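/- Let $d\ge 2$, $\alpha=\frac{d-1}{2}$, $\nu\in\mathbb R\setminus\{0\}$. On $\mathbb R^{1+d}$ (and, bilinearly, on $\mathbb C^{1+d}$) put $x\cdot y=x_0y_0-x_1y_1-\dots-x_dy_d$. Let $\mathcal C_+=\{\xi\in\mathbb R^{1+d}: \xi\cdot\xi=0,\ \xi_0>0\}$, let $\mathbb S^d\subset\mathbb R^{1+d}$ be the Euclidean unit sphere, $\mathcal I_+=\mathbb S^d\cap\mathcal C_+$, and $\mu(x)=x\cdot x$ for $x\in\mathbb S^d$, so that $\mu=0$ on $\mathcal I_+$. Set $$(\mu\pm i0)^{i\nu}=\theta(\mu)|\mu|^{i\nu}+e^{\mp\nu\pi}\theta(-\mu)|\mu|^{i\nu},\qquad a(\nu)=\frac{(2\pi)^{\alpha}\,2^{-i\nu}\,\Gamma(-i\nu)}{\Gamma(-i\nu+\alpha)},$$ where $\theta$ is the Heaviside function, and let $\omega=\sum_{i=1}^d(-1)^{i+1}\frac{\xi_i}{\xi_0}\,d\xi_1\wedge\dots\widehat{d\xi_i}\dots\wedge d\xi_d$; in the parametrization $\hat\xi\mapsto(1,\hat\xi)/\sqrt2$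 of $\mathcal I_+$ by $\mathbb S^{d-1}$, $\omega$ is $2^{-\alpha}$ times the standard area element. Powers $z^\lambda$ are principal. **Lemma.** Fix either sign $\pm$. (i) For every $\xi\in\mathcal C_+$, the boundary value $$(x_{\mathbb S}^{\pm}\cdot\xi)^{i\nu-\alpha}=\lim_{y\to0,\ y\cdot y>0,\ \pm y_0>0}\big((x+iy)\cdot\xi\big)^{i\nu-\alpha}\Big|_{x\in\mathbb S^d}$$ exists in the sense of distributions on $\mathbb S^d$. (ii) At $\mathcal I_+$ one has the asymptotics $$(x_{\mathbb S}^\pm\cdot\xi)^{i\nu-\alpha}\sim(\xi_+(x)\cdot\xi)^{i\nu-\alpha}+(\mu(x)\pm i0)^{i\nu}\,a(\nu)\,\delta(\xi_+(x),\xi),\qquad \xi_+(x)=\lim_{\mu\to0}x_{\mathbb S}\in\mathcal I_+,$$ in the following sense. There is an open neighbourhood $U$ of $\mathcal I_+$ in $\mathbb S^d$ such that for every smooth $\psi:\mathcal C_+\to\mathbb C$ homogeneous of degree $-i\nu-\alpha$ there exist $u^0,u^\pm\in C^\infty(\mathbb S^d)$ with $$\int_{\mathcal I_+}\omega(\xi)\,(x_{\mathbb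 S}^{\pm}\cdot\xi)^{i\nu-\alpha}\,\psi(\xi)=u^0(x)+(\mu(x)\pm i0)^{i\nu}\,u^{\pm}(x)$$ as distributions on $U$ (the left-hand side is paired with a test function before integrating in $\xi$, and that integral converges absolutely), and, for all $x\in\mathcal I_+$ (where $\xi_+(x)=x$), $$u^0(x)=\int_{\mathcal I_+}\omega(\xi)\,(x\cdot\xi)^{i\nu-\alpha}\,\psi(\xi),\qquad u^\pm(x)=a(\nu)\,\psi(x).$$ The integral for $u^0(x)$ is understood by analytic continuation: for $\operatorname{Re}s>0$ the integral $\int_{\mathcal I_+}\omega(\xi)(x\cdot\xi)^{s-\alpha}\psi(\xi)$ (with $\psi|_{\mathcal I_+}$ kept fixed) converges absolutely, it continues analytically from $\operatorname{Re}s>0$ to a neighbourhood of $s=i\nu$, and $u^0(x)$ is the value of the continuation at $s=i\nu$. -/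

import Mathlib

open MeasureTheory Filter Topology Metric
open scoped ContDiff Manifold

noncomputable section

namespace DeSitter

/-- Minkowski space `M^{1,d}`, i.e. `ℝ^{1+d}` (with its auxiliary Euclidean norm). -/
abbrev Mink (d : ℕ) : Type := EuclideanSpace ℝ (Fin (d + 1))

/-- The unit sphere `S^d` of `ℝ^{1+d}`. -/
abbrev Sph (d : ℕ) : Type := sphere (0 : Mink d) 1

/-- The unit sphere `S^{d-1}` of the space `ℝ^d` of the coordinates `x_1, …, x_d`. -/
abbrev AngSph (d : ℕ) : Type := sphere (0 : EuclideanSpace ℝ (Fin d)) 1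

/-- The bilinear product `x · y = x_0 y_0 - x_1 y_1 - ⋯ - x_d y_d`, on `ℝ^{1+d}` and on
`ℂ^{1+d}`. -/
def mdot {R : Type*} [CommRing R] {d : ℕ} (x y : Fin (d + 1) → R) : R :=
  x 0 * y 0 - ∑ i : Fin d, x i.succ * y i.succ

/-- The parameter `α = (d - 1) / 2`. -/
def alpha (d : ℕ) : ℝ := ((d : ℝ) - 1) / 2

/-- The future light cone `C_+`. -/
def futureCone (d : ℕ) : Set (Mink d) := {ξ | mdot ξ ξ = 0 ∧ 0 < ξ 0}

/-- The future conformal boundary `I_+`, the intersection of `S^d` with `C_+`. -/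
def scriPlus (d : ℕ) : Set (Sph d) := {x | (x : Mink d) ∈ futureCone d}

/-- The point `(‖η‖, η)`; this is a diffeomorphism from `ℝ^d ∖ {0}` onto `C_+`. -/
def conePoint {d : ℕ} (η : EuclideanSpace ℝ (Fin d)) : Mink d :=
  WithLp.toLp 2 (Fin.cons ‖η‖ (fun i => η i))

/-- The parametrization `ζ ↦ (1, ζ) / √2` of `I_+` by `S^{d-1}`. -/
def scriPoint {d : ℕ} (ζ : AngSph d) : Mink d :=
  (Real.sqrt 2)⁻¹ • conePoint (ζ : EuclideanSpace ℝ (Fin d))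

/-- Integration of the form `ω = ∑ i, (-1)^(i+1) (ξ_i / ξ_0) dξ_1 ∧ ⋯ (no dξ_i) ⋯ ∧ dξ_d` over
`I_+`, in the parametrization `ξ = (1, ζ) / √2`.  There `ξ_i / ξ_0 = ζ_i` and
`dξ_i = dζ_i / √2`, so `ω` is `2^(-(d-1)/2) = 2^(-α)` times the standard area form
`∑ i, (-1)^(i+1) ζ_i dζ_1 ∧ ⋯ (no dζ_i) ⋯ ∧ dζ_d` of `S^{d-1}`. -/
def omegaMeasure (d : ℕ) : Measure (AngSph d) :=
  ENNReal.ofReal ((2 : ℝ) ^ (-alpha d)) •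
    (volume : Measure (EuclideanSpace ℝ (Fin d))).toSphere

/-- Smooth complex functions on `S^d`. -/
def SmoothOnSphere {d : ℕ} (u : Sph d → ℂ) : Prop :=
  ContMDiff (𝓡 d) 𝓘(ℝ, ℂ) ∞ u

/-- Smooth complex functions on `C_+` that are homogeneous of degree `k` (the values of `ψ`
outside `C_+` play no role).  Restriction to `I_+` identifies them with the smooth functions
on `I_+`. -/
def IsSmoothHomogeneous (d : ℕ) (k : ℂ) (ψ : Mink d → ℂ) : Prop :=
  ContDiffOn ℝ ∞ (fun η : EuclideanSpace ℝ (Fin d) => ψ (conePoint η)) {0}ᶜ ∧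
    ∀ ξ ∈ futureCone d, ∀ t : ℝ, 0 < t → ψ (t • ξ) = (t : ℂ) ^ k * ψ ξ

/-- The cone of imaginary parts of the tuboid `T^ε`, for a sign `ε = ±1`:
`y · y > 0` and `ε y_0 > 0`. -/
def tubeCone (d : ℕ) (ε : ℤˣ) : Set (Mink d) :=
  {y | 0 < mdot y y ∧ 0 < ((ε : ℤ) : ℝ) * y 0}

/-- The pairing on `S^d` of `x ↦ ((x + i y) · ξ)^lam` with the test function `φ`. -/
def tubePairing {d : ℕ} (lam : ℂ) (ξ : Mink d) (φ : Sph d → ℂ) (y : Mink d) : ℂ :=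
  ∫ x : Sph d,
    (mdot (fun i => ((x : Mink d) i : ℂ) + Complex.I * (y i : ℂ)) (fun i => (ξ i : ℂ))) ^ lam
      * φ x ∂(volume : Measure (Mink d)).toSphere

/-- The sphere plane wave `(x_S^ε · ξ)^lam`, a distribution on `S^d`: its value on `φ` is the
limit of the pairings as `z = x + i y` tends to `x ∈ S^d` inside the tuboid `T^ε`. -/
def spherePlaneWave {d : ℕ} (ε : ℤˣ) (lam : ℂ) (ξ : Mink d) (φ : Sph d → ℂ) : ℂ :=
  limUnder (𝓝[tubeCone d ε] (0 : Mink d)) (tubePairing lam ξ φ)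

/-- The function `μ(x) = x · x / ρ(x)^2`, restricted to `S^d` (where `ρ = 1`). -/
def muFun {d : ℕ} (x : Sph d) : ℝ := mdot (x : Mink d) (x : Mink d) / ‖(x : Mink d)‖ ^ 2

/-- `(m + ε i 0)^(iν) = m_+^(iν) + e^(-ε ν π) m_-^(iν)`, with `m_±^(iν) = θ(±m) |m|^(iν)`; a
bounded function of `m`. -/
def i0Pow (ε : ℤˣ) (ν : ℝ) (m : ℝ) : ℂ :=
  (if 0 < m then ((|m| : ℝ) : ℂ) ^ (Complex.I * (ν : ℂ)) else 0) +
    ((Real.exp (-(((ε : ℤ) : ℝ) * ν * Real.pi)) : ℝ) : ℂ) *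
      (if m < 0 then ((|m| : ℝ) : ℂ) ^ (Complex.I * (ν : ℂ)) else 0)

/-- `a(ν) = (2π)^α 2^(-iν) Γ(-iν) / Γ(-iν + α)`. -/
def aCoeff (d : ℕ) (ν : ℝ) : ℂ :=
  ((2 * Real.pi : ℝ) : ℂ) ^ (alpha d : ℂ) * (2 : ℂ) ^ (-(Complex.I * (ν : ℂ))) *
    Complex.Gamma (-(Complex.I * (ν : ℂ))) /
      Complex.Gamma (-(Complex.I * (ν : ℂ)) + (alpha d : ℂ))

/-- The integrand `(x · ξ)^(s - α) ψ(ξ)` at the point `ξ = (1, ζ) / √2` of `I_+`. -/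
def boundaryIntegrand {d : ℕ} (ψ : Mink d → ℂ) (x : Mink d) (s : ℂ) (ζ : AngSph d) : ℂ :=
  ((mdot x (scriPoint ζ) : ℝ) : ℂ) ^ (s - (alpha d : ℂ)) * ψ (scriPoint ζ)

/-- `c` is the value at `s₀`, where `re s₀ = 0`, of the analytic continuation from `re s > 0` of
`∫_{I_+} ω(ξ) (x · ξ)^(s - α) ψ(ξ)`, for `x ∈ I_+`: the integral converges absolutely for
`re s > 0`, and it agrees there, near `s₀`, with a function that is analytic at `s₀` and takes
the value `c` at `s₀`. -/
def IsContinuedBoundaryIntegral {d : ℕ} (ψ : Mink d → ℂ) (x : Mink d) (s₀ c : ℂ) : Prop :=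
  (∀ s : ℂ, 0 < s.re → Integrable (boundaryIntegrand ψ x s) (omegaMeasure d)) ∧
    ∃ G : ℂ → ℂ, AnalyticAt ℂ G s₀ ∧ G s₀ = c ∧
      ∀ᶠ s in 𝓝[{s : ℂ | 0 < s.re}] s₀,
        G s = ∫ ζ, boundaryIntegrand ψ x s ζ ∂(omegaMeasure d)

end DeSitter

end

/-! ### The sphere measure: rotation invariance and slicing by hyperplanes. -/

noncomputable section

namespace DeSitter

/-! Throughout, n = d - 1 = 2α, and the two assertions rest on different one-dimensional reductions.

Existence. The product x · ξ is the Euclidean inner product of x with the space-reflected vector of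
ξ, and for y in the tube y · ξ has the sign ε. Hence the pairing is ‖ξ‖^p times the integral over
the sphere of (⟨N, x⟩ + iT)^p Φ(x), with N a unit vector and T tending to 0 from the side ε
(`tubePairing_eq`). Near the equator ⟨N, x⟩ = 0, slicing reduces this to ∫ (iT + v)^p G(v) dv with G
smooth and compactly supported. Integrating by parts until the exponent has nonnegative real part
makes the limit harmless; no denominator p + j vanishes because Im p = ν ≠ 0
(`exists_tendsto_integral_line`). Away from the equator the kernel is bounded. The bounds are
uniform over ξ in I_+, which gives absolute convergence of the ξ-integral and lets the limit along y
= (εt, 0) be exchanged with it.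

Asymptotics. For x = (x_0, rη) with ‖η‖ = 1, ξ = (1, ζ)/√2 and M = x_0/r - 1 one has x · ξ =
(r/√2)(M + 1 - ⟨η, ζ⟩). So the smeared wave is a zonal integral of (X + 1 - ⟨η, ζ⟩)^(iν - α) with X
→ M ± i0 (`waveIntegral_eq`). In the variable v = 1 - ⟨η, ζ⟩ the part near the pole ζ = η is ∫ (X +
v)^(iν - α) v^(α - 1) g(v, η) dv. Here g is smooth through v = 0: the mean of a smooth function over
a slice of radius √(v(2 - v)) is an even function of that radius, and the Fourier transform makes
this explicit (`contDiff_meanExt`). The part away from the pole is smooth in M.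

When d is even, the power v^(α - 1) is not an integer one. The Beta identity `integral_beta_kernel`
removes this difficulty in all dimensions: it writes (X + v)^(iν - α) v^(α - 1) as an average over τ
∈ [0, 1] of (Xτ + v)^(iν - n - 1) v^n. Then n + 1 integrations by parts in v leave only bounded
powers with exponent iν (`integral_eq_betaConst_mul`). On the real axis ∫ (M + v ± i0)^(iν) w'(v) dv
is shifted to y = M + v and split at y = 0: the part from y > 0 is smooth in M, and the rest is (M ±
i0)^(iν) times a smooth function, by scaling (`boundaryLayer_eq`). Homogeneity carries this
splitting through the τ-average. Finally μ = r(x_0 + r)M with a positive factor, so the singular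
power may be expressed in μ.

Coefficients. At M = 0 the singular part is Γ(-iν)Γ(α)/Γ(α - iν) times g(0, η), and g(0, η) contains
the area 2π^α/Γ(α) of the slice sphere; the product is a(ν)ψ (`waveSingular_of_mem_scriPlus`). The
regular part is -(iν)⁻¹ ∫ y^(iν) ∂_y g dy plus the far integral, which is the value at s = iν of the
continuation of ∫ y^(s - 1) g dy plus the far integral (`isContinuedBoundaryIntegral_waveRegular`).
-/

/-- The unit sphere measure, as a measure on the ambient space, is the pushforward of Lebesgue
measure on the punctured ball by radial projection. -/
theorem map_val_toSphere {E : Type*} [NormedAddCommGroup E] [NormedSpace ℝ E] [MeasurableSpace E]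
    [BorelSpace E] (μ : Measure E) :
    Measure.map (Subtype.val : sphere (0 : E) 1 → E) μ.toSphere =
      (Module.finrank ℝ E : ENNReal) •
        Measure.map (fun x : E => ‖x‖⁻¹ • x) (μ.restrict (ball 0 1 \ {0})) := by
  have hm : Measurable (fun x : E => ‖x‖⁻¹ • x) := by fun_prop
  ext A hA
  rw [Measure.map_apply measurable_subtype_coe hA,
    Measure.toSphere_apply' _ (measurable_subtype_coe hA), Measure.smul_apply,
    Measure.map_apply hm hA, Measure.restrict_apply (hm hA), smul_eq_mul]
  congr 2
  ext x
  constructor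
  · rintro ⟨r, hr, _, ⟨y, hy, rfl⟩, rfl⟩
    have hy1 : ‖(y : E)‖ = 1 := by simp
    have hn : ‖r • (y : E)‖ = r := by rw [norm_smul, hy1, Real.norm_of_nonneg hr.1.le, mul_one]
    refine ⟨?_, ?_, ?_⟩
    · change ‖r • (y : E)‖⁻¹ • r • (y : E) ∈ A
      rw [hn, smul_smul, inv_mul_cancel₀ hr.1.ne', one_smul]
      exact hy
    · simpa [hn] using hr.2
    · intro h
      rw [Set.mem_singleton_iff] at h
      change r • (y : E) = 0 at h
      rw [h, norm_zero] at hn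
      exact hr.1.ne hn
  · rintro ⟨hx, hx1, hx0⟩
    have h0 : ‖x‖ ≠ 0 := by simpa using hx0
    refine ⟨‖x‖, ⟨lt_of_le_of_ne (norm_nonneg _) h0.symm, by simpa using hx1⟩, ‖x‖⁻¹ • x,
      ⟨⟨‖x‖⁻¹ • x, by simp [norm_smul, h0]⟩, hx, rfl⟩, ?_⟩
    change ‖x‖ • ‖x‖⁻¹ • x = x
    rw [smul_smul, mul_inv_cancel₀ h0, one_smul]

/-- Invariance of the sphere measure under linear isometries. -/
theorem map_isometry_toSphere {E : Type*} [NormedAddCommGroup E] [InnerProductSpace ℝ E]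
    [FiniteDimensional ℝ E] [MeasurableSpace E] [BorelSpace E] (R : E ≃ₗᵢ[ℝ] E) :
    Measure.map (fun ζ : sphere (0 : E) 1 => R ζ) (volume : Measure E).toSphere =
      Measure.map Subtype.val (volume : Measure E).toSphere := by
  have hm : Measurable (fun x : E => ‖x‖⁻¹ • x) := by fun_prop
  have hR : Measurable R := R.continuous.measurable
  rw [show (fun ζ : sphere (0 : E) 1 => R ζ) = R ∘ Subtype.val from rfl,
    ← Measure.map_map hR measurable_subtype_coe, map_val_toSphere, Measure.map_smul,
    Measure.map_map hR hm]
  congr 1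
  have : R ∘ (fun x : E => ‖x‖⁻¹ • x) = (fun x : E => ‖x‖⁻¹ • x) ∘ R := by
    funext x; simp
  rw [this, ← Measure.map_map hm hR]
  congr 1
  have hs : (ball (0 : E) 1 \ {0}) = R ⁻¹' (ball (0 : E) 1 \ {0}) := by
    ext x; simp
  have h2 := (R.measurePreserving).restrict_preimage
    (s := ball (0 : E) 1 \ {0}) (measurableSet_ball.diff (measurableSet_singleton _))
  rw [← hs] at h2
  exact h2.map_eq

theorem lintegral_sphere_eq_ball {E : Type*} [NormedAddCommGroup E] [NormedSpace ℝ E]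
    [MeasurableSpace E] [BorelSpace E] (μ : Measure E) {F : E → ENNReal} (hF : Measurable F) :
    ∫⁻ ζ : sphere (0 : E) 1, F ζ ∂μ.toSphere =
      (Module.finrank ℝ E : ENNReal) * ∫⁻ x in ball 0 1 \ {0}, F (‖x‖⁻¹ • x) ∂μ := by
  have hm : Measurable (fun x : E => ‖x‖⁻¹ • x) := by fun_prop
  rw [← lintegral_map hF measurable_subtype_coe, map_val_toSphere, lintegral_smul_measure,
    lintegral_map hF hm, smul_eq_mul]

/-- Polar coordinates for the lower Lebesgue integral. -/
theorem lintegral_polar {E : Type*} [NormedAddCommGroup E] [NormedSpace ℝ E] [Nontrivial E]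
    [FiniteDimensional ℝ E] [MeasurableSpace E] [BorelSpace E] (μ : Measure E)
    [μ.IsAddHaarMeasure] {F : E → ENNReal} (hF : Measurable F) :
    ∫⁻ x, F x ∂μ = ∫⁻ ζ : sphere (0 : E) 1, ∫⁻ r in Set.Ioi (0 : ℝ),
      ENNReal.ofReal (r ^ (Module.finrank ℝ E - 1)) * F (r • (ζ : E)) ∂volume ∂μ.toSphere := by
  have h1 : ∫⁻ x, F x ∂μ = ∫⁻ x : ({(0)}ᶜ : Set E), F x ∂(μ.comap (↑)) := by
    rw [lintegral_subtype_comap (measurableSet_singleton _).compl F, restrict_compl_singleton]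
  have h2 := (μ.measurePreserving_homeomorphUnitSphereProd).lintegral_comp_emb
    (Homeomorph.measurableEmbedding _)
    (fun p : sphere (0 : E) 1 × Set.Ioi (0 : ℝ) => F ((p.2 : ℝ) • (p.1 : E)))
  have h3 : ∀ x : ({(0)}ᶜ : Set E), F ((((homeomorphUnitSphereProd E) x).2 : ℝ) •
      (((homeomorphUnitSphereProd E) x).1 : E)) = F x := by
    intro x
    have h0 : ‖(x : E)‖ ≠ 0 := norm_ne_zero_iff.2 x.2
    simp [smul_smul, h0]
  simp only [h3] at h2
  rw [h1, h2, lintegral_prod _ (by fun_prop)]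
  refine lintegral_congr fun ζ => ?_
  rw [Measure.volumeIoiPow, lintegral_withDensity_eq_lintegral_mul _ (by fun_prop) (by fun_prop)]
  exact lintegral_subtype_comap measurableSet_Ioi
    (fun r : ℝ => ENNReal.ofReal (r ^ (Module.finrank ℝ E - 1)) * F (r • (ζ : E)))

/-- The point `(c, w)` of `ℝ^{n+1}`. -/
def consPt {n : ℕ} (c : ℝ) (w : EuclideanSpace ℝ (Fin n)) : EuclideanSpace ℝ (Fin (n + 1)) :=
  WithLp.toLp 2 (Fin.cons c (fun i => w i))

@[simp] theorem consPt_zero {n : ℕ} (c : ℝ) (w : EuclideanSpace ℝ (Fin n)) :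
    consPt c w 0 = c := rfl

@[simp] theorem consPt_succ {n : ℕ} (c : ℝ) (w : EuclideanSpace ℝ (Fin n)) (i : Fin n) :
    consPt c w i.succ = w i := rfl

theorem consPt_add {n : ℕ} (c c' : ℝ) (w w' : EuclideanSpace ℝ (Fin n)) :
    consPt (c + c') (w + w') = consPt c w + consPt c' w' := by
  ext i; refine Fin.cases ?_ (fun i => ?_) i <;> simp

theorem consPt_smul {n : ℕ} (a c : ℝ) (w : EuclideanSpace ℝ (Fin n)) :
    consPt (a * c) (a • w) = a • consPt c w := by
  ext i; refine Fin.cases ?_ (fun i => ?_) i <;> simp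

theorem norm_consPt_sq {n : ℕ} (c : ℝ) (w : EuclideanSpace ℝ (Fin n)) :
    ‖consPt c w‖ ^ 2 = c ^ 2 + ‖w‖ ^ 2 := by
  simp [EuclideanSpace.norm_sq_eq, Fin.sum_univ_succ]

theorem norm_consPt {n : ℕ} (c : ℝ) (w : EuclideanSpace ℝ (Fin n)) :
    ‖consPt c w‖ = √(c ^ 2 + ‖w‖ ^ 2) := by
  rw [← norm_consPt_sq, Real.sqrt_sq (norm_nonneg _)]

theorem inner_consPt {n : ℕ} (c c' : ℝ) (w w' : EuclideanSpace ℝ (Fin n)) :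
    inner ℝ (consPt c w) (consPt c' w') = c * c' + inner ℝ w w' := by
  simp [PiLp.inner_apply, Fin.sum_univ_succ, mul_comm]

/-- `(c, w) ↦ consPt c w` as a continuous linear equivalence. -/
def consCLM (n : ℕ) : ℝ × EuclideanSpace ℝ (Fin n) →L[ℝ] EuclideanSpace ℝ (Fin (n + 1)) :=
  LinearMap.toContinuousLinearMap
    { toFun := fun p => consPt p.1 p.2
      map_add' := fun _ _ => consPt_add _ _ _ _
      map_smul' := fun _ _ => consPt_smul _ _ _ }

theorem measurePreserving_consPt (n : ℕ) :
    MeasurePreserving (fun p : ℝ × EuclideanSpace ℝ (Fin n) => consPt p.1 p.2) := by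
  have h1 := (volume_preserving_piFinSuccAbove (fun _ : Fin (n + 1) => ℝ) 0).symm
  have h2 := (PiLp.volume_preserving_toLp (Fin (n + 1)))
  have h3 : MeasurePreserving (Prod.map (id : ℝ → ℝ)
      (WithLp.ofLp : EuclideanSpace ℝ (Fin n) → (Fin n → ℝ))) :=
    (MeasurePreserving.id volume).prod (PiLp.volume_preserving_ofLp (Fin n))
  have h4 := h2.comp (h1.comp h3)
  convert h4 using 1
  funext p
  ext i
  refine Fin.cases ?_ (fun i => ?_) i <;> simp [MeasurableEquiv.piFinSuccAbove]

theorem continuous_consPt {n : ℕ} :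
    Continuous fun p : ℝ × EuclideanSpace ℝ (Fin n) => consPt p.1 p.2 :=
  (consCLM n).continuous


/-- The map `c ↦ c / √(1 - c²)` from `(-1, 1)` onto `ℝ` has derivative `(1 - c²)^(-3/2)`. -/
theorem hasDerivAt_div_sqrt {c : ℝ} (hc : c ∈ Set.Ioo (-1 : ℝ) 1) (r : ℝ) :
    HasDerivAt (fun c : ℝ => r * (c / √(1 - c ^ 2))) (r * (√(1 - c ^ 2) ^ 3)⁻¹) c := by
  have h0 : 0 < 1 - c ^ 2 := by nlinarith [hc.1, hc.2]
  have hs : √(1 - c ^ 2) ≠ 0 := (Real.sqrt_pos.2 h0).ne'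
  have h1 : HasDerivAt (fun c : ℝ => 1 - c ^ 2) (-(2 * c)) c := by
    simpa using ((hasDerivAt_id c).pow 2).const_sub 1
  have h2 := ((hasDerivAt_id c).div (h1.sqrt h0.ne') hs).const_mul r
  have h4 : √(1 - c ^ 2) ^ 2 = 1 - c ^ 2 := Real.sq_sqrt h0.le
  refine h2.congr_deriv ?_
  simp only [id]
  field_simp
  rw [h4]
  ring

theorem image_div_sqrt {r : ℝ} (hr : 0 < r) :
    (fun c : ℝ => r * (c / √(1 - c ^ 2))) '' Set.Ioo (-1) 1 = Set.univ := by
  refine Set.eq_univ_of_forall fun a => ⟨a / √(r ^ 2 + a ^ 2), ?_, ?_⟩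
  · have h1 : 0 < r ^ 2 + a ^ 2 := by positivity
    have h2 : |a| < √(r ^ 2 + a ^ 2) := by
      rw [← Real.sqrt_sq_eq_abs]; exact Real.sqrt_lt_sqrt (sq_nonneg _) (by nlinarith)
    have h3 : 0 < √(r ^ 2 + a ^ 2) := Real.sqrt_pos.2 h1
    rw [abs_lt] at h2
    constructor
    · rw [lt_div_iff₀ h3]; linarith
    · rw [div_lt_iff₀ h3]; linarith
  · have h1 : 0 < r ^ 2 + a ^ 2 := by positivity
    have h3 : 0 < √(r ^ 2 + a ^ 2) := Real.sqrt_pos.2 h1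
    have h4 : 1 - (a / √(r ^ 2 + a ^ 2)) ^ 2 = (r / √(r ^ 2 + a ^ 2)) ^ 2 := by
      rw [div_pow, div_pow, Real.sq_sqrt h1.le]; field_simp; ring
    simp only [h4]
    rw [Real.sqrt_sq (by positivity)]
    field_simp

theorem injOn_div_sqrt {r : ℝ} (hr : 0 < r) :
    Set.InjOn (fun c : ℝ => r * (c / √(1 - c ^ 2))) (Set.Ioo (-1) 1) := by
  have : StrictMonoOn (fun c : ℝ => r * (c / √(1 - c ^ 2))) (Set.Ioo (-1) 1) := by
    refine strictMonoOn_of_deriv_pos (convex_Ioo _ _)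
      (fun c hc => (hasDerivAt_div_sqrt hc r).continuousAt.continuousWithinAt) fun c hc => ?_
    rw [interior_Ioo] at hc
    rw [(hasDerivAt_div_sqrt hc r).deriv]
    have h0 : 0 < 1 - c ^ 2 := by nlinarith [hc.1, hc.2]
    have := Real.sqrt_pos.2 h0
    positivity
  exact this.injOn

theorem lintegral_pow_Ioo (n : ℕ) {b : ℝ} (hb : 0 ≤ b) :
    ∫⁻ r in Set.Ioo 0 b, ENNReal.ofReal (r ^ n) = ENNReal.ofReal (b ^ (n + 1) / (n + 1)) := by
  rw [Measure.restrict_congr_set Ioo_ae_eq_Ioc, ← ofReal_integral_eq_lintegral_ofReal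
    (intervalIntegral.intervalIntegrable_pow n).1, ← intervalIntegral.integral_of_le hb]
  · simp
  · filter_upwards [ae_restrict_mem measurableSet_Ioc] with y hy
    exact pow_nonneg hy.1.le _

/-- Slicing the unit sphere of `ℝ^{n+1}` by the hyperplanes `x_0 = c`. -/
theorem lintegral_sphere_slice {n : ℕ} (hn : 1 ≤ n) {F : EuclideanSpace ℝ (Fin (n + 1)) → ENNReal}
    (hF : Measurable F) :
    ∫⁻ ζ : sphere (0 : EuclideanSpace ℝ (Fin (n + 1))) 1, F ζ
        ∂(volume : Measure (EuclideanSpace ℝ (Fin (n + 1)))).toSphere =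
      ∫⁻ c in Set.Ioo (-1 : ℝ) 1, ∫⁻ u : sphere (0 : EuclideanSpace ℝ (Fin n)) 1,
        ENNReal.ofReal ((1 - c ^ 2) ^ ((n : ℝ) / 2 - 1)) * F (consPt c (√(1 - c ^ 2) • u))
        ∂(volume : Measure (EuclideanSpace ℝ (Fin n))).toSphere := by
  have : Nonempty (Fin n) := ⟨⟨0, hn⟩⟩
  have : Nontrivial (EuclideanSpace ℝ (Fin n)) := inferInstance
  have hmc : Measurable (fun p : ℝ × EuclideanSpace ℝ (Fin n) => consPt p.1 p.2) :=
    continuous_consPt.measurable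
  set B : Set (EuclideanSpace ℝ (Fin (n + 1))) := ball 0 1 \ {0} with hB
  have hBm : MeasurableSet B := measurableSet_ball.diff (measurableSet_singleton _)
  set H : EuclideanSpace ℝ (Fin (n + 1)) → ENNReal := B.indicator (fun x => F (‖x‖⁻¹ • x)) with hH
  have hHm : Measurable H := (hF.comp (by fun_prop)).indicator hBm
  rw [lintegral_sphere_eq_ball _ hF, ← lintegral_indicator hBm, ← hH,
    ← (measurePreserving_consPt n).lintegral_comp hHm, Measure.volume_eq_prod,
    lintegral_prod_symm (fun p : ℝ × EuclideanSpace ℝ (Fin n) => H (consPt p.1 p.2))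
      (hHm.comp hmc).aemeasurable,
    lintegral_polar volume (F := fun w => ∫⁻ a, H (consPt a w))
      (Measurable.lintegral_prod_left' (f := fun p : ℝ × EuclideanSpace ℝ (Fin n) =>
        H (consPt p.1 p.2)) (hHm.comp hmc))]
  have key : ∀ u : sphere (0 : EuclideanSpace ℝ (Fin n)) 1,
      ((n : ENNReal) + 1) * ∫⁻ r in Set.Ioi (0 : ℝ), ENNReal.ofReal (r ^ (n - 1)) *
        ∫⁻ a, H (consPt a (r • (u : EuclideanSpace ℝ (Fin n)))) =
      ∫⁻ c in Set.Ioo (-1 : ℝ) 1, ENNReal.ofReal ((1 - c ^ 2) ^ ((n : ℝ) / 2 - 1)) *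
        F (consPt c (√(1 - c ^ 2) • u)) := by
    intro u
    have hu : ‖(u : EuclideanSpace ℝ (Fin n))‖ = 1 := by simp
    -- For fixed r the substitution a = r c / √(1 - c²) parametrizes the line by the height c of the
    -- radial projection of (a, r u). That point has norm r / √(1 - c²), so the unit ball becomes r
    -- < √(1 - c²).
    have hA : ∀ r ∈ Set.Ioi (0 : ℝ), ENNReal.ofReal (r ^ (n - 1)) *
        ∫⁻ a, H (consPt a (r • (u : EuclideanSpace ℝ (Fin n)))) =
        ∫⁻ c in Set.Ioo (-1 : ℝ) 1, (Set.Ioo 0 (√(1 - c ^ 2))).indicator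
          (fun r => ENNReal.ofReal (r ^ n)) r * (ENNReal.ofReal ((√(1 - c ^ 2) ^ 3)⁻¹) *
          F (consPt c (√(1 - c ^ 2) • u))) := by
      intro r hr
      have hr : 0 < r := hr
      rw [← setLIntegral_univ (fun a => H (consPt a (r • (u : EuclideanSpace ℝ (Fin n))))),
        ← image_div_sqrt hr, lintegral_image_eq_lintegral_abs_deriv_mul measurableSet_Ioo
          (fun c hc => (hasDerivAt_div_sqrt hc r).hasDerivWithinAt) (injOn_div_sqrt hr),
        ← lintegral_const_mul' _ _ ENNReal.ofReal_ne_top]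
      refine setLIntegral_congr_fun measurableSet_Ioo fun c hc => ?_
      have h0 : 0 < 1 - c ^ 2 := by nlinarith [hc.1, hc.2]
      have hs : 0 < √(1 - c ^ 2) := Real.sqrt_pos.2 h0
      have hpt : consPt (r * (c / √(1 - c ^ 2))) (r • (u : EuclideanSpace ℝ (Fin n))) =
          (r / √(1 - c ^ 2)) • consPt c (√(1 - c ^ 2) • (u : EuclideanSpace ℝ (Fin n))) := by
        rw [← consPt_smul, smul_smul]
        congr 1
        · ring
        · congr 1; field_simp
      have hn1 : ‖consPt c (√(1 - c ^ 2) • (u : EuclideanSpace ℝ (Fin n)))‖ = 1 := by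
        rw [norm_consPt, norm_smul, hu, Real.norm_of_nonneg hs.le, mul_one, Real.sq_sqrt h0.le]
        simp
      have hn2 : ‖consPt (r * (c / √(1 - c ^ 2))) (r • (u : EuclideanSpace ℝ (Fin n)))‖ =
          r / √(1 - c ^ 2) := by
        rw [hpt, norm_smul, hn1, mul_one, Real.norm_of_nonneg (by positivity)]
      have hHv : H (consPt (r * (c / √(1 - c ^ 2))) (r • (u : EuclideanSpace ℝ (Fin n)))) =
          (Set.Ioo 0 (√(1 - c ^ 2))).indicator
            (fun _ => F (consPt c (√(1 - c ^ 2) • u))) r := by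
        have hnz : r / √(1 - c ^ 2) ≠ 0 := by positivity
        by_cases hlt : r < √(1 - c ^ 2)
        · rw [Set.indicator_of_mem (by exact ⟨hr, hlt⟩), hH, Set.indicator_of_mem, hn2, hpt,
            smul_smul, inv_mul_cancel₀ hnz, one_smul]
          refine ⟨?_, ?_⟩
          · rw [mem_ball_zero_iff, hn2, div_lt_one hs]; exact hlt
          · rw [Set.mem_singleton_iff, ← norm_eq_zero, hn2]; exact hnz
        · rw [Set.indicator_of_notMem (fun h => hlt h.2), hH, Set.indicator_of_notMem]
          rintro ⟨h1, -⟩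
          rw [mem_ball_zero_iff, hn2, div_lt_one hs] at h1
          exact hlt h1
      rw [hHv]
      by_cases hlt : r < √(1 - c ^ 2)
      · rw [Set.indicator_of_mem (by exact ⟨hr, hlt⟩), Set.indicator_of_mem (by exact ⟨hr, hlt⟩),
          abs_of_pos (by positivity), ENNReal.ofReal_mul hr.le, ← mul_assoc, ← mul_assoc,
          ← mul_assoc, ← ENNReal.ofReal_mul (by positivity), ← pow_succ, Nat.sub_add_cancel hn]
      · rw [Set.indicator_of_notMem (fun h => hlt h.2), Set.indicator_of_notMem (fun h => hlt h.2)]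
        simp
    rw [setLIntegral_congr_fun measurableSet_Ioi hA, lintegral_lintegral_swap,
      ← lintegral_const_mul' _ _ (by finiteness)]
    · refine setLIntegral_congr_fun measurableSet_Ioo fun c hc => ?_
      have h0 : 0 < 1 - c ^ 2 := by nlinarith [hc.1, hc.2]
      have hs : 0 < √(1 - c ^ 2) := Real.sqrt_pos.2 h0
      rw [lintegral_mul_const _ (by
          exact Measurable.indicator (by fun_prop) measurableSet_Ioo),
        lintegral_indicator measurableSet_Ioo, Measure.restrict_restrict measurableSet_Ioo,
        Set.inter_eq_left.2 (fun x hx => hx.1), lintegral_pow_Ioo n hs.le, ← mul_assoc,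
        ← mul_assoc]
      congr 1
      rw [show ((n : ENNReal) + 1) = ENNReal.ofReal ((n : ℝ) + 1) by
          rw [ENNReal.ofReal_add (by positivity) (by positivity)]; simp,
        ← ENNReal.ofReal_mul (by positivity), ← ENNReal.ofReal_mul (by positivity)]
      congr 1
      -- The r-integral gives √(1 - c²)^(n+1) / (n+1). The dimension n+1 cancels, and the Jacobian
      -- √(1 - c²)^(-3) leaves √(1 - c²)^(n-2).
      have e1 : √(1 - c ^ 2) = (1 - c ^ 2) ^ (1 / 2 : ℝ) := Real.sqrt_eq_rpow _
      rw [mul_div_cancel₀ _ (by positivity), e1]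
      generalize 1 - c ^ 2 = a at h0
      rw [← Real.rpow_natCast, ← Real.rpow_natCast,
        ← Real.rpow_mul h0.le, ← Real.rpow_mul h0.le, ← Real.rpow_neg h0.le,
        ← Real.rpow_add h0]
      congr 1
      push_cast
      ring
    · refine Measurable.aemeasurable ?_
      refine Measurable.mul ?_ (Measurable.mul (by fun_prop) ?_)
      · have : (Function.uncurry fun (r c : ℝ) => (Set.Ioo 0 (√(1 - c ^ 2))).indicator
            (fun r => ENNReal.ofReal (r ^ n)) r) =
            Set.indicator {p : ℝ × ℝ | 0 < p.1 ∧ p.1 < √(1 - p.2 ^ 2)}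
              (fun p => ENNReal.ofReal (p.1 ^ n)) := by
          funext p
          simp [Function.uncurry, Set.indicator, Set.mem_Ioo]
        change Measurable (Function.uncurry fun (r c : ℝ) => (Set.Ioo 0 (√(1 - c ^ 2))).indicator
            (fun r => ENNReal.ofReal (r ^ n)) r)
        rw [this]
        refine Measurable.indicator (by fun_prop) ?_
        exact (measurableSet_lt measurable_const measurable_fst).inter
          (measurableSet_lt measurable_fst (g := fun p : ℝ × ℝ => √(1 - p.2 ^ 2)) (by fun_prop))
      · exact hF.comp (hmc.comp (by fun_prop : Measurable fun p : ℝ × ℝ =>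
          (p.2, √(1 - p.2 ^ 2) • (u : EuclideanSpace ℝ (Fin n)))))
  simp only [finrank_euclideanSpace, Fintype.card_fin, Nat.cast_add, Nat.cast_one]
  rw [← lintegral_const_mul' _ _ (by finiteness), lintegral_congr key, lintegral_lintegral_swap]
  refine Measurable.aemeasurable ?_
  refine Measurable.mul (by fun_prop) ?_
  exact hF.comp (hmc.comp (by fun_prop :
    Measurable fun p : sphere (0 : EuclideanSpace ℝ (Fin n)) 1 × ℝ =>
      (p.2, √(1 - p.2 ^ 2) • (p.1 : EuclideanSpace ℝ (Fin n)))))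

/-- The weighted measure `(1 - c²)^(n/2 - 1) dc` on `(-1, 1)`. -/
def sliceMeasure (n : ℕ) : Measure ℝ :=
  (volume.restrict (Set.Ioo (-1 : ℝ) 1)).withDensity
    fun c => ENNReal.ofReal ((1 - c ^ 2) ^ ((n : ℝ) / 2 - 1))

theorem measurable_sliceDensity (n : ℕ) :
    Measurable fun c : ℝ => ENNReal.ofReal ((1 - c ^ 2) ^ ((n : ℝ) / 2 - 1)) := by
  fun_prop

instance (n : ℕ) : SFinite (sliceMeasure n) := by
  unfold sliceMeasure; infer_instance

theorem measurable_slicePt (n : ℕ) :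
    Measurable fun p : ℝ × sphere (0 : EuclideanSpace ℝ (Fin n)) 1 =>
      consPt p.1 (√(1 - p.1 ^ 2) • (p.2 : EuclideanSpace ℝ (Fin n))) :=
  continuous_consPt.measurable.comp
    (by fun_prop : Measurable fun p : ℝ × sphere (0 : EuclideanSpace ℝ (Fin n)) 1 =>
      (p.1, √(1 - p.1 ^ 2) • (p.2 : EuclideanSpace ℝ (Fin n))))

/-- The slicing formula for nonnegative functions upgrades to an equality of measures, through which
integrability and Bochner integrals of complex functions transfer together. -/
theorem map_slicePt {n : ℕ} (hn : 1 ≤ n) :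
    Measure.map (fun p : ℝ × sphere (0 : EuclideanSpace ℝ (Fin n)) 1 =>
        consPt p.1 (√(1 - p.1 ^ 2) • (p.2 : EuclideanSpace ℝ (Fin n))))
      ((sliceMeasure n).prod (volume : Measure (EuclideanSpace ℝ (Fin n))).toSphere) =
    Measure.map (Subtype.val : sphere (0 : EuclideanSpace ℝ (Fin (n + 1))) 1 → _)
      (volume : Measure (EuclideanSpace ℝ (Fin (n + 1)))).toSphere := by
  refine Measure.ext_of_lintegral _ fun F hF => ?_
  rw [lintegral_map hF (measurable_slicePt n), lintegral_map hF measurable_subtype_coe,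
    lintegral_sphere_slice hn hF, lintegral_prod
      (fun p : ℝ × sphere (0 : EuclideanSpace ℝ (Fin n)) 1 =>
        F (consPt p.1 (√(1 - p.1 ^ 2) • (p.2 : EuclideanSpace ℝ (Fin n)))))
      (hF.comp (measurable_slicePt n)).aemeasurable,
    sliceMeasure, lintegral_withDensity_eq_lintegral_mul _ (measurable_sliceDensity n)]
  · refine lintegral_congr fun c => ?_
    rw [Pi.mul_apply, lintegral_const_mul' _ _ ENNReal.ofReal_ne_top]
  · exact Measurable.lintegral_prod_right' (hF.comp (measurable_slicePt n))

theorem integrable_sphere_iff_slice {n : ℕ} (hn : 1 ≤ n)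
    {F : EuclideanSpace ℝ (Fin (n + 1)) → ℂ} (hF : Measurable F) :
    Integrable (fun ζ : sphere (0 : EuclideanSpace ℝ (Fin (n + 1))) 1 => F ζ)
        (volume : Measure (EuclideanSpace ℝ (Fin (n + 1)))).toSphere ↔
      Integrable (fun p : ℝ × sphere (0 : EuclideanSpace ℝ (Fin n)) 1 =>
        F (consPt p.1 (√(1 - p.1 ^ 2) • (p.2 : EuclideanSpace ℝ (Fin n)))))
        ((sliceMeasure n).prod (volume : Measure (EuclideanSpace ℝ (Fin n))).toSphere) := by
  have h1 := integrable_map_measure (f := Subtype.val)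
    (μ := (volume : Measure (EuclideanSpace ℝ (Fin (n + 1)))).toSphere)
    hF.aestronglyMeasurable measurable_subtype_coe.aemeasurable
  have h2 := integrable_map_measure (μ := ((sliceMeasure n).prod
    (volume : Measure (EuclideanSpace ℝ (Fin n))).toSphere))
    hF.aestronglyMeasurable (measurable_slicePt n).aemeasurable
  rw [map_slicePt hn] at h2
  exact h1.symm.trans h2

theorem integral_sphere_eq_slice {n : ℕ} (hn : 1 ≤ n)
    {F : EuclideanSpace ℝ (Fin (n + 1)) → ℂ} (hF : Measurable F) :
    ∫ ζ : sphere (0 : EuclideanSpace ℝ (Fin (n + 1))) 1, F ζ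
        ∂(volume : Measure (EuclideanSpace ℝ (Fin (n + 1)))).toSphere =
      ∫ p : ℝ × sphere (0 : EuclideanSpace ℝ (Fin n)) 1,
        F (consPt p.1 (√(1 - p.1 ^ 2) • (p.2 : EuclideanSpace ℝ (Fin n))))
        ∂((sliceMeasure n).prod (volume : Measure (EuclideanSpace ℝ (Fin n))).toSphere) := by
  rw [← integral_map measurable_subtype_coe.aemeasurable hF.aestronglyMeasurable,
    ← map_slicePt hn, integral_map (measurable_slicePt n).aemeasurable hF.aestronglyMeasurable]

theorem integrable_sphere_isometry {E : Type*} [NormedAddCommGroup E] [InnerProductSpace ℝ E]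
    [FiniteDimensional ℝ E] [MeasurableSpace E] [BorelSpace E] (R : E ≃ₗᵢ[ℝ] E)
    {F : E → ℂ} (hF : Measurable F) :
    Integrable (fun ζ : sphere (0 : E) 1 => F (R ζ)) (volume : Measure E).toSphere ↔
      Integrable (fun ζ : sphere (0 : E) 1 => F ζ) (volume : Measure E).toSphere := by
  have hR : Measurable (fun ζ : sphere (0 : E) 1 => R ζ) :=
    R.continuous.measurable.comp measurable_subtype_coe
  have h1 := integrable_map_measure (μ := (volume : Measure E).toSphere)
    hF.aestronglyMeasurable hR.aemeasurable
  have h2 := integrable_map_measure (μ := (volume : Measure E).toSphere) (f := Subtype.val)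
    hF.aestronglyMeasurable measurable_subtype_coe.aemeasurable
  rw [map_isometry_toSphere] at h1
  exact h1.symm.trans h2

theorem integral_sphere_isometry {E : Type*} [NormedAddCommGroup E] [InnerProductSpace ℝ E]
    [FiniteDimensional ℝ E] [MeasurableSpace E] [BorelSpace E] (R : E ≃ₗᵢ[ℝ] E)
    {F : E → ℂ} (hF : Measurable F) :
    ∫ ζ : sphere (0 : E) 1, F (R ζ) ∂(volume : Measure E).toSphere =
      ∫ ζ : sphere (0 : E) 1, F ζ ∂(volume : Measure E).toSphere := by
  have hR : Measurable (fun ζ : sphere (0 : E) 1 => R ζ) :=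
    R.continuous.measurable.comp measurable_subtype_coe
  rw [← integral_map hR.aemeasurable hF.aestronglyMeasurable, map_isometry_toSphere,
    integral_map measurable_subtype_coe.aemeasurable hF.aestronglyMeasurable]

/-- Any unit vector is moved to any other one by a linear isometry. -/
theorem exists_isometry_apply_eq {E : Type*} [NormedAddCommGroup E] [InnerProductSpace ℝ E]
    [FiniteDimensional ℝ E] {v w : E} (h : ‖v‖ = ‖w‖) : ∃ R : E ≃ₗᵢ[ℝ] E, R v = w :=
  ⟨(ℝ ∙ (v - w))ᗮ.reflection, Submodule.reflection_sub h⟩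

end DeSitter

end

/-! ### Smooth dependence of integrals on parameters. -/

noncomputable section

namespace DeSitter

section Parametric

variable {X V Y : Type} [NormedAddCommGroup X] [NormedSpace ℝ X]
  [NormedAddCommGroup V] [NormedSpace ℝ V] [MeasurableSpace Y] {μ : Measure Y}

/-- All joint derivatives of `H` at `(x, v y)`, weighted by `c y`, are locally uniformly in
`x ∈ O` dominated by integrable functions of `y`. -/
def DerivDominated {F : Type} [NormedAddCommGroup F] [NormedSpace ℝ F] (μ : Measure Y)
    (O : Set X) (v : Y → V) (c : Y → ℂ) (H : X × V → F) : Prop :=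
  ∀ k : ℕ, ∀ x₀ ∈ O, ∃ u ∈ 𝓝 x₀, ∃ b : Y → ℝ, Integrable b μ ∧
    ∀ x ∈ u, ∀ y, ‖c y‖ * ‖iteratedFDeriv ℝ k H (x, v y)‖ ≤ b y

/-- The partial derivative in the first variable. -/
def partialFDeriv {F : Type} [NormedAddCommGroup F] [NormedSpace ℝ F] (H : X × V → F) :
    X × V → (X →L[ℝ] F) :=
  fun p => (fderiv ℝ H p).comp (ContinuousLinearMap.inl ℝ X V)

variable {F : Type} [NormedAddCommGroup F] [NormedSpace ℝ F]

theorem partialFDeriv_eq (H : X × V → F) : partialFDeriv H =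
    ((ContinuousLinearMap.compL ℝ X (X × V) F).flip (ContinuousLinearMap.inl ℝ X V)) ∘
      fderiv ℝ H := by
  funext p; rfl

theorem contDiffOn_partialFDeriv {O : Set X} (hO : IsOpen O) {H : X × V → F}
    (hH : ContDiffOn ℝ ∞ H (O ×ˢ Set.univ)) :
    ContDiffOn ℝ ∞ (partialFDeriv H) (O ×ˢ Set.univ) := by
  rw [partialFDeriv_eq]
  exact (ContinuousLinearMap.contDiff _).comp_contDiffOn
    ((contDiffOn_infty_iff_fderiv_of_isOpen (hO.prod isOpen_univ)).1 hH).2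

/-- A partial derivative costs one more joint derivative, so the bound of order k + 1 serves at
order k. This stability is what lets the smoothness induction run. -/
theorem derivDominated_partialFDeriv {O : Set X} (hO : IsOpen O) {H : X × V → F} {v : Y → V}
    {c : Y → ℂ} (hH : ContDiffOn ℝ ∞ H (O ×ˢ Set.univ)) (hb : DerivDominated μ O v c H) :
    DerivDominated μ O v c (partialFDeriv H) := by
  intro k x₀ hx₀
  obtain ⟨u, hu, b, hbi, hub⟩ := hb (k + 1) x₀ hx₀
  set L := ((ContinuousLinearMap.compL ℝ X (X × V) F).flip (ContinuousLinearMap.inl ℝ X V))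
  refine ⟨u ∩ O, inter_mem hu (hO.mem_nhds hx₀), fun y => ‖L‖ * b y, hbi.const_mul _,
    fun x hx y => ?_⟩
  have h1 : ContDiffAt ℝ ∞ (fderiv ℝ H) (x, v y) :=
    ((contDiffOn_infty_iff_fderiv_of_isOpen (hO.prod isOpen_univ)).1 hH).2.contDiffAt
      ((hO.prod isOpen_univ).mem_nhds ⟨hx.2, trivial⟩)
  have h2 := L.norm_iteratedFDeriv_comp_left (n := k) h1 (by exact_mod_cast le_top)
  rw [norm_iteratedFDeriv_fderiv] at h2
  rw [partialFDeriv_eq]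
  calc ‖c y‖ * ‖iteratedFDeriv ℝ k (L ∘ fderiv ℝ H) (x, v y)‖
      ≤ ‖c y‖ * (‖L‖ * ‖iteratedFDeriv ℝ (k + 1) H (x, v y)‖) := by gcongr
    _ = ‖L‖ * (‖c y‖ * ‖iteratedFDeriv ℝ (k + 1) H (x, v y)‖) := by ring
    _ ≤ ‖L‖ * b y := by gcongr; exact hub x hx.1 y

variable [MeasurableSpace V] [BorelSpace V] [SecondCountableTopology V]

theorem aestronglyMeasurable_slice {O : Set X} {H : X × V → F} {v : Y → V}
    (hv : Measurable v) (hH : ContinuousOn H (O ×ˢ Set.univ)) {x : X} (hx : x ∈ O) :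
    AEStronglyMeasurable (fun y => H (x, v y)) μ := by
  have h1 : Continuous fun w : V => H (x, w) := by
    rw [← continuousOn_univ]
    exact hH.comp (by fun_prop) fun w _ => ⟨hx, trivial⟩
  exact h1.comp_aestronglyMeasurable hv.stronglyMeasurable.aestronglyMeasurable

variable [NormedSpace ℂ F] [IsScalarTower ℝ ℂ F]

theorem hasFDerivAt_parametric {O : Set X} (hO : IsOpen O) {H : X × V → F} {v : Y → V}
    (hv : Measurable v) {c : Y → ℂ} (hc : AEStronglyMeasurable c μ)
    (hH : ContDiffOn ℝ ∞ H (O ×ˢ Set.univ)) (hb : DerivDominated μ O v c H) {x₀ : X}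
    (hx₀ : x₀ ∈ O) :
    HasFDerivAt (fun x => ∫ y, c y • H (x, v y) ∂μ)
      (∫ y, c y • partialFDeriv H (x₀, v y) ∂μ) x₀ := by
  obtain ⟨u, hu, b, hbi, hub⟩ := derivDominated_partialFDeriv hO hH hb 0 x₀ hx₀
  obtain ⟨u', hu', b', hbi', hub'⟩ := hb 0 x₀ hx₀
  have hmeas : ∀ x ∈ O, AEStronglyMeasurable (fun y => c y • H (x, v y)) μ := fun x hx =>
    hc.smul (aestronglyMeasurable_slice hv hH.continuousOn hx)
  refine hasFDerivAt_integral_of_dominated_of_fderiv_le (𝕜 := ℝ)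
    (F' := fun x y => c y • partialFDeriv H (x, v y)) (s := u ∩ O) (inter_mem hu (hO.mem_nhds hx₀))
    (bound := b) ?_ ?_ ?_ ?_ hbi ?_
  · filter_upwards [hO.mem_nhds hx₀] with x hx using hmeas x hx
  · refine hbi'.mono' (hmeas x₀ hx₀) (Eventually.of_forall fun y => ?_)
    have := hub' x₀ (mem_of_mem_nhds hu') y
    rwa [norm_iteratedFDeriv_zero, ← norm_smul] at this
  · exact hc.smul (aestronglyMeasurable_slice hv
      (contDiffOn_partialFDeriv hO hH).continuousOn hx₀)
  · refine Eventually.of_forall fun y x hx => ?_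
    have := hub x hx.1 y
    rwa [norm_iteratedFDeriv_zero, ← norm_smul] at this
  · refine Eventually.of_forall fun y x hx => ?_
    have h1 : HasFDerivAt H (fderiv ℝ H (x, v y)) (x, v y) :=
      ((hH.contDiffAt ((hO.prod isOpen_univ).mem_nhds ⟨hx.2, trivial⟩)).differentiableAt
        (by simp)).hasFDerivAt
    exact (h1.comp x (hasFDerivAt_prodMk_left x (v y))).const_smul (c y)

end Parametric

section Parametric'

variable {X V Y : Type} [NormedAddCommGroup X] [NormedSpace ℝ X]
  [NormedAddCommGroup V] [NormedSpace ℝ V] [MeasurableSpace V] [BorelSpace V]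
  [SecondCountableTopology V] [MeasurableSpace Y] {μ : Measure Y}

/-- The target `F` is quantified inside the induction because the derivative of the integral is an
integral of the same kind with values in `X →L[ℝ] F`. -/
theorem contDiffOn_nat_parametric {O : Set X} (hO : IsOpen O) {v : Y → V}
    (hv : Measurable v) {c : Y → ℂ} (hc : AEStronglyMeasurable c μ) (m : ℕ) :
    ∀ {F : Type} [NormedAddCommGroup F] [NormedSpace ℝ F] [NormedSpace ℂ F]
      [IsScalarTower ℝ ℂ F] {H : X × V → F}, ContDiffOn ℝ ∞ H (O ×ˢ Set.univ) →
      DerivDominated μ O v c H →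
      ContDiffOn ℝ m (fun x => ∫ y, c y • H (x, v y) ∂μ) O := by
  induction m with
  | zero =>
    intro F _ _ _ _ H hH hb
    rw [Nat.cast_zero, contDiffOn_zero]
    exact fun x hx => (hasFDerivAt_parametric hO hv hc hH hb hx).continuousAt.continuousWithinAt
  | succ m ih =>
    intro F _ _ _ _ H hH hb
    have hd := fun x hx => hasFDerivAt_parametric hO hv hc hH hb (x₀ := x) hx
    rw [Nat.cast_succ, contDiffOn_succ_iff_fderiv_of_isOpen hO]
    refine ⟨fun x hx => (hd x hx).differentiableAt.differentiableWithinAt, by simp, ?_⟩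
    exact (ih (contDiffOn_partialFDeriv hO hH) (derivDominated_partialFDeriv hO hH hb)).congr
      fun x hx => (hd x hx).fderiv

/-- Smooth dependence of an integral on a parameter. -/
theorem contDiffOn_parametric {O : Set X} (hO : IsOpen O) {v : Y → V}
    (hv : Measurable v) {c : Y → ℂ} (hc : AEStronglyMeasurable c μ) {H : X × V → ℂ}
    (hH : ContDiffOn ℝ ∞ H (O ×ˢ Set.univ)) (hb : DerivDominated μ O v c H) :
    ContDiffOn ℝ ∞ (fun x => ∫ y, c y * H (x, v y) ∂μ) O :=
  contDiffOn_infty.2 fun m => contDiffOn_nat_parametric hO hv hc m hH hb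

/-- Smooth dependence on a parameter of an integral over a compact set. -/
theorem contDiffOn_parametric_of_isCompact [FiniteDimensional ℝ X] {O : Set X} (hO : IsOpen O)
    {v : Y → V} (hv : Measurable v) {K : Set V} (hK : IsCompact K) (hvK : ∀ y, v y ∈ K)
    {c : Y → ℂ} (hc : Integrable c μ) {H : X × V → ℂ}
    (hH : ContDiffOn ℝ ∞ H (O ×ˢ Set.univ)) :
    ContDiffOn ℝ ∞ (fun x => ∫ y, c y * H (x, v y) ∂μ) O := by
  refine contDiffOn_parametric hO hv hc.1 hH fun k x₀ hx₀ => ?_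
  obtain ⟨r, hr, hrO⟩ := Metric.nhds_basis_closedBall.mem_iff.1 (hO.mem_nhds hx₀)
  have : ProperSpace X := FiniteDimensional.proper ℝ X
  have hc1 : ContinuousOn (iteratedFDeriv ℝ k H) (closedBall x₀ r ×ˢ K) := by
    have h1 : ContinuousOn (iteratedFDerivWithin ℝ k H (O ×ˢ Set.univ)) (O ×ˢ Set.univ) :=
      hH.continuousOn_iteratedFDerivWithin (by exact_mod_cast le_top)
        (hO.prod isOpen_univ).uniqueDiffOn
    have h2 : ContinuousOn (iteratedFDeriv ℝ k H) (O ×ˢ Set.univ) :=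
      h1.congr fun p hp => (iteratedFDerivWithin_of_isOpen k (hO.prod isOpen_univ) hp).symm
    exact h2.mono (Set.prod_mono hrO (Set.subset_univ _))
  obtain ⟨C, hC⟩ := ((isCompact_closedBall x₀ r).prod hK).exists_bound_of_continuousOn hc1
  refine ⟨closedBall x₀ r, closedBall_mem_nhds _ hr, fun y => ‖c y‖ * C, hc.norm.mul_const _,
    fun x hx y => ?_⟩
  exact mul_le_mul_of_nonneg_left (hC _ ⟨hx, hvK y⟩) (norm_nonneg _)

/-- Smooth dependence on a parameter of an integral of a function of temperate growth. -/
theorem contDiff_parametric_of_temperate {v : Y → V} (hv : Measurable v)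
    {c : Y → ℂ} (hc : AEStronglyMeasurable c μ)
    (hint : ∀ k : ℕ, Integrable (fun y => ‖c y‖ * (1 + ‖v y‖) ^ k) μ) {H : X × V → ℂ}
    (hH : H.HasTemperateGrowth) :
    ContDiff ℝ ∞ (fun x => ∫ y, c y * H (x, v y) ∂μ) := by
  rw [← contDiffOn_univ]
  refine contDiffOn_parametric isOpen_univ hv hc hH.1.contDiffOn fun k x₀ _ => ?_
  obtain ⟨N, C, hC0, hC⟩ := hH.norm_iteratedFDeriv_le_uniform k
  refine ⟨ball x₀ 1, ball_mem_nhds _ one_pos,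
    fun y => C * (2 + ‖x₀‖) ^ N * (‖c y‖ * (1 + ‖v y‖) ^ N), (hint N).const_mul _,
    fun x hx y => ?_⟩
  have hx' : ‖x‖ ≤ ‖x₀‖ + 1 := by
    have := norm_le_norm_add_norm_sub' x x₀
    rw [mem_ball_iff_norm] at hx
    linarith
  have h1 : 1 + ‖(x, v y)‖ ≤ (2 + ‖x₀‖) * (1 + ‖v y‖) := by
    have := norm_nonneg (v y)
    have := norm_nonneg x₀
    rcases le_total ‖x‖ ‖v y‖ with h | h
    · rw [Prod.norm_mk, max_eq_right h]; nlinarith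
    · rw [Prod.norm_mk, max_eq_left h]; nlinarith
  calc ‖c y‖ * ‖iteratedFDeriv ℝ k H (x, v y)‖ ≤ ‖c y‖ * (C * (1 + ‖(x, v y)‖) ^ N) := by
        gcongr; exact hC k le_rfl _
    _ ≤ ‖c y‖ * (C * ((2 + ‖x₀‖) * (1 + ‖v y‖)) ^ N) := by gcongr
    _ = _ := by rw [mul_pow]; ring

end Parametric'

end DeSitter

end

/-! ### The function cos √v and the growth of its derivatives. -/

noncomputable section

namespace DeSitter

/-- The entire function `∑ (-v)^k / (2k)!`, equal to `cos √v` for `v ≥ 0`. -/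
def cosSqrt (v : ℝ) : ℝ := FormalMultilinearSeries.ofScalarsSum (E := ℝ)
  (fun k : ℕ => (-1 : ℝ) ^ k / (2 * k).factorial) v

theorem cosSqrt_sq (r : ℝ) : cosSqrt (r ^ 2) = Real.cos r := by
  rw [cosSqrt, FormalMultilinearSeries.ofScalarsSum_eq_tsum, Real.cos_eq_tsum]
  refine tsum_congr fun k => ?_
  rw [smul_eq_mul, ← pow_mul]; ring

/-- Consecutive coefficients have ratio 1/((2k + 1)(2k + 2)) in modulus, so the ratio test gives
infinite radius of convergence. -/
theorem contDiff_cosSqrt : ContDiff ℝ ∞ cosSqrt := by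
  have h1 : (FormalMultilinearSeries.ofScalars (𝕜 := ℝ) ℝ
      (fun k : ℕ => (-1 : ℝ) ^ k / (2 * k).factorial)).radius = ⊤ := by
    refine FormalMultilinearSeries.ofScalars_radius_eq_top_of_tendsto _ _
      (Eventually.of_forall fun k => by positivity) ?_
    have h2 : ∀ k : ℕ, ‖(-1 : ℝ) ^ (k + 1) / (2 * (k + 1)).factorial‖ /
        ‖(-1 : ℝ) ^ k / (2 * k).factorial‖ = 1 / ((2 * (k : ℝ) + 2) * (2 * k + 1)) := by
      intro k
      rw [show 2 * (k + 1) = (2 * k + 1) + 1 by ring, Nat.factorial_succ, Nat.factorial_succ]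
      simp only [norm_div, norm_pow, norm_neg, norm_one, one_pow, Real.norm_natCast]
      push_cast
      have : ((2 * k).factorial : ℝ) ≠ 0 := by positivity
      field_simp
      ring
    simp only [Nat.succ_eq_add_one, h2]
    refine squeeze_zero (fun k => by positivity) (fun k => ?_)
      (tendsto_one_div_add_atTop_nhds_zero_nat (𝕜 := ℝ))
    have : (0 : ℝ) ≤ k := by positivity
    exact one_div_le_one_div_of_le (by positivity) (by nlinarith)
  have h3 := (FormalMultilinearSeries.ofScalars (𝕜 := ℝ) ℝ
      (fun k : ℕ => (-1 : ℝ) ^ k / (2 * k).factorial)).hasFPowerSeriesOnBall (by rw [h1]; simp)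
  rw [h1] at h3
  have h4 := h3.analyticOnNhd
  rw [Metric.eball_top] at h4
  have h5 := h4.contDiffOn (n := ∞) uniqueDiffOn_univ
  rw [contDiffOn_univ] at h5
  exact h5

theorem cosSqrt_eventuallyEq {v : ℝ} (hv : 0 < v) :
    cosSqrt =ᶠ[𝓝 v] fun v => Real.cos √v := by
  filter_upwards [Ioi_mem_nhds hv] with w hw
  rw [← cosSqrt_sq, Real.sq_sqrt (le_of_lt hw)]

theorem iteratedDeriv_cosSqrt_one {v : ℝ} (hv : 0 < v) :
    iteratedDeriv 1 cosSqrt v = -Real.sin √v / (2 * √v) := by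
  rw [iteratedDeriv_one, (cosSqrt_eventuallyEq hv).deriv_eq,
    ((Real.hasDerivAt_sqrt hv.ne').cos).deriv]
  ring

/-- cos √v solves 4v y'' + 2y' + y = 0; each further differentiation raises the middle coefficient
by 4. -/
theorem iteratedDeriv_cosSqrt_ode (j : ℕ) : ∀ v : ℝ, 0 < v →
    4 * v * iteratedDeriv (j + 2) cosSqrt v + (4 * j + 2) * iteratedDeriv (j + 1) cosSqrt v +
      iteratedDeriv j cosSqrt v = 0 := by
  have hD : ∀ (k : ℕ) (v : ℝ), HasDerivAt (iteratedDeriv k cosSqrt)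
      (iteratedDeriv (k + 1) cosSqrt v) v := by
    intro k v
    rw [iteratedDeriv_succ]
    exact ((contDiff_cosSqrt.differentiable_iteratedDeriv k
      (by exact_mod_cast ENat.natCast_lt_top k)) v).hasDerivAt
  induction j with
  | zero =>
    intro v hv
    have hs : √v ≠ 0 := (Real.sqrt_pos.2 hv).ne'
    have h1 : iteratedDeriv 1 cosSqrt =ᶠ[𝓝 v] fun v => -Real.sin √v / (2 * √v) := by
      filter_upwards [Ioi_mem_nhds hv] with w hw using iteratedDeriv_cosSqrt_one hw
    have h2 := (Real.hasDerivAt_sqrt hv.ne').sin.neg.div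
      ((Real.hasDerivAt_sqrt hv.ne').const_mul 2) (by positivity)
    have h3 := (hD 1 v).unique (h2.congr_of_eventuallyEq h1)
    have h4 : √v ^ 2 = v := Real.sq_sqrt hv.le
    rw [zero_add, h3, iteratedDeriv_cosSqrt_one hv, iteratedDeriv_zero,
      (cosSqrt_eventuallyEq hv).eq_of_nhds]
    nth_rewrite 1 [← h4]
    simp only [Pi.neg_apply]
    field_simp
    ring_nf
  | succ j ih =>
    intro v hv
    have h1 : (fun v => 4 * v * iteratedDeriv (j + 2) cosSqrt v +
        (4 * j + 2) * iteratedDeriv (j + 1) cosSqrt v + iteratedDeriv j cosSqrt v)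
        =ᶠ[𝓝 v] fun _ => 0 := by
      filter_upwards [Ioi_mem_nhds hv] with w hw using ih w hw
    have h2 := (((((hasDerivAt_id v).const_mul 4).mul (hD (j + 2) v)).add
      ((hD (j + 1) v).const_mul (4 * (j : ℝ) + 2))).add (hD j v)).unique
      ((hasDerivAt_const v (0 : ℝ)).congr_of_eventuallyEq h1)
    simp only [id] at h2
    push_cast
    linarith

/-- For v ≥ 1 the differential equation bounds a derivative by the two preceding ones, so
boundedness propagates from cos √v and its first derivative. On [0, 1] compactness suffices. -/
theorem exists_bound_iteratedDeriv_cosSqrt (j : ℕ) :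
    ∃ C, ∀ v, 0 ≤ v → |iteratedDeriv j cosSqrt v| ≤ C := by
  have hc : ∀ k : ℕ, ∃ C, ∀ v ∈ Set.Icc (0 : ℝ) 1, |iteratedDeriv k cosSqrt v| ≤ C := fun k =>
    isCompact_Icc.exists_bound_of_continuousOn
      (contDiff_cosSqrt.continuous_iteratedDeriv k (by exact_mod_cast le_top)).continuousOn
  have key : ∃ C, ∀ v, 1 ≤ v → |iteratedDeriv j cosSqrt v| ≤ C := by
    induction j using Nat.twoStepInduction with
    | zero =>
      refine ⟨1, fun v hv => ?_⟩
      rw [iteratedDeriv_zero, (cosSqrt_eventuallyEq (by linarith)).eq_of_nhds]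
      exact Real.abs_cos_le_one _
    | one =>
      refine ⟨1, fun v hv => ?_⟩
      have h1 : 1 ≤ √v := Real.one_le_sqrt.2 hv
      rw [iteratedDeriv_cosSqrt_one (by linarith), abs_div, abs_neg, abs_of_pos (a := 2 * √v)
        (by positivity), div_le_one (by positivity)]
      linarith [Real.abs_sin_le_one √v]
    | more k h1 h2 =>
      obtain ⟨C₁, h1⟩ := h1
      obtain ⟨C₂, h2⟩ := h2
      refine ⟨(4 * k + 2) * C₂ + C₁, fun v hv => ?_⟩
      have h3 := iteratedDeriv_cosSqrt_ode k v (by linarith)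
      have h4 : |4 * v * iteratedDeriv (k + 2) cosSqrt v| ≤ (4 * k + 2) * C₂ + C₁ := by
        rw [show 4 * v * iteratedDeriv (k + 2) cosSqrt v = -((4 * k + 2) *
          iteratedDeriv (k + 1) cosSqrt v + iteratedDeriv k cosSqrt v) by linarith, abs_neg]
        refine (abs_add_le _ _).trans (add_le_add ?_ (h1 v hv))
        rw [abs_mul, abs_of_nonneg (by positivity)]
        exact mul_le_mul_of_nonneg_left (h2 v hv) (by positivity)
      rw [abs_mul, abs_of_pos (by positivity)] at h4
      nlinarith [abs_nonneg (iteratedDeriv (k + 2) cosSqrt v)]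
  obtain ⟨C₁, h1⟩ := hc j
  obtain ⟨C₂, h2⟩ := key
  refine ⟨max C₁ C₂, fun v hv => ?_⟩
  rcases le_total v 1 with h | h
  · exact (h1 v ⟨hv, h⟩).trans (le_max_left _ _)
  · exact (h2 v h).trans (le_max_right _ _)

/-- A function of temperate growth on `ℝ` that equals `cos √v` for `v ≥ 0`. -/
def tameCosSqrt (v : ℝ) : ℝ := Real.smoothTransition (v + 2) * cosSqrt v

theorem tameCosSqrt_sq (r : ℝ) : tameCosSqrt (r ^ 2) = Real.cos r := by
  rw [tameCosSqrt, Real.smoothTransition.one_of_one_le (by nlinarith [sq_nonneg r]), one_mul,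
    cosSqrt_sq]

/-- The cutoff is needed because cos √v becomes cosh √|v| for v < 0. Left of -2 the function
vanishes, [-2, 0] is compact, and on v > 0 it is `cosSqrt`. -/
theorem tameCosSqrt_temperate : Function.HasTemperateGrowth tameCosSqrt := by
  have hsm : ContDiff ℝ ∞ tameCosSqrt :=
    (Real.smoothTransition.contDiff.comp (contDiff_id.add contDiff_const)).mul contDiff_cosSqrt
  refine ⟨hsm, fun j => ?_⟩
  obtain ⟨C₁, h1⟩ := exists_bound_iteratedDeriv_cosSqrt j
  obtain ⟨C₂, h2⟩ := (isCompact_Icc (a := (-2 : ℝ)) (b := 0)).exists_bound_of_continuousOn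
    (hsm.continuous_iteratedDeriv j (by exact_mod_cast le_top)).continuousOn
  have hC₂ : 0 ≤ C₂ := (norm_nonneg _).trans (h2 0 (by simp))
  refine ⟨0, max C₁ C₂, fun v => ?_⟩
  rw [norm_iteratedFDeriv_eq_norm_iteratedDeriv, pow_zero, mul_one]
  rcases lt_trichotomy v (-2) with h | h | h
  · have h3 : tameCosSqrt =ᶠ[𝓝 v] fun _ => 0 := by
      filter_upwards [Iio_mem_nhds h] with w hw
      rw [tameCosSqrt, Real.smoothTransition.zero_of_nonpos (by linarith [Set.mem_Iio.1 hw]),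
        zero_mul]
    rw [h3.iteratedDeriv_eq j]
    simp only [iteratedDeriv_fun_const_zero, norm_zero]
    exact hC₂.trans (le_max_right _ _)
  · exact (h2 v (by rw [h]; simp)).trans (le_max_right _ _)
  · rcases le_or_gt v 0 with h0 | h0
    · exact (h2 v ⟨h.le, h0⟩).trans (le_max_right _ _)
    · have h3 : tameCosSqrt =ᶠ[𝓝 v] cosSqrt := by
        filter_upwards [Ioi_mem_nhds h0] with w hw
        rw [tameCosSqrt, Real.smoothTransition.one_of_one_le (by linarith [Set.mem_Ioi.1 hw]),
          one_mul]
      rw [h3.iteratedDeriv_eq j]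
      exact (h1 v h0.le).trans (le_max_left _ _)

end DeSitter

end

/-! ### Means over slices, extended smoothly through the pole. -/

noncomputable section

namespace DeSitter

open scoped SchwartzMap FourierTransform

theorem temperate_exp_mul_I :
    Function.HasTemperateGrowth (fun t : ℝ => Complex.exp (t * Complex.I)) := by
  have hd : ∀ k : ℕ, iteratedDeriv k (fun t : ℝ => Complex.exp (t * Complex.I)) =
      fun t : ℝ => Complex.I ^ k * Complex.exp (t * Complex.I) := by
    intro k
    induction k with
    | zero => simp
    | succ k ih =>
      rw [iteratedDeriv_succ, ih]
      funext t
      have h1 : HasDerivAt (fun t : ℝ => Complex.exp (t * Complex.I))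
          (Complex.exp (t * Complex.I) * (1 * Complex.I)) t :=
        ((Complex.ofRealCLM.hasDerivAt (x := t)).mul_const Complex.I).cexp
      rw [(h1.const_mul (Complex.I ^ k)).deriv]
      ring
  have hs : ContDiff ℝ ∞ (fun t : ℝ => Complex.exp (t * Complex.I)) :=
    (Complex.ofRealCLM.contDiff.mul contDiff_const).cexp
  refine ⟨hs, fun k => ⟨0, 1, fun t => ?_⟩⟩
  rw [norm_iteratedFDeriv_eq_norm_iteratedDeriv, hd]
  simp [Complex.norm_exp_ofReal_mul_I]

theorem temperate_inner {X H : Type*} [NormedAddCommGroup X] [NormedSpace ℝ X]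
    [NormedAddCommGroup H] [InnerProductSpace ℝ H] {f g : X → H}
    (hf : f.HasTemperateGrowth) (hg : g.HasTemperateGrowth) :
    Function.HasTemperateGrowth fun x => (inner ℝ (f x) (g x) : ℝ) :=
  (innerSL ℝ (E := H)).bilinear_hasTemperateGrowth hf hg

theorem temperate_fst {X V : Type*} [NormedAddCommGroup X] [NormedSpace ℝ X]
    [NormedAddCommGroup V] [NormedSpace ℝ V] :
    Function.HasTemperateGrowth (Prod.fst : X × V → X) :=
  (ContinuousLinearMap.fst ℝ X V).hasTemperateGrowth

theorem temperate_snd {X V : Type*} [NormedAddCommGroup X] [NormedSpace ℝ X]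
    [NormedAddCommGroup V] [NormedSpace ℝ V] :
    Function.HasTemperateGrowth (Prod.snd : X × V → V) :=
  (ContinuousLinearMap.snd ℝ X V).hasTemperateGrowth

/-- The kernel of the extended spherical mean. -/
def meanKernel (E : Type) [NormedAddCommGroup E] [InnerProductSpace ℝ E]
    (x : (ℝ × E) × (E × ℝ)) : ℂ :=
  Complex.exp ((2 * Real.pi * ((1 - x.1.1) * inner ℝ x.2.1 x.1.2) : ℝ) * Complex.I) *
    ((tameCosSqrt ((2 * Real.pi) ^ 2 * (x.1.1 * (2 - x.1.1)) *
      (‖x.2.1‖ ^ 2 - (inner ℝ x.2.1 x.1.2) ^ 2) * x.2.2 ^ 2) : ℝ) : ℂ)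

theorem temperate_meanKernel (E : Type) [NormedAddCommGroup E] [InnerProductSpace ℝ E] :
    Function.HasTemperateGrowth (meanKernel E) := by
  have h11 : Function.HasTemperateGrowth (fun x : (ℝ × E) × (E × ℝ) => x.1.1) :=
    temperate_fst.comp temperate_fst
  have h12 : Function.HasTemperateGrowth (fun x : (ℝ × E) × (E × ℝ) => x.1.2) :=
    temperate_snd.comp temperate_fst
  have h21 : Function.HasTemperateGrowth (fun x : (ℝ × E) × (E × ℝ) => x.2.1) :=
    temperate_fst.comp temperate_snd
  have h22 : Function.HasTemperateGrowth (fun x : (ℝ × E) × (E × ℝ) => x.2.2) :=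
    temperate_snd.comp temperate_snd
  have hin := temperate_inner h21 h12
  have hn : Function.HasTemperateGrowth (fun x : (ℝ × E) × (E × ℝ) => ‖x.2.1‖ ^ 2) :=
    (Function.hasTemperateGrowth_norm_sq E).comp h21
  refine Function.HasTemperateGrowth.mul (R := ℂ) ?_ ?_
  · refine temperate_exp_mul_I.comp (f := fun x : (ℝ × E) × (E × ℝ) =>
      2 * Real.pi * ((1 - x.1.1) * inner ℝ x.2.1 x.1.2)) ?_
    fun_prop
  · refine Function.HasTemperateGrowth.comp (g := Complex.ofReal) (by fun_prop) ?_
    refine tameCosSqrt_temperate.comp (f := fun x : (ℝ × E) × (E × ℝ) =>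
      (2 * Real.pi) ^ 2 * (x.1.1 * (2 - x.1.1)) *
      (‖x.2.1‖ ^ 2 - (inner ℝ x.2.1 x.1.2) ^ 2) * x.2.2 ^ 2) ?_
    fun_prop

variable {m : ℕ}

theorem norm_le_one_of_sphere (u : sphere (0 : EuclideanSpace ℝ (Fin (m + 1))) 1) :
    ‖(u : EuclideanSpace ℝ (Fin (m + 1))) 0‖ ≤ 1 := by
  have h := PiLp.norm_apply_le (u : EuclideanSpace ℝ (Fin (m + 1))) 0
  have h1 : ‖(u : EuclideanSpace ℝ (Fin (m + 1)))‖ = 1 := by simp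
  linarith

/-- The mean of `f` over the slice of the sphere at height `⟨x, η⟩ = 1 - v`, extended smoothly to
all real `v` and all vectors `η` by means of the Fourier transform. -/
def meanExt (f : 𝓢(EuclideanSpace ℝ (Fin (m + 2)), ℂ))
    (x : ℝ × EuclideanSpace ℝ (Fin (m + 2))) : ℂ :=
  ∫ y : EuclideanSpace ℝ (Fin (m + 2)) × sphere (0 : EuclideanSpace ℝ (Fin (m + 1))) 1,
    (𝓕 f) y.1 * meanKernel _ (x, (y.1, (y.2 : EuclideanSpace ℝ (Fin (m + 1))) 0))
    ∂((volume : Measure (EuclideanSpace ℝ (Fin (m + 2)))).prod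
      (volume : Measure (EuclideanSpace ℝ (Fin (m + 1)))).toSphere)

/-- The kernel has temperate growth in all variables, also for (v, η) without geometric meaning,
while 𝓕 f decays faster than any power; differentiation under the integral is therefore
unrestricted. -/
theorem contDiff_meanExt (f : 𝓢(EuclideanSpace ℝ (Fin (m + 2)), ℂ)) :
    ContDiff ℝ ∞ (meanExt f) := by
  refine contDiff_parametric_of_temperate (V := EuclideanSpace ℝ (Fin (m + 2)) × ℝ)
    (v := fun y : EuclideanSpace ℝ (Fin (m + 2)) × sphere (0 : EuclideanSpace ℝ (Fin (m + 1))) 1 =>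
      (y.1, (y.2 : EuclideanSpace ℝ (Fin (m + 1))) 0)) (c := fun y => (𝓕 f) y.1) ?_ ?_ ?_
    (temperate_meanKernel _)
  · fun_prop
  · exact (((𝓕 f).continuous.comp continuous_fst)).aestronglyMeasurable
  · intro k
    have h1 : Integrable (fun p => ‖(𝓕 f) p‖ * (2 + ‖p‖) ^ k) := by
      have h2 := ((((𝓕 f).integrable_pow_mul volume 0).const_mul (2 ^ k)).add
        ((𝓕 f).integrable_pow_mul volume k)).const_mul (2 ^ k)
      refine h2.mono' ?_ (Eventually.of_forall fun p => ?_)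
      · exact (((𝓕 f).continuous.norm).mul (by fun_prop)).aestronglyMeasurable
      · rw [Real.norm_of_nonneg (by positivity)]
        have h3 : (2 + ‖p‖) ^ k ≤ 2 ^ k * (2 ^ k + ‖p‖ ^ k) := by
          have h0 := norm_nonneg p
          rcases le_total 2 ‖p‖ with h | h
          · calc (2 + ‖p‖) ^ k ≤ (2 * ‖p‖) ^ k := by gcongr; linarith
              _ = 2 ^ k * ‖p‖ ^ k := mul_pow _ _ _
              _ ≤ _ := by gcongr; exact le_add_of_nonneg_left (by positivity)
          · calc (2 + ‖p‖) ^ k ≤ (2 * 2) ^ k := by gcongr; linarith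
              _ = 2 ^ k * 2 ^ k := mul_pow _ _ _
              _ ≤ _ := by gcongr; exact le_add_of_nonneg_right (by positivity)
        simp only [Pi.add_apply, pow_zero, one_mul]
        nlinarith [mul_le_mul_of_nonneg_left h3 (norm_nonneg ((𝓕 f) p))]
    refine (h1.comp_fst _).mono' ?_ (Eventually.of_forall fun y => ?_)
    · refine Continuous.aestronglyMeasurable ?_
      exact (((𝓕 f).continuous.comp continuous_fst).norm).mul (by fun_prop)
    · rw [Real.norm_of_nonneg (by positivity)]
      refine mul_le_mul_of_nonneg_left (pow_le_pow_left₀ (by positivity) ?_ k) (norm_nonneg _)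
      rw [Prod.norm_mk]
      have := norm_le_one_of_sphere y.2
      have := norm_nonneg y.1
      have : max ‖y.1‖ ‖(y.2 : EuclideanSpace ℝ (Fin (m + 1))) 0‖ ≤ 1 + ‖y.1‖ :=
        max_le (by linarith) (by linarith)
      linarith

theorem schwartz_eq_integral (f : 𝓢(EuclideanSpace ℝ (Fin (m + 2)), ℂ))
    (x : EuclideanSpace ℝ (Fin (m + 2))) :
    f x = ∫ p, (𝓕 f) p * Complex.exp ((2 * Real.pi * inner ℝ p x : ℝ) * Complex.I) := by
  have h : (𝓕⁻ (𝓕 f)) x = f x := by rw [FourierTransform.fourierInv_fourier_eq]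
  rw [← h, SchwartzMap.fourierInv_coe, Real.fourierInv_eq']
  refine integral_congr_ae (Eventually.of_forall fun p => ?_)
  simp only [smul_eq_mul]
  ring

/-- The mean of a character over the unit sphere. -/
theorem integral_sphere_exp (q : EuclideanSpace ℝ (Fin (m + 1))) :
    ∫ u : sphere (0 : EuclideanSpace ℝ (Fin (m + 1))) 1,
      Complex.exp ((inner ℝ q (u : EuclideanSpace ℝ (Fin (m + 1))) : ℝ) * Complex.I)
      ∂(volume : Measure (EuclideanSpace ℝ (Fin (m + 1)))).toSphere =
    ∫ u : sphere (0 : EuclideanSpace ℝ (Fin (m + 1))) 1,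
      ((tameCosSqrt (‖q‖ ^ 2 * ((u : EuclideanSpace ℝ (Fin (m + 1))) 0) ^ 2) : ℝ) : ℂ)
      ∂(volume : Measure (EuclideanSpace ℝ (Fin (m + 1)))).toSphere := by
  set e : EuclideanSpace ℝ (Fin (m + 1)) := EuclideanSpace.single 0 1
  have he : ∀ u : EuclideanSpace ℝ (Fin (m + 1)), inner ℝ e u = u 0 := fun u => by
    simp [e, EuclideanSpace.inner_single_left]
  obtain ⟨S, hS⟩ := exists_isometry_apply_eq (v := ‖q‖ • e) (w := q) (by simp [norm_smul, e])
  have h1 : ∀ u : EuclideanSpace ℝ (Fin (m + 1)), inner ℝ q (S u) = ‖q‖ * u 0 := by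
    intro u
    conv_lhs => rw [← hS]
    rw [S.inner_map_map, inner_smul_left, he]; simp
  have hE : Continuous fun u : EuclideanSpace ℝ (Fin (m + 1)) =>
      Complex.exp ((inner ℝ q u : ℝ) * Complex.I) := by fun_prop
  have hE2 : Continuous fun u : EuclideanSpace ℝ (Fin (m + 1)) =>
      Complex.exp ((‖q‖ * u 0 : ℝ) * Complex.I) := by fun_prop
  have h2 : ∫ u : sphere (0 : EuclideanSpace ℝ (Fin (m + 1))) 1,
      Complex.exp ((inner ℝ q (u : EuclideanSpace ℝ (Fin (m + 1))) : ℝ) * Complex.I)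
      ∂(volume : Measure (EuclideanSpace ℝ (Fin (m + 1)))).toSphere =
      ∫ u : sphere (0 : EuclideanSpace ℝ (Fin (m + 1))) 1,
      Complex.exp ((‖q‖ * (u : EuclideanSpace ℝ (Fin (m + 1))) 0 : ℝ) * Complex.I)
      ∂(volume : Measure (EuclideanSpace ℝ (Fin (m + 1)))).toSphere := by
    rw [← integral_sphere_isometry S hE.measurable]
    refine integral_congr_ae (Eventually.of_forall fun u => ?_)
    simp only [h1]
  -- Invariance under u ↦ -u symmetrizes the exponential into a cosine, an even function of ‖q‖ and
  -- hence a smooth function of ‖q‖².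
  have h3 : ∫ u : sphere (0 : EuclideanSpace ℝ (Fin (m + 1))) 1,
      Complex.exp ((‖q‖ * (u : EuclideanSpace ℝ (Fin (m + 1))) 0 : ℝ) * Complex.I)
      ∂(volume : Measure (EuclideanSpace ℝ (Fin (m + 1)))).toSphere =
      ∫ u : sphere (0 : EuclideanSpace ℝ (Fin (m + 1))) 1,
      Complex.exp (-((‖q‖ * (u : EuclideanSpace ℝ (Fin (m + 1))) 0 : ℝ) * Complex.I))
      ∂(volume : Measure (EuclideanSpace ℝ (Fin (m + 1)))).toSphere := by
    rw [← integral_sphere_isometry (LinearIsometryEquiv.neg ℝ) hE2.measurable]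
    refine integral_congr_ae (Eventually.of_forall fun u => ?_)
    simp
  have hfin : ∀ g : EuclideanSpace ℝ (Fin (m + 1)) → ℂ, Continuous g →
      Integrable (fun u : sphere (0 : EuclideanSpace ℝ (Fin (m + 1))) 1 => g u)
        (volume : Measure (EuclideanSpace ℝ (Fin (m + 1)))).toSphere := fun g hg =>
    (hg.comp continuous_subtype_val).integrable_of_hasCompactSupport
      (HasCompactSupport.of_compactSpace _)
  have h4 : ∀ u : sphere (0 : EuclideanSpace ℝ (Fin (m + 1))) 1,
      ((tameCosSqrt (‖q‖ ^ 2 * ((u : EuclideanSpace ℝ (Fin (m + 1))) 0) ^ 2) : ℝ) : ℂ) =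
      (1 / 2 : ℂ) * (Complex.exp ((‖q‖ * (u : EuclideanSpace ℝ (Fin (m + 1))) 0 : ℝ) * Complex.I) +
        Complex.exp (-((‖q‖ * (u : EuclideanSpace ℝ (Fin (m + 1))) 0 : ℝ) * Complex.I))) := by
    intro u
    rw [← mul_pow, tameCosSqrt_sq, Complex.ofReal_cos, Complex.cos, neg_mul]
    ring
  simp only [h4]
  rw [integral_const_mul, integral_add (hfin _ hE2) (hfin (fun u => Complex.exp
    (-((‖q‖ * u 0 : ℝ) * Complex.I))) (by fun_prop)), ← h3, h2]
  ring

/-- For `|c| < 1`, the extended mean is the spherical mean over the slice at height `c`. -/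
theorem integral_slice_eq_meanExt (f : 𝓢(EuclideanSpace ℝ (Fin (m + 2)), ℂ))
    (R : EuclideanSpace ℝ (Fin (m + 2)) ≃ₗᵢ[ℝ] EuclideanSpace ℝ (Fin (m + 2)))
    {c : ℝ} (hc : c ∈ Set.Icc (-1 : ℝ) 1) :
    ∫ u : sphere (0 : EuclideanSpace ℝ (Fin (m + 1))) 1,
      f (R (consPt c (√(1 - c ^ 2) • (u : EuclideanSpace ℝ (Fin (m + 1))))))
      ∂(volume : Measure (EuclideanSpace ℝ (Fin (m + 1)))).toSphere =
    meanExt f (1 - c, R (EuclideanSpace.single 0 1)) := by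
  have h0 : 0 ≤ 1 - c ^ 2 := by nlinarith [hc.1, hc.2]
  set h := 𝓕 f
  set e : EuclideanSpace ℝ (Fin (m + 2)) := EuclideanSpace.single 0 1
  have hR : Continuous R := R.continuous
  have hpt : Continuous fun u : sphere (0 : EuclideanSpace ℝ (Fin (m + 1))) 1 =>
      consPt c (√(1 - c ^ 2) • (u : EuclideanSpace ℝ (Fin (m + 1)))) :=
    continuous_consPt.comp (by fun_prop : Continuous
      fun u : sphere (0 : EuclideanSpace ℝ (Fin (m + 1))) 1 =>
        (c, √(1 - c ^ 2) • (u : EuclideanSpace ℝ (Fin (m + 1)))))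
  have hint : Integrable (fun y : sphere (0 : EuclideanSpace ℝ (Fin (m + 1))) 1 ×
      EuclideanSpace ℝ (Fin (m + 2)) => h y.2 * Complex.exp ((2 * Real.pi * inner ℝ y.2
        (R (consPt c (√(1 - c ^ 2) • (y.1 : EuclideanSpace ℝ (Fin (m + 1)))))) : ℝ) * Complex.I))
      ((volume : Measure (EuclideanSpace ℝ (Fin (m + 1)))).toSphere.prod volume) := by
    refine ((h.integrable (μ := volume)).comp_snd _).mono ?_ (Eventually.of_forall fun y => ?_)
    · refine Continuous.aestronglyMeasurable ?_
      refine (h.continuous.comp continuous_snd).mul ?_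
      have := hR.comp (hpt.comp (continuous_fst (Y := EuclideanSpace ℝ (Fin (m + 2)))))
      refine Complex.continuous_exp.comp (Continuous.mul (Complex.continuous_ofReal.comp
        (continuous_const.mul (continuous_snd.inner this))) continuous_const)
    · rw [norm_mul, Complex.norm_exp_ofReal_mul_I, mul_one]
  have hint2 : Integrable (fun y : EuclideanSpace ℝ (Fin (m + 2)) ×
      sphere (0 : EuclideanSpace ℝ (Fin (m + 1))) 1 =>
      h y.1 * meanKernel _ ((1 - c, R e), (y.1, (y.2 : EuclideanSpace ℝ (Fin (m + 1))) 0)))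
      (volume.prod (volume : Measure (EuclideanSpace ℝ (Fin (m + 1)))).toSphere) := by
    refine ((h.integrable (μ := volume)).comp_fst _).mono ?_ (Eventually.of_forall fun y => ?_)
    · refine Continuous.aestronglyMeasurable ?_
      refine (h.continuous.comp continuous_fst).mul ?_
      exact (temperate_meanKernel _).1.continuous.comp (by fun_prop)
    · rw [norm_mul]
      refine mul_le_of_le_one_right (norm_nonneg _) ?_
      rw [meanKernel, norm_mul, Complex.norm_exp_ofReal_mul_I, one_mul, Complex.norm_real]
      -- In the geometric range the argument of `tameCosSqrt` is nonnegative, so the kernel is a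
      -- phase times a genuine cosine and 𝓕 f alone dominates.
      have h5 : 0 ≤ (2 * Real.pi) ^ 2 * ((1 - c) * (2 - (1 - c))) *
          (‖y.1‖ ^ 2 - (inner ℝ y.1 (R e)) ^ 2) * ((y.2 : EuclideanSpace ℝ (Fin (m + 1))) 0) ^ 2 := by
        have h6 : |inner ℝ y.1 (R e)| ≤ ‖y.1‖ := by
          refine (abs_real_inner_le_norm _ _).trans ?_
          simp [e]
        have h7 : 0 ≤ ‖y.1‖ ^ 2 - (inner ℝ y.1 (R e)) ^ 2 := by
          rw [← sq_abs (inner ℝ y.1 (R e))]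
          nlinarith [abs_nonneg (inner ℝ y.1 (R e))]
        have h8 : 0 ≤ (1 - c) * (2 - (1 - c)) := by nlinarith
        positivity
      rw [← Real.sq_sqrt h5, tameCosSqrt_sq]
      exact Real.abs_cos_le_one _
  rw [meanExt, integral_prod _ hint2]
  simp only [schwartz_eq_integral f]
  rw [integral_integral_swap hint]
  refine integral_congr_ae (Eventually.of_forall fun p => ?_)
  simp only [integral_const_mul]
  congr 1
  -- Split R⁻¹p into its axial component and a rest q in the slicing hyperplane. The axial part
  -- gives the phase, and the q-part is averaged by `integral_sphere_exp`; with v = 1 - c, the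
  -- squared slice radius 1 - c² is the polynomial v(2 - v).
  have hRp : ∃ q, R.symm p = consPt (inner ℝ p (R e)) q := by
    refine ⟨WithLp.toLp 2 fun i => (R.symm p) i.succ, ?_⟩
    have h1 : inner ℝ p (R e) = (R.symm p) 0 := by
      conv_lhs => rw [← R.apply_symm_apply p]
      rw [R.inner_map_map]
      simp [e, EuclideanSpace.inner_single_right]
    rw [h1]
    ext i
    refine Fin.cases ?_ (fun i => ?_) i <;> simp
  obtain ⟨q, hq⟩ := hRp
  have hin : ∀ x, inner ℝ p (R x) = inner ℝ (R.symm p) x := fun x => by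
    conv_lhs => rw [← R.apply_symm_apply p]
    rw [R.inner_map_map]
  have hq2 : ‖q‖ ^ 2 = ‖p‖ ^ 2 - (inner ℝ p (R e)) ^ 2 := by
    have := norm_consPt_sq (inner ℝ p (R e)) q
    rw [← hq, R.symm.norm_map] at this
    linarith
  have h1 := integral_sphere_exp ((2 * Real.pi * √(1 - c ^ 2)) • q)
  simp only [meanKernel, hin]
  rw [integral_const_mul]
  rw [show (‖(2 * Real.pi * √(1 - c ^ 2)) • q‖ ^ 2) = (2 * Real.pi) ^ 2 *
    ((1 - c) * (2 - (1 - c))) * (‖p‖ ^ 2 - (inner ℝ p (R e)) ^ 2) by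
    rw [norm_smul, mul_pow, hq2, Real.norm_eq_abs, sq_abs, mul_pow, Real.sq_sqrt h0]; ring] at h1
  simp only [hin] at h1
  rw [← h1, ← integral_const_mul]
  refine integral_congr_ae (Eventually.of_forall fun u => ?_)
  simp only
  rw [← Complex.exp_add, ← hin e, hq, inner_consPt, inner_smul_left, inner_smul_right]
  congr 1
  simp only [conj_trivial]
  push_cast
  ring

end DeSitter

end

/-! ### Zonal integrals in the variable v = 1 - ⟨η, ζ⟩. -/

noncomputable section

namespace DeSitter

open scoped SchwartzMap FourierTransform

theorem sliceDensity_toReal (n : ℕ) {c : ℝ} (hc : c ∈ Set.Ioo (-1 : ℝ) 1) :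
    (ENNReal.ofReal ((1 - c ^ 2) ^ ((n : ℝ) / 2 - 1))).toReal =
      (1 - c ^ 2) ^ ((n : ℝ) / 2 - 1) :=
  ENNReal.toReal_ofReal (Real.rpow_nonneg (by nlinarith [hc.1, hc.2]) _)

theorem integrable_sliceMeasure (n : ℕ) {G : ℝ → ℂ} :
    Integrable G (sliceMeasure n) ↔ IntegrableOn
      (fun c => (((1 - c ^ 2) ^ ((n : ℝ) / 2 - 1) : ℝ) : ℂ) * G c) (Set.Ioo (-1 : ℝ) 1) := by
  rw [sliceMeasure, integrable_withDensity_iff_integrable_smul' (measurable_sliceDensity n)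
    (Eventually.of_forall fun c => ENNReal.ofReal_lt_top)]
  refine integrable_congr ?_
  filter_upwards [ae_restrict_mem measurableSet_Ioo] with c hc
  rw [sliceDensity_toReal n hc, Complex.real_smul]

theorem integral_sliceMeasure (n : ℕ) (G : ℝ → ℂ) :
    ∫ c, G c ∂(sliceMeasure n) =
      ∫ c in Set.Ioo (-1 : ℝ) 1, (((1 - c ^ 2) ^ ((n : ℝ) / 2 - 1) : ℝ) : ℂ) * G c := by
  rw [sliceMeasure, integral_withDensity_eq_integral_toReal_smul (measurable_sliceDensity n)
    (Eventually.of_forall fun c => ENNReal.ofReal_lt_top)]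
  refine setIntegral_congr_fun measurableSet_Ioo fun c hc => ?_
  simp only [sliceDensity_toReal n hc, Complex.real_smul]

theorem integrableOn_comp_one_sub {G : ℝ → ℂ} {a b : ℝ} :
    IntegrableOn (fun v => G (1 - v)) (Set.Ioo (1 - b) (1 - a)) ↔
      IntegrableOn G (Set.Ioo a b) := by
  have h := (Measure.measurePreserving_sub_left (volume : Measure ℝ) 1).integrableOn_comp_preimage
    (f := G) (s := Set.Ioo a b) (Homeomorph.subLeft (1 : ℝ)).measurableEmbedding
  rw [Set.preimage_const_sub_Ioo] at h
  exact h

theorem setIntegral_comp_one_sub (G : ℝ → ℂ) (a b : ℝ) :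
    ∫ v in Set.Ioo (1 - b) (1 - a), G (1 - v) = ∫ c in Set.Ioo a b, G c := by
  have h := (Measure.measurePreserving_sub_left (volume : Measure ℝ) 1).setIntegral_preimage_emb
    (Homeomorph.subLeft (1 : ℝ)).measurableEmbedding G (Set.Ioo a b)
  rw [Set.preimage_const_sub_Ioo] at h
  exact h

variable {m : ℕ}

/-- Integral over the sphere of a zonal function supported in the cap `⟨ζ, η⟩ > 1/2` against a
smooth function. -/
theorem integral_sphere_zonal (f : 𝓢(EuclideanSpace ℝ (Fin (m + 2)), ℂ))
    {η : EuclideanSpace ℝ (Fin (m + 2))} (hη : ‖η‖ = 1) {F : ℝ → ℂ} (hF : Measurable F)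
    (hF0 : ∀ c, c ≤ 1 / 2 → F c = 0)
    (hFi : IntegrableOn (fun v : ℝ => ((v ^ (((m + 1 : ℕ) : ℝ) / 2 - 1) : ℝ) : ℂ) * F (1 - v))
      (Set.Ioo 0 (1 / 2))) :
    Integrable (fun ζ : sphere (0 : EuclideanSpace ℝ (Fin (m + 2))) 1 =>
        F (inner ℝ η (ζ : EuclideanSpace ℝ (Fin (m + 2)))) * f ζ)
        (volume : Measure (EuclideanSpace ℝ (Fin (m + 2)))).toSphere ∧
      ∫ ζ : sphere (0 : EuclideanSpace ℝ (Fin (m + 2))) 1,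
        F (inner ℝ η (ζ : EuclideanSpace ℝ (Fin (m + 2)))) * f ζ
        ∂(volume : Measure (EuclideanSpace ℝ (Fin (m + 2)))).toSphere =
      ∫ v in Set.Ioo (0 : ℝ) (1 / 2), ((v ^ (((m + 1 : ℕ) : ℝ) / 2 - 1) : ℝ) : ℂ) * F (1 - v) *
        ((((2 - v) ^ (((m + 1 : ℕ) : ℝ) / 2 - 1) : ℝ) : ℂ) * meanExt f (v, η)) := by
  set p : ℝ := ((m + 1 : ℕ) : ℝ) / 2 - 1 with hp
  set e : EuclideanSpace ℝ (Fin (m + 2)) := EuclideanSpace.single 0 1 with he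
  obtain ⟨R, hR⟩ := exists_isometry_apply_eq (v := e) (w := η) (by simp [e, hη])
  have hin : ∀ x, inner ℝ η (R x) = x 0 := fun x => by
    rw [← hR, R.inner_map_map]; simp [e, EuclideanSpace.inner_single_left]
  have hm1 : Measurable fun x : EuclideanSpace ℝ (Fin (m + 2)) => F (inner ℝ η x) * f x :=
    (hF.comp (by fun_prop)).mul f.continuous.measurable
  have hm2 : Measurable fun x : EuclideanSpace ℝ (Fin (m + 2)) => F (x 0) * f (R x) :=
    (hF.comp (by fun_prop)).mul (f.continuous.comp R.continuous).measurable
  rw [← integrable_sphere_isometry R hm1, ← integral_sphere_isometry R hm1]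
  simp only [hin]
  rw [integrable_sphere_iff_slice (by omega) hm2, integral_sphere_eq_slice (by omega) hm2]
  simp only [consPt_zero]
  have hzero : ∀ v ∈ Set.Ioo (0 : ℝ) 2, v ∉ Set.Ioo (0 : ℝ) (1 / 2) → F (1 - v) = 0 := by
    intro v hv hv'
    refine hF0 _ ?_
    by_contra h
    exact hv' ⟨hv.1, by linarith⟩
  have hFs : Integrable F (sliceMeasure (m + 1)) := by
    rw [integrable_sliceMeasure, ← integrableOn_comp_one_sub]
    norm_num only
    have h1 : IntegrableOn (fun v => (((1 - (1 - v) ^ 2) ^ (((m + 1 : ℕ) : ℝ) / 2 - 1) : ℝ) : ℂ) *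
        F (1 - v)) (Set.Ioo 0 (1 / 2)) := by
      -- Since 1 - (1 - v)² = v(2 - v), the slice density is v^p times a factor continuous on [0,
      -- 1/2], so integrability against v^p alone is enough.
      have h2 : IntegrableOn (fun v => (((2 - v) ^ p : ℝ) : ℂ) * (((v ^ p : ℝ) : ℂ) * F (1 - v)))
          (Set.Icc 0 (1 / 2)) := by
        refine IntegrableOn.continuousOn_mul ?_ ?_ isCompact_Icc
        · refine Complex.continuous_ofReal.comp_continuousOn ?_
          exact ContinuousOn.rpow_const (by fun_prop) fun v hv => Or.inl (by linarith [hv.2])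
        · rwa [integrableOn_Icc_iff_integrableOn_Ioo]
      refine (h2.mono_set Set.Ioo_subset_Icc_self).congr_fun (fun v hv => ?_) measurableSet_Ioo
      simp only
      rw [← mul_assoc, ← Complex.ofReal_mul, ← Real.mul_rpow (by linarith [hv.2]) hv.1.le]
      congr 3
      ring
    refine h1.of_forall_sdiff_eq_zero measurableSet_Ioo fun v hv => ?_
    rw [hzero v hv.1 hv.2, mul_zero]
  obtain ⟨C, hC⟩ : ∃ C, ∀ x, ‖f x‖ ≤ C := by
    obtain ⟨C, hC⟩ := f.decay 0 0
    exact ⟨C, fun x => by simpa using hC.2 x⟩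
  have hint : Integrable (fun y : ℝ × sphere (0 : EuclideanSpace ℝ (Fin (m + 1))) 1 =>
      F y.1 * f (R (consPt y.1 (√(1 - y.1 ^ 2) • (y.2 : EuclideanSpace ℝ (Fin (m + 1)))))))
      ((sliceMeasure (m + 1)).prod
        (volume : Measure (EuclideanSpace ℝ (Fin (m + 1)))).toSphere) := by
    refine (hFs.comp_fst _).mul_bdd (c := C) ?_ (Eventually.of_forall fun y => hC _)
    exact ((f.continuous.comp R.continuous).measurable.comp
      (measurable_slicePt (m + 1))).aestronglyMeasurable
  refine ⟨hint, ?_⟩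
  rw [integral_prod _ hint]
  simp only [integral_const_mul]
  rw [integral_sliceMeasure, ← setIntegral_comp_one_sub]
  norm_num only
  have hsub : Set.Ioo (0 : ℝ) (1 / 2) ⊆ Set.Ioo 0 2 := Set.Ioo_subset_Ioo_right (by norm_num)
  rw [setIntegral_eq_of_subset_of_forall_sdiff_eq_zero measurableSet_Ioo hsub]
  · refine setIntegral_congr_fun measurableSet_Ioo fun v hv => ?_
    have hv' := hsub hv
    rw [integral_slice_eq_meanExt f R (c := 1 - v) ⟨by linarith [hv'.2], by linarith [hv'.1]⟩,
      ← he, hR, sub_sub_cancel,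
      show 1 - (1 - v) ^ 2 = v * (2 - v) by ring, Real.mul_rpow hv.1.le (by linarith [hv'.2]),
      ← hp, Complex.ofReal_mul]
    ring
  · intro v hv
    rw [hzero v hv.1 hv.2, zero_mul, mul_zero]

/-- At height c = 1 the slice radius is zero: the integrand is constant and only the total mass of
the slice sphere remains. -/
theorem meanExt_zero (f : 𝓢(EuclideanSpace ℝ (Fin (m + 2)), ℂ))
    {η : EuclideanSpace ℝ (Fin (m + 2))} (hη : ‖η‖ = 1) :
    meanExt f (0, η) =
      (volume : Measure (EuclideanSpace ℝ (Fin (m + 1)))).toSphere.real Set.univ * f η := by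
  set e : EuclideanSpace ℝ (Fin (m + 2)) := EuclideanSpace.single 0 1 with he
  obtain ⟨R, hR⟩ := exists_isometry_apply_eq (v := e) (w := η) (by simp [e, hη])
  have h := integral_slice_eq_meanExt f R (c := 1) (by simp)
  have h1 : consPt 1 (0 : EuclideanSpace ℝ (Fin (m + 1))) = e := by
    ext i
    refine Fin.cases ?_ (fun i => ?_) i <;> simp [e]
  simp only [one_pow, sub_self, Real.sqrt_zero, zero_smul, ← he, hR, h1, integral_const] at h
  rw [← h, Complex.real_smul]

end DeSitter

end

/-! ### The Beta kernel identity. -/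

noncomputable section

namespace DeSitter

theorem add_mem_slitPlane {X : ℂ} (hX : X.im ≠ 0) {r v : ℝ} (hv : 0 < v) :
    (r : ℂ) * X + v ∈ Complex.slitPlane := by
  rw [Complex.mem_slitPlane_iff]
  rcases eq_or_ne r 0 with rfl | hr
  · left; simpa using hv
  · right; simp [hr, hX]

theorem hasDerivAt_line_cpow {z w : ℂ} {t : ℝ} (h : z * t + w ∈ Complex.slitPlane) (p : ℂ) :
    HasDerivAt (fun t : ℝ => (z * t + w) ^ p) (p * (z * t + w) ^ (p - 1) * z) t := by
  have h1 : HasDerivAt (fun t : ℂ => z * t + w) z t := by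
    simpa using ((hasDerivAt_id (t : ℂ)).const_mul z).add_const w
  exact (h1.cpow_const (c := p) h).comp_ofReal

/-- A beta integral with a linear form in the kernel. -/
theorem integral_beta_kernel {X : ℂ} (hX : X.im ≠ 0) {v : ℝ} (hv : 0 < v) {a b : ℂ}
    (ha : 0 < a.re) (hb : 0 < b.re) :
    ∫ τ in (0 : ℝ)..1, ((τ : ℂ) ^ (a - 1) * (1 - (τ : ℂ)) ^ (b - 1)) * (X * τ + v) ^ (-(a + b)) =
      Complex.betaIntegral a b * ((X + v) ^ (-a) * (v : ℂ) ^ (-b)) := by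
  set k : ℝ → ℂ := fun τ => (τ : ℂ) ^ (a - 1) * (1 - (τ : ℂ)) ^ (b - 1) with hk
  have hki : IntervalIntegrable k volume 0 1 := Complex.betaIntegral_convergent ha hb
  have hsl : ∀ t τ : ℝ, (t : ℂ) * X * τ + v ∈ Complex.slitPlane := fun t τ => by
    have := add_mem_slitPlane hX (r := t * τ) hv
    push_cast at this
    rwa [mul_right_comm] at this
  have hsl' : ∀ t τ : ℝ, X * τ * t + v ∈ Complex.slitPlane := fun t τ => by
    have := hsl t τ
    rwa [mul_comm (t : ℂ) X, mul_right_comm] at this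
  have hcont : ∀ p : ℂ, Continuous fun q : ℝ × ℝ => (X * q.2 * q.1 + v : ℂ) ^ p := fun p =>
    Continuous.cpow (by fun_prop) continuous_const fun q => hsl' q.1 q.2
  -- Deform X to tX. The quantity A(t)(tX + v)^a will turn out independent of t: at t = 0 it is a
  -- Beta integral, at t = 1 it is the integral sought.
  set A : ℝ → ℂ := fun t => ∫ τ in (0 : ℝ)..1, k τ * (X * τ * t + v) ^ (-(a + b)) with hA
  have hint : ∀ (t : ℝ) (p : ℂ),
      IntervalIntegrable (fun τ => k τ * (X * τ * t + v) ^ p) volume 0 1 := fun t p =>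
    hki.mul_continuousOn ((hcont p).comp (by fun_prop : Continuous fun τ : ℝ => (t, τ))).continuousOn
  have hAd : ∀ t : ℝ, HasDerivAt A (∫ τ in (0 : ℝ)..1,
      k τ * (-(a + b) * (X * τ * t + v) ^ (-(a + b) - 1) * (X * τ))) t := by
    intro t
    have hc2 : Continuous fun q : ℝ × ℝ =>
        (-(a + b) * (X * q.2 * q.1 + v : ℂ) ^ (-(a + b) - 1) * (X * q.2)) :=
      (continuous_const.mul (hcont _)).mul (by fun_prop)
    obtain ⟨C, hC⟩ := (IsCompact.prod (isCompact_closedBall t 1)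
      (isCompact_Icc (a := (0 : ℝ)) (b := 1))).exists_bound_of_continuousOn hc2.continuousOn
    refine (intervalIntegral.hasDerivAt_integral_of_dominated_loc_of_deriv_le
      (F := fun (t τ : ℝ) => k τ * (X * τ * t + v) ^ (-(a + b)))
      (F' := fun (t τ : ℝ) => k τ * (-(a + b) * (X * τ * t + v) ^ (-(a + b) - 1) * (X * τ)))
      (bound := fun τ => ‖k τ‖ * C) (ball_mem_nhds t one_pos) ?_ (hint t _) ?_ ?_ ?_ ?_).2
    · exact Eventually.of_forall fun t' => (hint t' _).def'.aestronglyMeasurable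
    · exact (hki.mul_continuousOn (hc2.comp
        (by fun_prop : Continuous fun τ : ℝ => (t, τ))).continuousOn).def'.aestronglyMeasurable
    · refine Eventually.of_forall fun τ hτ t' ht' => ?_
      rw [norm_mul]
      rw [Set.uIoc_of_le zero_le_one] at hτ
      exact mul_le_mul_of_nonneg_left
        (hC (t', τ) ⟨ball_subset_closedBall ht', hτ.1.le, hτ.2⟩) (norm_nonneg _)
    · exact hki.norm.mul_const _
    · exact Eventually.of_forall fun τ _ t' _ =>
        (hasDerivAt_line_cpow (hsl' t' τ) _).const_mul (k τ)
  -- The integrand is the τ-derivative of τ^a (1 - τ)^b (tXτ + v)^(-(a+b)), which vanishes at both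
  -- ends because a and b have positive real part.
  have hFTC : ∀ t : ℝ, ∫ τ in (0 : ℝ)..1, k τ * (X * τ * t + v) ^ (-(a + b) - 1) *
      (a * v - τ * ((a + b) * v + b * (t * X))) = 0 := by
    intro t
    have h1 := intervalIntegral.integral_eq_sub_of_hasDerivAt_of_le (a := (0 : ℝ)) (b := 1)
      zero_le_one
      (f := fun τ : ℝ => ((τ : ℂ) ^ a * (1 - (τ : ℂ)) ^ b) * (t * X * τ + v) ^ (-(a + b)))
      (f' := fun τ : ℝ => k τ * (X * τ * t + v) ^ (-(a + b) - 1) *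
        (a * v - τ * ((a + b) * v + b * (t * X)))) ?_ ?_ ?_
    · rw [h1]
      have ha0 : a ≠ 0 := fun h => by simp [h] at ha
      have hb0 : b ≠ 0 := fun h => by simp [h] at hb
      simp [Complex.zero_cpow ha0, Complex.zero_cpow hb0]
    · refine Continuous.continuousOn ?_
      refine ((Complex.continuous_ofReal_cpow_const ha).mul ?_).mul ?_
      · have h2 := (Complex.continuous_ofReal_cpow_const hb).comp
          (by fun_prop : Continuous fun τ : ℝ => 1 - τ)
        refine h2.congr fun τ => ?_
        simp
      · exact Continuous.cpow (by fun_prop) continuous_const fun τ => hsl t τ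
    · intro τ hτ
      have hτ0 : (τ : ℂ) ≠ 0 := by exact_mod_cast hτ.1.ne'
      have hτ1 : (1 - (τ : ℂ)) ≠ 0 := by
        have : (1 - τ : ℝ) ≠ 0 := by linarith [hτ.2]
        exact_mod_cast this
      have d1 : HasDerivAt (fun τ : ℝ => (τ : ℂ) ^ a) (a * (τ : ℂ) ^ (a - 1)) τ := by
        have := hasDerivAt_line_cpow (z := 1) (w := 0) (t := τ)
          (by simp [Complex.mem_slitPlane_iff, hτ.1]) a
        simpa using this
      have d2 : HasDerivAt (fun τ : ℝ => (1 - (τ : ℂ)) ^ b)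
          (-(b * (1 - (τ : ℂ)) ^ (b - 1))) τ := by
        have := hasDerivAt_line_cpow (z := -1) (w := 1) (t := τ)
          (by simp [Complex.mem_slitPlane_iff, hτ.2]) b
        simpa [neg_add_eq_sub] using this
      have d3 := hasDerivAt_line_cpow (hsl t τ) (-(a + b))
      refine ((d1.mul d2).mul d3).congr_deriv ?_
      have e1 : (τ : ℂ) ^ a = (τ : ℂ) ^ (a - 1) * τ := by
        rw [Complex.cpow_sub _ _ hτ0, Complex.cpow_one, div_mul_cancel₀ _ hτ0]
      have e2 : (1 - (τ : ℂ)) ^ b = (1 - (τ : ℂ)) ^ (b - 1) * (1 - τ) := by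
        rw [Complex.cpow_sub _ _ hτ1, Complex.cpow_one, div_mul_cancel₀ _ hτ1]
      have hne := Complex.slitPlane_ne_zero (hsl t τ)
      have e3 : ((t : ℂ) * X * τ + v) ^ (-(a + b)) =
          ((t : ℂ) * X * τ + v) ^ (-(a + b) - 1) * (t * X * τ + v) := by
        rw [Complex.cpow_sub _ _ hne, Complex.cpow_one, div_mul_cancel₀ _ hne]
      simp only [Pi.mul_apply]
      rw [e1, e2, e3, hk, show X * τ * t + v = t * X * τ + v by ring]
      ring
    · refine IntervalIntegrable.mul_continuousOn (hint t _) ?_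
      exact Continuous.continuousOn (by fun_prop)
  have hslt : ∀ t : ℝ, X * t + v ∈ Complex.slitPlane := fun t => by
    simpa using hsl' t 1
  have hφ : ∀ t : ℝ, HasDerivAt (fun t : ℝ => A t * (X * t + v) ^ a) 0 t := by
    intro t
    refine ((hAd t).mul (hasDerivAt_line_cpow (hslt t) a)).congr_deriv ?_
    have hne := Complex.slitPlane_ne_zero (hslt t)
    have e1 : (X * t + v) ^ a = (X * t + v) ^ (a - 1) * (X * t + v) := by
      rw [Complex.cpow_sub _ _ hne, Complex.cpow_one, div_mul_cancel₀ _ hne]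
    -- Up to the factor (tX + v)^(a - 1), the left side is the derivative of A(t)(tX + v)^a; it
    -- equals X times the vanishing integral of `hFTC`.
    have h2 : (∫ τ in (0 : ℝ)..1, k τ * (-(a + b) * (X * τ * t + v) ^ (-(a + b) - 1) * (X * τ))) *
        (X * t + v) + A t * (a * X) = X * ∫ τ in (0 : ℝ)..1, k τ *
          (X * τ * t + v) ^ (-(a + b) - 1) * (a * v - τ * ((a + b) * v + b * (t * X))) := by
      rw [hA, ← intervalIntegral.integral_mul_const, ← intervalIntegral.integral_mul_const,
        ← intervalIntegral.integral_const_mul, ← intervalIntegral.integral_add]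
      · refine intervalIntegral.integral_congr fun τ _ => ?_
        have hne := Complex.slitPlane_ne_zero (hsl' t τ)
        have e3 : (X * τ * t + v) ^ (-(a + b)) =
            (X * τ * t + v) ^ (-(a + b) - 1) * (X * τ * t + v) := by
          rw [Complex.cpow_sub _ _ hne, Complex.cpow_one, div_mul_cancel₀ _ hne]
        simp only [e3]
        ring
      · have := ((hint t (-(a + b) - 1)).mul_continuousOn (g := fun τ : ℝ =>
          -(a + b) * (X * τ) * (X * t + v)) (Continuous.continuousOn (by fun_prop)))
        refine this.congr fun τ _ => ?_
        ring
      · exact (hint t _).mul_const _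
    rw [hFTC, mul_zero] at h2
    rw [e1]
    linear_combination ((X * t + v) ^ (a - 1)) * h2
  have hconst := is_const_of_deriv_eq_zero (fun t => (hφ t).differentiableAt)
    (fun t => (hφ t).deriv) 1 0
  have hv0 : (v : ℂ) ≠ 0 := by exact_mod_cast hv.ne'
  have hX0 : X + v ≠ 0 := by simpa using Complex.slitPlane_ne_zero (hslt 1)
  have h3 : A 0 = Complex.betaIntegral a b * (v : ℂ) ^ (-(a + b)) := by
    rw [hA, Complex.betaIntegral, ← intervalIntegral.integral_mul_const]
    simp [hk]
  simp only [Complex.ofReal_one, mul_one, Complex.ofReal_zero, mul_zero, zero_add, h3] at hconst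
  have h4 : A 1 = ∫ τ in (0 : ℝ)..1, k τ * (X * τ + v) ^ (-(a + b)) := by simp [hA]
  rw [← h4, Complex.cpow_neg (X + v) a]
  have h5 : (X + v) ^ a ≠ 0 := by simp [Complex.cpow_eq_zero_iff, hX0]
  rw [eq_comm, ← mul_right_inj' h5]
  rw [mul_comm _ (A 1), hconst, neg_add, Complex.cpow_add _ _ hv0, Complex.cpow_neg _ a]
  have h6 : (v : ℂ) ^ a ≠ 0 := by simp [Complex.cpow_eq_zero_iff, hv0]
  field_simp

end DeSitter

end

/-! ### Euler operators, integration by parts and elementary power bounds. -/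

noncomputable section

namespace DeSitter

section Euler

variable {E : Type} [NormedAddCommGroup E] [NormedSpace ℝ E]

/-- Smooth functions on `ℝ × E` that are supported in `|v| ≤ 1/2`. -/
structure IsCapFunction (G : ℝ × E → ℂ) : Prop where
  contDiff : ContDiff ℝ ∞ G
  eq_zero : ∀ x : ℝ × E, 1 / 2 < |x.1| → G x = 0

/-- The partial derivative in the real variable. -/
def dv (G : ℝ × E → ℂ) (x : ℝ × E) : ℂ := fderiv ℝ G x (1, 0)

/-- The operator `v ∂_v + j`. -/
def eulerStep (j : ℕ) (G : ℝ × E → ℂ) (x : ℝ × E) : ℂ := (j : ℂ) * G x + (x.1 : ℂ) * dv G x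

/-- The product of the operators `v ∂_v + i`, `1 ≤ i ≤ j`. -/
def eulerProd : ℕ → (ℝ × E → ℂ) → (ℝ × E → ℂ)
  | 0, G => G
  | j + 1, G => eulerProd j (eulerStep (j + 1) G)

namespace IsCapFunction

variable {G : ℝ × E → ℂ}

theorem dv (hG : IsCapFunction G) : IsCapFunction (dv G) := by
  refine ⟨?_, fun x hx => ?_⟩
  · exact (hG.contDiff.fderiv_right (m := ∞) (by simp)).clm_apply contDiff_const
  · have h1 : G =ᶠ[𝓝 x] fun _ => 0 := by
      filter_upwards [(isOpen_lt (continuous_const (y := (1 / 2 : ℝ)))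
        (continuous_abs.comp continuous_fst)).mem_nhds hx] with y hy using hG.eq_zero y hy
    rw [DeSitter.dv, h1.fderiv_eq]
    simp

theorem eulerStep (hG : IsCapFunction G) (j : ℕ) : IsCapFunction (eulerStep j G) := by
  refine ⟨?_, fun x hx => ?_⟩
  · exact (contDiff_const.mul hG.contDiff).add
      ((Complex.ofRealCLM.contDiff.comp contDiff_fst).mul hG.dv.contDiff)
  · rw [DeSitter.eulerStep, hG.eq_zero x hx, hG.dv.eq_zero x hx]; simp

theorem eulerProd (j : ℕ) : ∀ {G : ℝ × E → ℂ}, IsCapFunction G → IsCapFunction (eulerProd j G) := by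
  induction j with
  | zero => exact fun h => h
  | succ j ih => exact fun h => ih (h.eulerStep (j + 1))

theorem hasDerivAt (hG : IsCapFunction G) (v : ℝ) (η : E) :
    HasDerivAt (fun v => G (v, η)) (DeSitter.dv G (v, η)) v :=
  ((hG.contDiff.differentiable (by simp) (v, η)).hasFDerivAt.comp_hasDerivAt v
    ((hasDerivAt_id v).prodMk (hasDerivAt_const v η)))

theorem continuous_slice (hG : IsCapFunction G) (η : E) : Continuous fun v : ℝ => G (v, η) :=
  hG.contDiff.continuous.comp (by fun_prop)

end IsCapFunction

/-- At v = 0 the operator v ∂_v + i reduces to multiplication by i. -/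
theorem eulerProd_zero (j : ℕ) : ∀ {G : ℝ × E → ℂ} (η : E),
    eulerProd j G (0, η) = j.factorial * G (0, η) := by
  induction j with
  | zero => intro G η; simp [eulerProd]
  | succ j ih =>
    intro G η
    rw [eulerProd, ih, eulerStep, Nat.factorial_succ]
    push_cast
    simp only [zero_mul, add_zero]
    ring

theorem hasDerivAt_add_cpow {Y : ℂ} (hY : Y.im ≠ 0) (v : ℝ) (p : ℂ) :
    HasDerivAt (fun v : ℝ => (Y + v) ^ p) (p * (Y + v) ^ (p - 1)) v := by
  have := hasDerivAt_line_cpow (z := 1) (w := Y) (t := v)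
    (by rw [Complex.mem_slitPlane_iff]; right; simpa using hY) p
  simpa [add_comm] using this

theorem continuous_add_cpow {Y : ℂ} (hY : Y.im ≠ 0) (p : ℂ) :
    Continuous (fun v : ℝ => (Y + v) ^ p) :=
  continuous_iff_continuousAt.2 fun v => (hasDerivAt_add_cpow hY v p).continuousAt

/-- Integration by parts: the support condition kills the boundary term at v = 1, while the one at v
= 0 survives and later produces the singular power. -/
theorem integral_cpow_mul_eq {G : ℝ × E → ℂ} (hG : IsCapFunction G) (η : E) {Y : ℂ}
    (hY : Y.im ≠ 0) {p : ℂ} (hp : p + 1 ≠ 0) :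
    ∫ v in (0 : ℝ)..1, (Y + v) ^ p * G (v, η) = -(p + 1)⁻¹ * (Y ^ (p + 1) * G (0, η) +
      ∫ v in (0 : ℝ)..1, (Y + v) ^ (p + 1) * dv G (v, η)) := by
  have c1 : Continuous fun v : ℝ => (Y + v) ^ p * G (v, η) :=
    (continuous_add_cpow hY p).mul (hG.continuous_slice η)
  have c2 : Continuous fun v : ℝ => (Y + v) ^ (p + 1) * dv G (v, η) :=
    (continuous_add_cpow hY (p + 1)).mul (hG.dv.continuous_slice η)
  have h := intervalIntegral.integral_eq_sub_of_hasDerivAt (a := (0 : ℝ)) (b := 1)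
    (f := fun v : ℝ => (Y + v) ^ (p + 1) * G (v, η))
    (f' := fun v : ℝ => (p + 1) * ((Y + v) ^ p * G (v, η)) + (Y + v) ^ (p + 1) * dv G (v, η))
    (fun v _ => by
      refine ((hasDerivAt_add_cpow hY v (p + 1)).mul (hG.hasDerivAt v η)).congr_deriv ?_
      rw [add_sub_cancel_right]; ring)
    (((continuous_const.mul c1).add c2).intervalIntegrable _ _)
  rw [intervalIntegral.integral_add ((c1.intervalIntegrable _ _).const_mul _)
    (c2.intervalIntegrable _ _), intervalIntegral.integral_const_mul,
    hG.eq_zero (1, η) (by norm_num)] at h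
  simp only [mul_zero, Complex.ofReal_zero, add_zero, zero_sub] at h
  field_simp
  linear_combination h

/-- The Euler operators arise from ∂_v(v^(j+1) G) = v^j (v ∂_v + j + 1) G, and the factor v^(j+1)
removes the boundary term at 0. Each power of v thus pays for one unit of the exponent. -/
theorem integral_cpow_mul_pow_succ_eq {G : ℝ × E → ℂ} (hG : IsCapFunction G) (η : E) {Y : ℂ}
    (hY : Y.im ≠ 0) {p : ℂ} (hp : p + 1 ≠ 0) (j : ℕ) :
    ∫ v in (0 : ℝ)..1, (Y + v) ^ p * (v : ℂ) ^ (j + 1) * G (v, η) = -(p + 1)⁻¹ *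
      ∫ v in (0 : ℝ)..1, (Y + v) ^ (p + 1) * (v : ℂ) ^ j * eulerStep (j + 1) G (v, η) := by
  have hv : ∀ k : ℕ, Continuous fun v : ℝ => (v : ℂ) ^ k := fun k => by fun_prop
  have c1 : Continuous fun v : ℝ => (Y + v) ^ p * (v : ℂ) ^ (j + 1) * G (v, η) :=
    ((continuous_add_cpow hY p).mul (hv (j + 1))).mul (hG.continuous_slice η)
  have c2 : Continuous fun v : ℝ => (Y + v) ^ (p + 1) * (v : ℂ) ^ j * eulerStep (j + 1) G (v, η) :=
    ((continuous_add_cpow hY (p + 1)).mul (hv j)).mul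
      ((hG.eulerStep (j + 1)).continuous_slice η)
  have h := intervalIntegral.integral_eq_sub_of_hasDerivAt (a := (0 : ℝ)) (b := 1)
    (f := fun v : ℝ => (Y + v) ^ (p + 1) * (v : ℂ) ^ (j + 1) * G (v, η))
    (f' := fun v : ℝ => (p + 1) * ((Y + v) ^ p * (v : ℂ) ^ (j + 1) * G (v, η)) +
      (Y + v) ^ (p + 1) * (v : ℂ) ^ j * eulerStep (j + 1) G (v, η))
    (fun v _ => by
      have d1 : HasDerivAt (fun v : ℝ => (v : ℂ) ^ (j + 1)) ((j + 1 : ℕ) * (v : ℂ) ^ j) v := by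
        have := (hasDerivAt_pow (j + 1) (v : ℂ)).comp_ofReal
        simpa using this
      refine (((hasDerivAt_add_cpow hY v (p + 1)).mul d1).mul (hG.hasDerivAt v η)).congr_deriv ?_
      simp only [Pi.mul_apply]
      rw [add_sub_cancel_right, eulerStep]; ring)
    (((continuous_const.mul c1).add c2).intervalIntegrable _ _)
  rw [intervalIntegral.integral_add ((c1.intervalIntegrable _ _).const_mul _)
    (c2.intervalIntegrable _ _), intervalIntegral.integral_const_mul,
    hG.eq_zero (1, η) (by norm_num)] at h
  simp only [mul_zero, Complex.ofReal_zero, ne_eq, Nat.add_eq_zero_iff, one_ne_zero, and_false,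
    not_false_eq_true, zero_pow, zero_mul, sub_zero] at h
  field_simp
  linear_combination h

/-- Repeated integration by parts. -/
theorem integral_cpow_mul_pow_eq {s : ℂ} (hs : s.re = 0) {Y : ℂ} (hY : Y.im ≠ 0) (η : E) (j : ℕ) :
    ∀ {G : ℝ × E → ℂ}, IsCapFunction G →
    ∫ v in (0 : ℝ)..1, (Y + v) ^ (s - j - 1) * (v : ℂ) ^ j * G (v, η) =
      (∏ i ∈ Finset.range j, ((i : ℂ) + 1 - s))⁻¹ *
        ∫ v in (0 : ℝ)..1, (Y + v) ^ (s - 1) * eulerProd j G (v, η) := by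
  induction j with
  | zero => intro G hG; simp [eulerProd]
  | succ j ih =>
    intro G hG
    have hne : (s - ((j + 1 : ℕ) : ℂ) - 1) + 1 ≠ 0 := fun h => by
      have := congrArg Complex.re h
      simp [hs] at this
      have h2 : (0 : ℝ) ≤ j := by positivity
      linarith
    rw [integral_cpow_mul_pow_succ_eq hG η hY hne, Finset.prod_range_succ,
      show (s - ((j + 1 : ℕ) : ℂ) - 1) + 1 = s - j - 1 by push_cast; ring,
      ih (hG.eulerStep (j + 1)), eulerProd, mul_inv,
      show (s - (j : ℂ) - 1) = -(j + 1 - s) by ring, inv_neg]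
    ring

end Euler

theorem norm_cpow_le_of_re {z s : ℂ} :
    ‖z ^ s‖ ≤ ‖z‖ ^ s.re * Real.exp (Real.pi * |s.im|) := by
  refine (Complex.norm_cpow_le z s).trans ?_
  rw [div_eq_mul_inv, ← Real.exp_neg]
  refine mul_le_mul_of_nonneg_left (Real.exp_le_exp.2 ?_) (Real.rpow_nonneg (norm_nonneg _) _)
  calc -(z.arg * s.im) ≤ |z.arg * s.im| := neg_le_abs _
    _ = |z.arg| * |s.im| := abs_mul _ _
    _ ≤ Real.pi * |s.im| := by gcongr; exact Complex.abs_arg_le_pi z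

/-- The imaginary part of Xτ + v controls τ, and then the triangle inequality controls v. -/
theorem add_le_const_mul_norm {X : ℂ} (hX : X.im ≠ 0) {τ v : ℝ} (hτ : 0 ≤ τ) (hv : 0 ≤ v) :
    τ + v ≤ (1 + (‖X‖ + 1) / |X.im|) * ‖X * τ + v‖ := by
  have hy : 0 < |X.im| := abs_pos.2 hX
  have h1 : |X.im| * τ ≤ ‖X * τ + v‖ := by
    have := Complex.abs_im_le_norm (X * τ + v)
    simpa [abs_mul, abs_of_nonneg hτ] using this
  have h2 : v ≤ ‖X * τ + v‖ + ‖X‖ * τ := by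
    have := norm_sub_le (X * τ + v) (X * τ)
    simpa [abs_of_nonneg hτ, abs_of_nonneg hv] using this
  have h3 : τ ≤ ‖X * τ + v‖ / |X.im| := by rw [le_div_iff₀ hy]; linarith
  calc τ + v ≤ ‖X * τ + v‖ + (‖X‖ + 1) * τ := by linarith
    _ ≤ ‖X * τ + v‖ + (‖X‖ + 1) * (‖X * τ + v‖ / |X.im|) := by gcongr
    _ = _ := by field_simp

/-- This splits the corner singularity 1/(τ + v) into two integrable powers. The exponents are
unequal because the Beta weight already carries τ^(α - 1) with α possibly 1/2: an extra τ^(-1/4) is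
affordable there, τ^(-1/2) would not be. -/
theorem inv_add_le_rpow {τ v : ℝ} (hτ : 0 < τ) (hv : 0 < v) :
    (τ + v)⁻¹ ≤ τ ^ (-(1 / 4) : ℝ) * v ^ (-(3 / 4) : ℝ) := by
  have h1 : τ ^ (1 / 4 : ℝ) * v ^ (3 / 4 : ℝ) ≤ τ + v := by
    calc τ ^ (1 / 4 : ℝ) * v ^ (3 / 4 : ℝ) ≤ (τ + v) ^ (1 / 4 : ℝ) * (τ + v) ^ (3 / 4 : ℝ) := by
          gcongr <;> linarith
      _ = τ + v := by rw [← Real.rpow_add (by positivity)]; norm_num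
  rw [Real.rpow_neg hτ.le, Real.rpow_neg hv.le, ← mul_inv]
  exact inv_anti₀ (by positivity) h1

end DeSitter

end

/-! ### Beta representation of the cap integral. -/

noncomputable section

namespace DeSitter

section BetaTransform

variable {E : Type} [NormedAddCommGroup E] [NormedSpace ℝ E]

theorem norm_one_sub_cpow_le {α : ℝ} (hα : 0 ≤ α) {τ : ℝ} (h0 : 0 ≤ τ) (h1 : τ ≤ 1) :
    ‖(1 - (τ : ℂ)) ^ (α : ℂ)‖ ≤ 1 := by
  rw [show (1 - (τ : ℂ)) = ((1 - τ : ℝ) : ℂ) by push_cast; rfl,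
    ← Complex.ofReal_cpow (by linarith), Complex.norm_real,
    Real.norm_of_nonneg (Real.rpow_nonneg (by linarith) _)]
  exact Real.rpow_le_one (by linarith) (by linarith) hα

/-- The factor v^n absorbs n of the n + 1 inverse powers of ‖Xτ + v‖, since v ≤ τ + v is comparable
to that norm; only 1/(τ + v) is left. -/
theorem norm_cpow_mul_pow_le {s : ℂ} (hs : s.re = 0) {X : ℂ} (hX : X.im ≠ 0) (n : ℕ) {τ v : ℝ}
    (hτ : 0 < τ) (hv : 0 < v) :
    ‖(X * τ + v) ^ (s - n - 1) * (v : ℂ) ^ n‖ ≤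
      Real.exp (Real.pi * |s.im|) * (1 + (‖X‖ + 1) / |X.im|) ^ (n + 1) *
        (τ ^ (-(1 / 4) : ℝ) * v ^ (-(3 / 4) : ℝ)) := by
  set C := 1 + (‖X‖ + 1) / |X.im| with hC
  set N := ‖X * τ + v‖ with hN
  have h1 : τ + v ≤ C * N := add_le_const_mul_norm hX hτ.le hv.le
  have hC0 : 0 < C := by positivity
  have hN0 : 0 < N := by
    by_contra h
    have : C * N ≤ 0 := mul_nonpos_of_nonneg_of_nonpos hC0.le (not_lt.1 h)
    linarith
  have h2 : ‖(X * τ + v) ^ (s - n - 1)‖ ≤ (N ^ (n + 1))⁻¹ * Real.exp (Real.pi * |s.im|) := by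
    refine norm_cpow_le_of_re.trans_eq ?_
    have e1 : (s - n - 1).re = -((n + 1 : ℕ) : ℝ) := by simp [hs]; ring
    have e2 : (s - n - 1).im = s.im := by simp
    rw [e1, e2, Real.rpow_neg (norm_nonneg _), Real.rpow_natCast]
  have h3 : v ^ n ≤ (C * N) ^ n := by gcongr; linarith
  have h4 : N⁻¹ ≤ C * (τ + v)⁻¹ := by
    rw [← div_eq_mul_inv, le_div_iff₀ (by positivity), inv_mul_le_iff₀ hN0]
    linarith
  rw [norm_mul, norm_pow, Complex.norm_real, Real.norm_of_nonneg hv.le]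
  calc ‖(X * τ + v) ^ (s - n - 1)‖ * v ^ n
      ≤ ((N ^ (n + 1))⁻¹ * Real.exp (Real.pi * |s.im|)) * (C * N) ^ n := by gcongr
    _ = Real.exp (Real.pi * |s.im|) * C ^ n * N⁻¹ := by
        rw [mul_pow, pow_succ]; field_simp
    _ ≤ Real.exp (Real.pi * |s.im|) * C ^ n * (C * (τ + v)⁻¹) := by gcongr
    _ = Real.exp (Real.pi * |s.im|) * C ^ (n + 1) * (τ + v)⁻¹ := by ring
    _ ≤ _ := by gcongr; exact inv_add_le_rpow hτ hv

/-- The function `Y ^ s w(0) + ∫ (Y + v) ^ s ∂_v w dv`. -/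
def powerLayer (s : ℂ) (w : ℝ × E → ℂ) (η : E) (Y : ℂ) : ℂ :=
  Y ^ s * w (0, η) + ∫ v in (0 : ℝ)..1, (Y + v) ^ s * dv w (v, η)

/-- The constant in the Beta representation of `∫ (X + v) ^ (s - α) v ^ (α - 1) g dv`. -/
def betaConst (s : ℂ) (n : ℕ) : ℂ :=
  -s⁻¹ * (∏ i ∈ Finset.range n, ((i : ℂ) + 1 - s))⁻¹ *
    (Complex.betaIntegral ((n / 2 : ℝ) - s) ((n / 2 : ℝ) + 1))⁻¹

theorem betaIntegral_ne_zero {a b : ℂ} (ha : 0 < a.re) (hb : 0 < b.re) :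
    Complex.betaIntegral a b ≠ 0 := by
  intro h
  have := Complex.Gamma_mul_Gamma_eq_betaIntegral ha hb
  rw [h, mul_zero] at this
  exact mul_ne_zero (Complex.Gamma_ne_zero_of_re_pos ha) (Complex.Gamma_ne_zero_of_re_pos hb) this

/-- Take a = α - s and b = α + 1 in the Beta kernel. As n = 2α, one has v^(α - 1) = v^(-b) v^n and a
+ b = n + 1 - s, so the power v^(α - 1) is traded for the integer power v^n and a τ-average. After
Fubini, n integrations by parts use up v^n, and one more brings the exponent to s and yields
`powerLayer`. -/
theorem integral_eq_betaConst_mul {s : ℂ} (hs : s.re = 0) (hs0 : s ≠ 0) {n : ℕ} (hn : 1 ≤ n)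
    {g : ℝ × E → ℂ} (hg : IsCapFunction g) (η : E) {X : ℂ} (hX : X.im ≠ 0) :
    ∫ v in (0 : ℝ)..1, (X + v) ^ (s - (n / 2 : ℝ)) * (v : ℂ) ^ ((n / 2 : ℝ) - 1 : ℂ) * g (v, η) =
      betaConst s n * ∫ τ in (0 : ℝ)..1, (τ : ℂ) ^ ((n / 2 : ℝ) - s - 1) *
        (1 - (τ : ℂ)) ^ (((n / 2 : ℝ) : ℝ) : ℂ) * powerLayer s (eulerProd n g) η (X * τ) := by
  set α : ℝ := n / 2 with hα
  have hn' : (1 : ℝ) ≤ n := by exact_mod_cast hn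
  have hα0 : 1 / 2 ≤ α := by rw [hα]; linarith
  have hnα : (n : ℂ) = α + α := by rw [hα]; push_cast; ring
  have ha : 0 < ((α : ℂ) - s).re := by simp [hs]; linarith
  have hb : 0 < ((α : ℂ) + 1).re := by simp; linarith
  set B := Complex.betaIntegral ((α : ℂ) - s) ((α : ℂ) + 1) with hB
  have hB0 : B ≠ 0 := betaIntegral_ne_zero ha hb
  have key : ∀ v ∈ Set.Ioc (0 : ℝ) 1,
      (X + v) ^ (s - α) * (v : ℂ) ^ (α - 1 : ℂ) * g (v, η) = B⁻¹ * ∫ τ in Set.Ioc (0 : ℝ) 1,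
        (τ : ℂ) ^ (α - s - 1) * (1 - (τ : ℂ)) ^ (α : ℂ) *
          ((X * τ + v) ^ (s - n - 1) * (v : ℂ) ^ n * g (v, η)) := by
    intro v hv
    have hb2 := integral_beta_kernel hX hv.1 ha hb
    rw [intervalIntegral.integral_of_le zero_le_one, ← hB] at hb2
    have e : ∀ τ : ℝ, (τ : ℂ) ^ (α - s - 1) * (1 - (τ : ℂ)) ^ (α : ℂ) *
          ((X * τ + v) ^ (s - n - 1) * (v : ℂ) ^ n * g (v, η)) =
        ((τ : ℂ) ^ (α - s - 1) * (1 - (τ : ℂ)) ^ ((α : ℂ) + 1 - 1)) *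
          (X * τ + v) ^ (-((α : ℂ) - s + (α + 1))) * ((v : ℂ) ^ n * g (v, η)) := fun τ => by
      rw [add_sub_cancel_right, show s - (n : ℂ) - 1 = -((α : ℂ) - s + (α + 1)) by rw [hnα]; ring]
      ring
    simp_rw [e]
    rw [integral_mul_const, hb2]
    have hv0 : (v : ℂ) ≠ 0 := by exact_mod_cast hv.1.ne'
    have e3 : (v : ℂ) ^ (α - 1 : ℂ) = (v : ℂ) ^ (-((α : ℂ) + 1)) * (v : ℂ) ^ n := by
      rw [← Complex.cpow_natCast, ← Complex.cpow_add _ _ hv0, hnα]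
      congr 1; ring
    rw [e3, neg_sub]
    field_simp
  rw [intervalIntegral.integral_of_le zero_le_one, intervalIntegral.integral_of_le zero_le_one,
    setIntegral_congr_fun measurableSet_Ioc key, integral_const_mul]
  obtain ⟨Cg, hCg⟩ : ∃ Cg, ∀ v ∈ Set.Icc (0 : ℝ) 1, ‖g (v, η)‖ ≤ Cg :=
    isCompact_Icc.exists_bound_of_continuousOn (hg.continuous_slice η).continuousOn
  have hint : Integrable (Function.uncurry fun v τ : ℝ =>
      (τ : ℂ) ^ (α - s - 1) * (1 - (τ : ℂ)) ^ (α : ℂ) *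
          ((X * τ + v) ^ (s - n - 1) * (v : ℂ) ^ n * g (v, η)))
      ((volume.restrict (Set.Ioc 0 1)).prod (volume.restrict (Set.Ioc 0 1))) := by
    have i1 : Integrable (fun v : ℝ => v ^ (-(3 / 4) : ℝ)) (volume.restrict (Set.Ioc 0 1)) :=
      (intervalIntegrable_iff_integrableOn_Ioc_of_le zero_le_one).1
        (intervalIntegral.intervalIntegrable_rpow' (by norm_num))
    have i2 : Integrable (fun v : ℝ => v ^ (α - 1 - 1 / 4 : ℝ)) (volume.restrict (Set.Ioc 0 1)) :=
      (intervalIntegrable_iff_integrableOn_Ioc_of_le zero_le_one).1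
        (intervalIntegral.intervalIntegrable_rpow' (by linarith))
    set K := Real.exp (Real.pi * |s.im|) * (1 + (‖X‖ + 1) / |X.im|) ^ (n + 1) with hK
    refine Integrable.mono' ((i1.mul_prod i2).const_mul (K * Cg)) ?_ ?_
    · have hgm : Measurable fun v : ℝ => g (v, η) := (hg.continuous_slice η).measurable
      refine Measurable.aestronglyMeasurable ?_
      have : Measurable fun x : ℝ × ℝ => g (x.1, η) := hgm.comp measurable_fst
      refine Measurable.mul (by fun_prop) (Measurable.mul (by fun_prop) this)
    · rw [Measure.prod_restrict]
      refine (ae_restrict_iff' (measurableSet_Ioc.prod measurableSet_Ioc)).2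
        (Eventually.of_forall ?_)
      rintro ⟨v, τ⟩ ⟨hv, hτ⟩
      simp only [Function.uncurry]
      have b1 : ‖(τ : ℂ) ^ (α - s - 1)‖ = τ ^ (α - 1) := by
        rw [Complex.norm_cpow_eq_rpow_re_of_pos hτ.1]; simp [hs]
      rw [norm_mul, norm_mul, norm_mul _ (g (v, η)), b1]
      calc τ ^ (α - 1) * ‖(1 - (τ : ℂ)) ^ (α : ℂ)‖ *
            (‖(X * τ + v) ^ (s - n - 1) * (v : ℂ) ^ n‖ * ‖g (v, η)‖)
          ≤ τ ^ (α - 1) * 1 * ((K * (τ ^ (-(1 / 4) : ℝ) * v ^ (-(3 / 4) : ℝ))) * Cg) := by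
            gcongr
            · exact mul_nonneg (Real.rpow_nonneg hτ.1.le _) zero_le_one
            · exact Real.rpow_nonneg hτ.1.le _
            · exact norm_one_sub_cpow_le (by linarith) hτ.1.le hτ.2
            · have := Real.rpow_nonneg hτ.1.le (-(1 / 4))
              have := Real.rpow_nonneg hv.1.le (-(3 / 4))
              positivity
            · exact norm_cpow_mul_pow_le hs hX n hτ.1 hv.1
            · exact hCg v ⟨hv.1.le, hv.2⟩
        _ = _ := by
            rw [sub_eq_add_neg (α - 1) (1 / 4), Real.rpow_add hτ.1]; ring
  rw [integral_integral_swap hint]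
  rw [betaConst, ← hα, ← hB, ← integral_const_mul, ← integral_const_mul]
  refine setIntegral_congr_fun measurableSet_Ioc fun τ hτ => ?_
  have hY : (X * τ).im ≠ 0 := by simp [hX, hτ.1.ne']
  have h2 := integral_cpow_mul_pow_eq hs hY η n hg
  have h3 := integral_cpow_mul_eq (hg.eulerProd n) η hY (p := s - 1) (by simpa using hs0)
  rw [intervalIntegral.integral_of_le zero_le_one] at h2
  rw [integral_const_mul, h2, h3, powerLayer, sub_add_cancel]
  ring

end BetaTransform

end DeSitter

end

/-! ### Boundary values of logarithms and powers. -/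

noncomputable section

namespace DeSitter

/-- The sign of `ε` as a real number. -/
def sgn (ε : ℤˣ) : ℝ := ((ε : ℤ) : ℝ)

theorem sgn_eq (ε : ℤˣ) : sgn ε = 1 ∨ sgn ε = -1 := by
  rcases Int.units_eq_one_or ε with h | h <;> simp [sgn, h]

theorem sgn_ne_zero (ε : ℤˣ) : sgn ε ≠ 0 := by
  rcases sgn_eq ε with h | h <;> rw [h] <;> norm_num

/-- The boundary value of the logarithm at the real point `y`. -/
def bdryLog (ε : ℤˣ) (y : ℝ) : ℂ :=
  Real.log |y| + if y < 0 then (sgn ε * Real.pi : ℝ) * Complex.I else 0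

/-- The principal logarithm extends continuously to the negative axis from either side, with
imaginary part επ when approached from the side ε; on the positive axis it is simply continuous. -/
theorem tendsto_log_bdry {β : Type*} {l : Filter β} {f : β → ℂ} {y : ℝ} (hy : y ≠ 0) (ε : ℤˣ)
    (hf : Tendsto f l (𝓝 y)) (him : ∀ᶠ b in l, 0 < sgn ε * (f b).im) :
    Tendsto (fun b => Complex.log (f b)) l (𝓝 (bdryLog ε y)) := by
  rcases hy.lt_or_gt with h | h
  · have hre : (y : ℂ).re < 0 := by simpa using h
    have hi : (y : ℂ).im = 0 := by simp
    rcases sgn_eq ε with he | he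
    · have h2 : Tendsto f l (𝓝[{z : ℂ | 0 ≤ z.im}] (y : ℂ)) :=
        tendsto_nhdsWithin_iff.2 ⟨hf, him.mono fun b hb => by
          rw [he, one_mul] at hb; exact hb.le⟩
      have h3 := (Complex.tendsto_log_nhdsWithin_im_nonneg_of_re_neg_of_im_zero hre hi).comp h2
      simpa [bdryLog, h, he, sub_eq_add_neg, Function.comp_def] using h3
    · have h2 : Tendsto f l (𝓝[{z : ℂ | z.im < 0}] (y : ℂ)) :=
        tendsto_nhdsWithin_iff.2 ⟨hf, him.mono fun b hb => by
          rw [he] at hb; show (f b).im < 0; linarith⟩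
      have h3 := (Complex.tendsto_log_nhdsWithin_im_neg_of_re_neg_of_im_zero hre hi).comp h2
      simpa [bdryLog, h, he, sub_eq_add_neg, Function.comp_def] using h3
  · have h1 : (y : ℂ) ∈ Complex.slitPlane := Complex.ofReal_mem_slitPlane.2 h
    have h2 := (continuousAt_clog h1).tendsto.comp hf
    rw [bdryLog, if_neg h.not_gt, add_zero, abs_of_pos h, Complex.ofReal_log h.le]
    exact h2

/-- For y < 0 the boundary logarithm has imaginary part επ, and exp(iν · iεπ) = exp(-ενπ) is exactly
the jump factor in `i0Pow`. -/
theorem i0Pow_eq_exp {y : ℝ} (hy : y ≠ 0) (ε : ℤˣ) (ν : ℝ) :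
    i0Pow ε ν y = Complex.exp (bdryLog ε y * (Complex.I * ν)) := by
  have h0 : ((|y| : ℝ) : ℂ) ≠ 0 := by exact_mod_cast (abs_pos.2 hy).ne'
  rcases hy.lt_or_gt with h | h
  · rw [i0Pow, if_neg h.not_gt, if_pos h, zero_add, bdryLog, if_pos h, add_mul, Complex.exp_add,
      Complex.cpow_def_of_ne_zero h0, ← Complex.ofReal_log (abs_nonneg _), mul_comm]
    congr 1
    rw [Complex.ofReal_exp]
    congr 1
    push_cast [sgn]
    linear_combination (-(ε : ℤ) * ν * Real.pi : ℂ) * Complex.I_mul_I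
  · rw [i0Pow, if_pos h, if_neg h.not_gt, mul_zero, add_zero, bdryLog, if_neg h.not_gt, add_zero,
      Complex.cpow_def_of_ne_zero h0, ← Complex.ofReal_log (abs_nonneg _)]

theorem i0Pow_zero (ε : ℤˣ) (ν : ℝ) : i0Pow ε ν 0 = 0 := by simp [i0Pow]

theorem i0Pow_of_pos {y : ℝ} (hy : 0 < y) (ε : ℤˣ) (ν : ℝ) :
    i0Pow ε ν y = (y : ℂ) ^ (Complex.I * ν) := by
  simp [i0Pow, hy, hy.not_gt, abs_of_pos hy]

theorem norm_i0Pow_le (ε : ℤˣ) (ν y : ℝ) : ‖i0Pow ε ν y‖ ≤ Real.exp (Real.pi * |ν|) := by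
  by_cases hy : y = 0
  · rw [hy, i0Pow_zero, norm_zero]; positivity
  rw [i0Pow_eq_exp hy, Complex.norm_exp]
  refine Real.exp_le_exp.2 ?_
  have : (bdryLog ε y * (Complex.I * ν)).re = -(bdryLog ε y).im * ν := by
    simp [Complex.mul_re]
  rw [this, bdryLog]
  have hs : |sgn ε| = 1 := by rcases sgn_eq ε with h | h <;> simp [h]
  split_ifs
  · refine (le_abs_self _).trans_eq ?_
    simp [abs_mul, hs, abs_of_pos Real.pi_pos, -mul_eq_mul_left_iff, -neg_mul]
  · simp; positivity

/-- Positive scaling leaves the sign of the argument alone. This homogeneity is what allows the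
singular power to be pulled out of integrals over τ. -/
theorem i0Pow_mul {a : ℝ} (ha : 0 < a) (ε : ℤˣ) (ν y : ℝ) :
    i0Pow ε ν (a * y) = (a : ℂ) ^ (Complex.I * ν) * i0Pow ε ν y := by
  have h1 : (0 < a * y) ↔ 0 < y := by simp [ha]
  have h2 : (a * y < 0) ↔ y < 0 := by simp [mul_neg_iff, ha, ha.le]
  have h3 : ((|a * y| : ℝ) : ℂ) ^ (Complex.I * ν) =
      (a : ℂ) ^ (Complex.I * ν) * ((|y| : ℝ) : ℂ) ^ (Complex.I * ν) := by
    rw [abs_mul, abs_of_pos ha, Complex.ofReal_mul,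
      Complex.mul_cpow_ofReal_nonneg ha.le (abs_nonneg _)]
  rw [i0Pow, i0Pow, h3]
  simp only [h1, h2]
  split_ifs <;> ring

theorem measurable_i0Pow (ε : ℤˣ) (ν : ℝ) : Measurable (i0Pow ε ν) := by
  unfold i0Pow
  refine (Measurable.ite measurableSet_Ioi (by fun_prop) measurable_const).add
    (measurable_const.mul (Measurable.ite measurableSet_Iio (by fun_prop) measurable_const))

theorem tendsto_cpow_bdry {β : Type*} {l : Filter β} {f : β → ℂ} {y : ℝ} (hy : y ≠ 0) (ε : ℤˣ)
    (hf : Tendsto f l (𝓝 y)) (him : ∀ᶠ b in l, 0 < sgn ε * (f b).im) (p : ℂ) :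
    Tendsto (fun b => f b ^ p) l (𝓝 (Complex.exp (bdryLog ε y * p))) := by
  have h := (Complex.continuous_exp.tendsto _).comp
    ((tendsto_log_bdry hy ε hf him).mul_const p)
  refine h.congr' ?_
  filter_upwards [him] with b hb
  have : f b ≠ 0 := fun h0 => by simp [h0] at hb
  rw [Complex.cpow_def_of_ne_zero this]; rfl

theorem tendsto_cpow_i0Pow {β : Type*} {l : Filter β} {f : β → ℂ} {y : ℝ} (hy : y ≠ 0) (ε : ℤˣ)
    (hf : Tendsto f l (𝓝 y)) (him : ∀ᶠ b in l, 0 < sgn ε * (f b).im) (ν : ℝ) :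
    Tendsto (fun b => f b ^ (Complex.I * ν)) l (𝓝 (i0Pow ε ν y)) := by
  rw [i0Pow_eq_exp hy]
  exact tendsto_cpow_bdry hy ε hf him _

theorem contDiff_intervalIntegral {X : Type} [NormedAddCommGroup X] [NormedSpace ℝ X]
    [FiniteDimensional ℝ X] {b : ℝ} (hb : 0 ≤ b) {c : ℝ → ℂ}
    (hc : IntervalIntegrable c volume 0 b) {H : X × ℝ → ℂ} (hH : ContDiff ℝ ∞ H) :
    ContDiff ℝ ∞ fun x => ∫ y in (0 : ℝ)..b, c y * H (x, y) := by
  -- Clamping the integration variable to [0, b] changes nothing on the domain of integration and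
  -- makes it range in a compact set everywhere.
  have h1 : (fun x => ∫ y in (0 : ℝ)..b, c y * H (x, y)) = fun x =>
      ∫ y in Set.Ioc 0 b, c y * H (x, max 0 (min b y)) := by
    funext x
    rw [intervalIntegral.integral_of_le hb]
    refine setIntegral_congr_fun measurableSet_Ioc fun y hy => ?_
    simp only [min_eq_right hy.2, max_eq_right hy.1.le]
  rw [h1, ← contDiffOn_univ]
  refine contDiffOn_parametric_of_isCompact isOpen_univ (v := fun y : ℝ => max 0 (min b y))
    (by fun_prop) (isCompact_Icc (a := 0) (b := b)) (fun y => ⟨le_max_left _ _, ?_⟩)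
    ((intervalIntegrable_iff_integrableOn_Ioc_of_le hb).1 hc) hH.contDiffOn
  exact max_le hb (min_le_left _ _)

end DeSitter

end

/-! ### The boundary layer: smooth part plus singular power. -/

noncomputable section

namespace DeSitter

section BoundaryLayer

variable {E : Type} [NormedAddCommGroup E] [NormedSpace ℝ E]

theorem intervalIntegrable_of_norm_le {c f : ℝ → ℂ} {K a b : ℝ} (hc : Measurable c)
    (hb : ∀ y, ‖c y‖ ≤ K) (hf : Continuous f) :
    IntervalIntegrable (fun y => c y * f y) volume a b := by
  rw [intervalIntegrable_iff]
  exact ((intervalIntegrable_iff.1 (hf.intervalIntegrable a b)).bdd_mul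
    hc.aestronglyMeasurable (Eventually.of_forall hb))

theorem norm_cpow_I_le {x : ℝ} (ν : ℝ) : ‖(x : ℂ) ^ (Complex.I * ν)‖ ≤ Real.exp (Real.pi * |ν|) := by
  by_cases hν : ν = 0
  · subst hν; simp
  by_cases hx : x = 0
  · subst hx
    rw [Complex.ofReal_zero, Complex.zero_cpow (by simp [hν]), norm_zero]
    positivity
  refine norm_cpow_le_of_re.trans_eq ?_
  simp

theorem norm_cpow_I_le' {z : ℂ} (ν : ℝ) : ‖z ^ (Complex.I * ν)‖ ≤ Real.exp (Real.pi * |ν|) := by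
  refine norm_cpow_le_of_re.trans_eq ?_
  simp

/-- The boundary value of `powerLayer` on the real axis. -/
def boundaryLayer (ε : ℤˣ) (ν : ℝ) (w : ℝ × E → ℂ) (η : E) (M : ℝ) : ℂ :=
  i0Pow ε ν M * w (0, η) + ∫ v in (0 : ℝ)..1, i0Pow ε ν (M + v) * dv w (v, η)

/-- The part of `boundaryLayer` that is smooth in `M`. -/
def layerRegular (ν : ℝ) (w : ℝ × E → ℂ) (x : ℝ × E) : ℂ :=
  ∫ y in (0 : ℝ)..2, (y : ℂ) ^ (Complex.I * ν) * dv w (y - x.1, x.2)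

/-- The coefficient of the singular power in `boundaryLayer`. -/
def layerSingular (ν : ℝ) (w : ℝ × E → ℂ) (x : ℝ × E) : ℂ :=
  w (0, x.2) - x.1 * ∫ τ in (0 : ℝ)..1, (τ : ℂ) ^ (Complex.I * ν) * dv w (x.1 * (τ - 1), x.2)

variable {w : ℝ × E → ℂ}

/-- With y = M + v the integral runs over [M, M + 1]; split it at y = 0. The piece from 0 to M + 1
extends to 2 by the support of w and involves only the fixed weight y^(iν) on y > 0, so M enters
only inside the smooth factor. The piece from 0 to M, rescaled by y = τM, is (M ± i0)^(iν) M times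
an integral smooth in M; this also covers M < 0, with an oriented integral. -/
theorem boundaryLayer_eq (hw : IsCapFunction w) (ε : ℤˣ) (ν : ℝ) (η : E) {M : ℝ} (hM : |M| ≤ 1) :
    boundaryLayer ε ν w η M =
      layerRegular ν w (M, η) + i0Pow ε ν M * layerSingular ν w (M, η) := by
  have hM' := abs_le.1 hM
  set h : ℝ → ℂ := fun y => i0Pow ε ν y * dv w (y - M, η) with hh
  have hcont : Continuous fun y : ℝ => dv w (y - M, η) :=
    (hw.dv.continuous_slice η).comp (by fun_prop : Continuous fun y : ℝ => y - M)
  have hI : ∀ a b, IntervalIntegrable h volume a b := fun a b =>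
    intervalIntegrable_of_norm_le (measurable_i0Pow ε ν) (norm_i0Pow_le ε ν) hcont
  have e1 : ∫ v in (0 : ℝ)..1, i0Pow ε ν (M + v) * dv w (v, η) = ∫ y in M..(M + 1), h y := by
    have := intervalIntegral.integral_comp_add_left (a := (0 : ℝ)) (b := 1) h M
    rw [add_zero] at this
    rw [← this]
    simp [hh]
  have e2 : ∫ y in M..(M + 1), h y = (∫ y in (0 : ℝ)..(M + 1), h y) - ∫ y in (0 : ℝ)..M, h y :=
    (intervalIntegral.integral_interval_sub_left (hI _ _) (hI _ _)).symm
  have e3 : ∫ y in (0 : ℝ)..(M + 1), h y = ∫ y in (0 : ℝ)..2, h y := by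
    rw [← intervalIntegral.integral_add_adjacent_intervals (hI 0 (M + 1)) (hI (M + 1) 2)]
    have : ∫ y in (M + 1)..2, h y = 0 := by
      rw [intervalIntegral.integral_of_le (by linarith)]
      refine setIntegral_eq_zero_of_forall_eq_zero fun y hy => ?_
      have : 1 / 2 < |y - M| := lt_of_lt_of_le (by linarith [hy.1]) (le_abs_self (y - M))
      rw [hh]; simp only []
      rw [hw.dv.eq_zero _ this, mul_zero]
    rw [this, add_zero]
  have e4 : ∫ y in (0 : ℝ)..2, h y = layerRegular ν w (M, η) := by
    rw [layerRegular, intervalIntegral.integral_of_le zero_le_two,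
      intervalIntegral.integral_of_le zero_le_two]
    refine setIntegral_congr_fun measurableSet_Ioc fun y hy => ?_
    simp only [hh, i0Pow_of_pos hy.1]
  have e5 : ∫ y in (0 : ℝ)..M, h y = i0Pow ε ν M * (M *
      ∫ τ in (0 : ℝ)..1, (τ : ℂ) ^ (Complex.I * ν) * dv w (M * (τ - 1), η)) := by
    have := intervalIntegral.smul_integral_comp_mul_right (a := (0 : ℝ)) (b := 1) h M
    rw [zero_mul, one_mul] at this
    have h2 : ∫ τ in (0 : ℝ)..1, h (τ * M) = i0Pow ε ν M *
        ∫ τ in (0 : ℝ)..1, (τ : ℂ) ^ (Complex.I * ν) * dv w (M * (τ - 1), η) := by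
      rw [intervalIntegral.integral_of_le zero_le_one,
        intervalIntegral.integral_of_le zero_le_one, ← integral_const_mul]
      refine setIntegral_congr_fun measurableSet_Ioc fun τ hτ => ?_
      simp only [hh, i0Pow_mul hτ.1]
      rw [show τ * M - M = M * (τ - 1) by ring]
      ring
    rw [← this, h2, Complex.real_smul]
    ring
  rw [boundaryLayer, e1, e2, e3, e4, e5, layerSingular]
  ring

/-- A purely imaginary exponent keeps all powers below exp(π|ν|), so dominated convergence applies;
the exceptional point v = -M is null. -/
theorem tendsto_powerLayer (hw : IsCapFunction w) (ε : ℤˣ) (ν : ℝ) (η : E) {M : ℝ} (hM : M ≠ 0)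
    {β : Type*} {l : Filter β} [l.IsCountablyGenerated] {f : β → ℂ} (hf : Tendsto f l (𝓝 M))
    (him : ∀ᶠ b in l, 0 < sgn ε * (f b).im) :
    Tendsto (fun b => powerLayer (Complex.I * ν) w η (f b)) l (𝓝 (boundaryLayer ε ν w η M)) := by
  refine ((tendsto_cpow_i0Pow hM ε hf him ν).mul_const _).add ?_
  refine intervalIntegral.tendsto_integral_filter_of_dominated_convergence
    (fun v => Real.exp (Real.pi * |ν|) * ‖dv w (v, η)‖) ?_ ?_ ?_ ?_
  · refine Eventually.of_forall fun b => Measurable.aestronglyMeasurable ?_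
    have := (hw.dv.continuous_slice η).measurable
    exact (by fun_prop : Measurable fun v : ℝ => (f b + v) ^ (Complex.I * ν)).mul this
  · refine Eventually.of_forall fun b => ae_of_all _ fun v _ => ?_
    rw [norm_mul]
    gcongr
    exact norm_cpow_I_le' ν
  · exact (continuous_const.mul (hw.dv.continuous_slice η).norm).intervalIntegrable _ _
  · have h0 : ∀ᵐ v : ℝ, v ≠ -M := by
      rw [ae_iff]; simp
    filter_upwards [h0] with v hv _
    have h1 : M + v ≠ 0 := fun h => hv (by linarith)
    refine (tendsto_cpow_i0Pow h1 ε ?_ ?_ ν).mul_const _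
    · push_cast
      exact hf.add_const _
    · simpa using him

/-- A bound for `powerLayer`. -/
theorem norm_powerLayer_le (ν : ℝ) (η : E) {K : ℝ}
    (hK : ∀ v ∈ Set.Icc (0 : ℝ) 1, ‖w (v, η)‖ ≤ K ∧ ‖dv w (v, η)‖ ≤ K) (Y : ℂ) :
    ‖powerLayer (Complex.I * ν) w η Y‖ ≤ 2 * Real.exp (Real.pi * |ν|) * K := by
  have h0 := (hK 0 ⟨le_rfl, zero_le_one⟩).1
  have hK0 : 0 ≤ K := (norm_nonneg _).trans h0
  have h1 : ‖∫ v in (0 : ℝ)..1, (Y + v) ^ (Complex.I * ν) * dv w (v, η)‖ ≤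
      Real.exp (Real.pi * |ν|) * K * |1 - 0| := by
    refine intervalIntegral.norm_integral_le_of_norm_le_const fun v hv => ?_
    rw [Set.uIoc_of_le zero_le_one] at hv
    rw [norm_mul]
    exact mul_le_mul (norm_cpow_I_le' ν) (hK v ⟨hv.1.le, hv.2⟩).2 (norm_nonneg _) (by positivity)
  rw [powerLayer]
  refine (norm_add_le _ _).trans ?_
  rw [norm_mul]
  have := mul_le_mul (norm_cpow_I_le' (z := Y) ν) h0 (norm_nonneg _) (by positivity)
  simp at h1
  linarith

/-- This supplies measurability in τ for the dominated convergence in `tendsto_capIntegral`. -/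
theorem continuous_powerLayer (hw : IsCapFunction w) (ν : ℝ) (η : E) {X : ℂ} (hX : X.im ≠ 0) :
    ContinuousOn (fun τ : ℝ => powerLayer (Complex.I * ν) w η (X * τ)) {0}ᶜ := by
  intro τ hτ
  have him : (X * τ).im ≠ 0 := by simpa [hX] using hτ
  have hX0 : X * τ ∈ Complex.slitPlane := Complex.mem_slitPlane_iff.2 (Or.inr him)
  refine ContinuousAt.continuousWithinAt ?_
  have hc : ContinuousAt (fun τ : ℝ => X * τ) τ := by fun_prop
  refine ((hc.cpow continuousAt_const hX0).mul_const _).add ?_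
  refine intervalIntegral.continuousAt_of_dominated_interval (μ := volume)
    (bound := fun v => Real.exp (Real.pi * |ν|) * ‖dv w (v, η)‖) ?_ ?_ ?_ ?_
  · refine Eventually.of_forall fun b => Measurable.aestronglyMeasurable ?_
    have := (hw.dv.continuous_slice η).measurable
    exact (by fun_prop : Measurable fun v : ℝ => (X * b + v) ^ (Complex.I * ν)).mul this
  · refine Eventually.of_forall fun b => ae_of_all _ fun v _ => ?_
    rw [norm_mul]
    gcongr
    exact norm_cpow_I_le' ν
  · exact (continuous_const.mul (hw.dv.continuous_slice η).norm).intervalIntegrable _ _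
  · refine ae_of_all _ fun v _ => ?_
    refine ContinuousAt.mul_const ?_ _
    refine (hc.add continuousAt_const).cpow continuousAt_const ?_
    exact Complex.mem_slitPlane_iff.2 (Or.inr (by simpa using him))

variable [FiniteDimensional ℝ E]

theorem intervalIntegrable_cpow_I (ν a b : ℝ) :
    IntervalIntegrable (fun y : ℝ => (y : ℂ) ^ (Complex.I * ν)) volume a b := by
  have := intervalIntegrable_of_norm_le (f := fun _ => 1) (a := a) (b := b)
    (by fun_prop : Measurable fun y : ℝ => (y : ℂ) ^ (Complex.I * ν))
    (fun y => norm_cpow_I_le ν) continuous_const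
  simpa using this

theorem contDiff_layerRegular (hw : IsCapFunction w) (ν : ℝ) :
    ContDiff ℝ ∞ (layerRegular ν w) := by
  unfold layerRegular
  refine contDiff_intervalIntegral zero_le_two (intervalIntegrable_cpow_I ν _ _)
    (H := fun z : (ℝ × E) × ℝ => dv w (z.2 - z.1.1, z.1.2)) ?_
  exact hw.dv.contDiff.comp (by fun_prop)

theorem contDiff_layerSingular (hw : IsCapFunction w) (ν : ℝ) :
    ContDiff ℝ ∞ (layerSingular ν w) := by
  unfold layerSingular
  refine (hw.contDiff.comp (by fun_prop)).sub ?_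
  refine (Complex.ofRealCLM.contDiff.comp contDiff_fst).mul ?_
  refine contDiff_intervalIntegral zero_le_one (intervalIntegrable_cpow_I ν _ _)
    (H := fun z : (ℝ × E) × ℝ => dv w (z.1.1 * (z.2 - 1), z.1.2)) ?_
  exact hw.dv.contDiff.comp (by fun_prop)

end BoundaryLayer

end DeSitter

end

/-! ### Boundary values of the cap integral and their coefficients at M = 0. -/

noncomputable section

namespace DeSitter

section CapIntegral

variable {E : Type} [NormedAddCommGroup E] [NormedSpace ℝ E]

/-- The Beta weight `τ ^ (n/2 - s - 1) (1 - τ) ^ (n/2)`. -/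
def betaWeight (s : ℂ) (n : ℕ) (τ : ℝ) : ℂ :=
  (τ : ℂ) ^ ((n / 2 : ℝ) - s - 1) * (1 - (τ : ℂ)) ^ (((n / 2 : ℝ) : ℝ) : ℂ)

/-- The integral `∫ (X + v) ^ (iν - n/2) v ^ (n/2 - 1) g(v, η) dv` over the unit interval. -/
def capIntegral (ν : ℝ) (n : ℕ) (g : ℝ × E → ℂ) (η : E) (X : ℂ) : ℂ :=
  ∫ v in (0 : ℝ)..1, (X + v) ^ (Complex.I * ν - (n / 2 : ℝ)) * (v : ℂ) ^ ((n / 2 : ℝ) - 1 : ℂ) *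
    g (v, η)

/-- The smooth part of the boundary value of `capIntegral`. -/
def capRegular (ν : ℝ) (n : ℕ) (g : ℝ × E → ℂ) (x : ℝ × E) : ℂ :=
  betaConst (Complex.I * ν) n * ∫ τ in (0 : ℝ)..1, betaWeight (Complex.I * ν) n τ *
    layerRegular ν (eulerProd n g) (x.1 * τ, x.2)

/-- The coefficient of the singular power in the boundary value of `capIntegral`. -/
def capSingular (ν : ℝ) (n : ℕ) (g : ℝ × E → ℂ) (x : ℝ × E) : ℂ :=
  betaConst (Complex.I * ν) n * ∫ τ in (0 : ℝ)..1, betaWeight 0 n τ *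
    layerSingular ν (eulerProd n g) (x.1 * τ, x.2)

variable {s : ℂ} {n : ℕ} {g : ℝ × E → ℂ}

theorem intervalIntegrable_betaWeight (hs : s.re = 0) (hn : 1 ≤ n) :
    IntervalIntegrable (betaWeight s n) volume 0 1 := by
  have hn' : (1 : ℝ) ≤ n := by exact_mod_cast hn
  have := Complex.betaIntegral_convergent (u := (n / 2 : ℝ) - s) (v := (n / 2 : ℝ) + 1)
    (by rw [Complex.sub_re, Complex.ofReal_re, hs]; linarith)
    (by rw [Complex.add_re, Complex.ofReal_re, Complex.one_re]; linarith)
  rw [add_sub_cancel_right] at this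
  exact this

theorem integral_betaWeight :
    ∫ τ in (0 : ℝ)..1, betaWeight s n τ =
      Complex.betaIntegral ((n / 2 : ℝ) - s) ((n / 2 : ℝ) + 1) := by
  rw [Complex.betaIntegral, add_sub_cancel_right]
  rfl

/-- The factor τ^s released by homogeneity of the singular power turns the weight for s into the
weight for 0; hence the different weights in `capRegular` and `capSingular`. -/
theorem betaWeight_eq_mul (s : ℂ) (n : ℕ) {τ : ℝ} (hτ : 0 < τ) :
    betaWeight 0 n τ = betaWeight s n τ * (τ : ℂ) ^ s := by
  have h0 : (τ : ℂ) ≠ 0 := by exact_mod_cast hτ.ne'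
  rw [betaWeight, betaWeight, mul_right_comm, ← Complex.cpow_add _ _ h0]
  congr 3
  ring

theorem capIntegral_eq (hn : 1 ≤ n) {ν : ℝ} (hν : ν ≠ 0) (hg : IsCapFunction g) (η : E) {X : ℂ}
    (hX : X.im ≠ 0) :
    capIntegral ν n g η X = betaConst (Complex.I * ν) n * ∫ τ in (0 : ℝ)..1,
      betaWeight (Complex.I * ν) n τ * powerLayer (Complex.I * ν) (eulerProd n g) η (X * τ) :=
  integral_eq_betaConst_mul (by simp) (by simp [hν]) hn hg η hX

theorem exists_bound_slice {w : ℝ × E → ℂ} (hw : IsCapFunction w) {S : Set E} (hS : IsCompact S) :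
    ∃ K, ∀ η ∈ S, ∀ v ∈ Set.Icc (0 : ℝ) 1, ‖w (v, η)‖ ≤ K ∧ ‖dv w (v, η)‖ ≤ K := by
  have hc : IsCompact (Set.Icc (0 : ℝ) 1 ×ˢ S) := isCompact_Icc.prod hS
  obtain ⟨K1, h1⟩ := hc.exists_bound_of_continuousOn hw.contDiff.continuous.continuousOn
  obtain ⟨K2, h2⟩ := hc.exists_bound_of_continuousOn hw.dv.contDiff.continuous.continuousOn
  exact ⟨max K1 K2, fun η hη v hv => ⟨(h1 (v, η) ⟨hv, hη⟩).trans (le_max_left _ _),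
    (h2 (v, η) ⟨hv, hη⟩).trans (le_max_right _ _)⟩⟩

/-- In the Beta representation `powerLayer` is bounded independently of the distance of X to the
real axis, and the weight is integrable. The original integrand shows no such uniformity. -/
theorem exists_norm_capIntegral_le (hn : 1 ≤ n) {ν : ℝ} (hν : ν ≠ 0) (hg : IsCapFunction g)
    {S : Set E} (hS : IsCompact S) :
    ∃ K, ∀ η ∈ S, ∀ X : ℂ, X.im ≠ 0 → ‖capIntegral ν n g η X‖ ≤ K := by
  obtain ⟨K, hK⟩ := exists_bound_slice (hg.eulerProd n) hS
  refine ⟨‖betaConst (Complex.I * ν) n‖ * ∫ τ in (0 : ℝ)..1, ‖betaWeight (Complex.I * ν) n τ‖ *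
    (2 * Real.exp (Real.pi * |ν|) * K), fun η hη X hX => ?_⟩
  rw [capIntegral_eq hn hν hg η hX, norm_mul]
  gcongr
  refine intervalIntegral.norm_integral_le_of_norm_le zero_le_one (ae_of_all _ fun τ _ => ?_)
    ((intervalIntegrable_betaWeight (by simp) hn).norm.mul_const _)
  rw [norm_mul]
  gcongr
  exact norm_powerLayer_le ν η (hK η hη) _

/-- The limit is taken under the τ-integral, dominated by the Beta weight; M ≠ 0 ensures Mτ ≠ 0 for
every τ > 0. -/
theorem tendsto_capIntegral (hn : 1 ≤ n) (ε : ℤˣ) {ν : ℝ} (hν : ν ≠ 0) (hg : IsCapFunction g)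
    (η : E) {M : ℝ} (hM : M ≠ 0) {β : Type*} {l : Filter β} [l.IsCountablyGenerated] {f : β → ℂ}
    (hf : Tendsto f l (𝓝 M)) (him : ∀ᶠ b in l, 0 < sgn ε * (f b).im) :
    Tendsto (fun b => capIntegral ν n g η (f b)) l (𝓝 (betaConst (Complex.I * ν) n *
      ∫ τ in (0 : ℝ)..1, betaWeight (Complex.I * ν) n τ *
        boundaryLayer ε ν (eulerProd n g) η (M * τ))) := by
  have hw := hg.eulerProd n
  have him0 : ∀ᶠ b in l, (f b).im ≠ 0 := him.mono fun b hb h => by simp [h] at hb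
  obtain ⟨K, hK⟩ := exists_bound_slice hw (isCompact_singleton (x := η))
  have hi : IntervalIntegrable (betaWeight (Complex.I * ν) n) volume 0 1 :=
    intervalIntegrable_betaWeight (by simp) hn
  refine Tendsto.congr' (him0.mono fun b hb => (capIntegral_eq hn hν hg η hb).symm)
    (Tendsto.const_mul _ ?_)
  refine intervalIntegral.tendsto_integral_filter_of_dominated_convergence
    (fun τ => ‖betaWeight (Complex.I * ν) n τ‖ * (2 * Real.exp (Real.pi * |ν|) * K)) ?_ ?_
    (hi.norm.mul_const _) ?_
  · filter_upwards [him0] with b hb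
    rw [Set.uIoc_of_le zero_le_one]
    refine ((intervalIntegrable_iff_integrableOn_Ioc_of_le zero_le_one).1 hi).1.mul ?_
    exact ((continuous_powerLayer hw ν η hb).mono fun τ hτ => hτ.1.ne').aestronglyMeasurable
      measurableSet_Ioc
  · refine Eventually.of_forall fun b => ae_of_all _ fun τ _ => ?_
    rw [norm_mul]
    gcongr
    exact norm_powerLayer_le ν η (hK η rfl) _
  · refine ae_of_all _ fun τ hτ => Tendsto.const_mul _ ?_
    rw [Set.uIoc_of_le zero_le_one] at hτ
    refine tendsto_powerLayer hw ε ν η (mul_ne_zero hM hτ.1.ne') ?_ ?_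
    · push_cast
      exact hf.mul_const _
    · filter_upwards [him] with b hb
      have : (f b * τ).im = (f b).im * τ := by simp
      rw [this, ← mul_assoc]
      exact mul_pos hb hτ.1

theorem layerRegular_continuous_slice [FiniteDimensional ℝ E] (hg : IsCapFunction g) (ν : ℝ)
    (η : E) (M : ℝ) :
    Continuous fun τ : ℝ => layerRegular ν (eulerProd n g) (M * τ, η) :=
  (contDiff_layerRegular (hg.eulerProd n) ν).continuous.comp (by fun_prop)

theorem layerSingular_continuous_slice [FiniteDimensional ℝ E] (hg : IsCapFunction g) (ν : ℝ)
    (η : E) (M : ℝ) :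
    Continuous fun τ : ℝ => layerSingular ν (eulerProd n g) (M * τ, η) :=
  (contDiff_layerSingular (hg.eulerProd n) ν).continuous.comp (by fun_prop)

/-- Apply `boundaryLayer_eq` at Mτ, which stays in [-1, 1], and extract (M ± i0)^(iν) by
homogeneity. -/
theorem betaConst_mul_boundaryLayer [FiniteDimensional ℝ E] (hn : 1 ≤ n) (ε : ℤˣ) (ν : ℝ)
    (hg : IsCapFunction g) (η : E) {M : ℝ} (hM1 : |M| ≤ 1) :
    betaConst (Complex.I * ν) n * ∫ τ in (0 : ℝ)..1, betaWeight (Complex.I * ν) n τ *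
        boundaryLayer ε ν (eulerProd n g) η (M * τ) =
      capRegular ν n g (M, η) + i0Pow ε ν M * capSingular ν n g (M, η) := by
  have hw := hg.eulerProd n
  have h1 : ∫ τ in (0 : ℝ)..1, betaWeight (Complex.I * ν) n τ *
        boundaryLayer ε ν (eulerProd n g) η (M * τ) =
      ∫ τ in (0 : ℝ)..1, (betaWeight (Complex.I * ν) n τ *
        layerRegular ν (eulerProd n g) (M * τ, η) + i0Pow ε ν M * (betaWeight 0 n τ *
          layerSingular ν (eulerProd n g) (M * τ, η))) := by
    rw [intervalIntegral.integral_of_le zero_le_one, intervalIntegral.integral_of_le zero_le_one]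
    refine setIntegral_congr_fun measurableSet_Ioc fun τ hτ => ?_
    have : |M * τ| ≤ 1 := by
      rw [abs_mul, abs_of_pos hτ.1]
      exact mul_le_one₀ hM1 hτ.1.le hτ.2
    rw [boundaryLayer_eq hw ε ν η this, mul_comm M τ, i0Pow_mul hτ.1,
      betaWeight_eq_mul (Complex.I * ν) n hτ.1]
    ring
  rw [h1, intervalIntegral.integral_add, intervalIntegral.integral_const_mul, capRegular,
    capSingular]
  · ring
  · exact (intervalIntegrable_betaWeight (by simp) hn).mul_continuousOn
      (layerRegular_continuous_slice hg ν η M).continuousOn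
  · exact ((intervalIntegrable_betaWeight (by simp) hn).mul_continuousOn
      (layerSingular_continuous_slice hg ν η M).continuousOn).const_mul _

theorem contDiff_capRegular [FiniteDimensional ℝ E] (hn : 1 ≤ n) (hg : IsCapFunction g) (ν : ℝ) :
    ContDiff ℝ ∞ (capRegular ν n g) := by
  unfold capRegular
  refine contDiff_const.mul (contDiff_intervalIntegral zero_le_one
    (intervalIntegrable_betaWeight (by simp) hn)
    (H := fun z : (ℝ × E) × ℝ => layerRegular ν (eulerProd n g) (z.1.1 * z.2, z.1.2)) ?_)
  exact (contDiff_layerRegular (hg.eulerProd n) ν).comp (by fun_prop)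

theorem contDiff_capSingular [FiniteDimensional ℝ E] (hn : 1 ≤ n) (hg : IsCapFunction g) (ν : ℝ) :
    ContDiff ℝ ∞ (capSingular ν n g) := by
  unfold capSingular
  refine contDiff_const.mul (contDiff_intervalIntegral zero_le_one
    (intervalIntegrable_betaWeight (by simp) hn)
    (H := fun z : (ℝ × E) × ℝ => layerSingular ν (eulerProd n g) (z.1.1 * z.2, z.1.2)) ?_)
  exact (contDiff_layerSingular (hg.eulerProd n) ν).comp (by fun_prop)

theorem prod_ne_zero_of_re (hs : s.re = 0) (n : ℕ) :
    ∏ i ∈ Finset.range n, ((i : ℂ) + 1 - s) ≠ 0 := by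
  refine Finset.prod_ne_zero_iff.2 fun i _ h => ?_
  have := congrArg Complex.re h
  simp [hs] at this
  have h2 : (0 : ℝ) ≤ i := by positivity
  linarith

theorem Gamma_add_nat_add_one (hs : s.re = 0) (hs0 : s ≠ 0) (n : ℕ) :
    Complex.Gamma (n + 1 - s) =
      (∏ i ∈ Finset.range n, ((i : ℂ) + 1 - s)) * (-s * Complex.Gamma (-s)) := by
  induction n with
  | zero =>
    have := Complex.Gamma_add_one (-s) (neg_ne_zero.2 hs0)
    simp only [Nat.cast_zero, zero_add, Finset.range_zero, Finset.prod_empty, one_mul]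
    rw [← this]; congr 1; ring
  | succ n ih =>
    have h0 : (n : ℂ) + 1 - s ≠ 0 :=
      (Finset.prod_ne_zero_iff.1 (prod_ne_zero_of_re hs (n + 1))) n (by simp)
    have := Complex.Gamma_add_one _ h0
    rw [Finset.prod_range_succ, mul_right_comm, ← ih, mul_comm, ← this]
    congr 1; push_cast; ring

/-- B(α - s, α + 1) has denominator Γ(n + 1 - s), and the functional equation reduces this to Γ(-s)
times precisely the factors collected in the integrations by parts. -/
theorem betaConst_eq (hs : s.re = 0) (hs0 : s ≠ 0) (hn : 1 ≤ n) :
    betaConst s n = Complex.Gamma (-s) /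
      (Complex.Gamma ((n / 2 : ℝ) - s) * Complex.Gamma ((n / 2 : ℝ) + 1)) := by
  have hn' : (1 : ℝ) ≤ n := by exact_mod_cast hn
  have ha : 0 < (((n / 2 : ℝ) : ℂ) - s).re := by
    rw [Complex.sub_re, Complex.ofReal_re, hs]; linarith
  have hb : 0 < (((n / 2 : ℝ) : ℂ) + 1).re := by
    rw [Complex.add_re, Complex.ofReal_re, Complex.one_re]; linarith
  have h1 := Complex.Gamma_mul_Gamma_eq_betaIntegral ha hb
  have e : ((n / 2 : ℝ) : ℂ) - s + ((n / 2 : ℝ) + 1) = n + 1 - s := by push_cast; ring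
  rw [e, Gamma_add_nat_add_one hs hs0 n] at h1
  have h2 := prod_ne_zero_of_re hs n
  have h3 := betaIntegral_ne_zero ha hb
  have h4 := Complex.Gamma_ne_zero_of_re_pos ha
  have h5 := Complex.Gamma_ne_zero_of_re_pos hb
  rw [betaConst, h1]
  have h6 : Complex.Gamma (-s) ≠ 0 := by
    intro h
    exact mul_ne_zero h4 h5 (h1.trans (by rw [h]; ring))
  field_simp

/-- At M = 0 the layer contributes n! g(0, η) and the weight integrates to B(α, α + 1) = Γ(α)Γ(α +
1)/n!. Both n! and Γ(α + 1) cancel against `betaConst`. -/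
theorem capSingular_zero (hn : 1 ≤ n) {ν : ℝ} (hν : ν ≠ 0) (g : ℝ × E → ℂ) (η : E) :
    capSingular ν n g (0, η) = Complex.Gamma (-(Complex.I * ν)) * Complex.Gamma ((n / 2 : ℝ)) /
      Complex.Gamma ((n / 2 : ℝ) - Complex.I * ν) * g (0, η) := by
  have hn' : (1 : ℝ) ≤ n := by exact_mod_cast hn
  have ha : 0 < (((n / 2 : ℝ) : ℂ)).re := by rw [Complex.ofReal_re]; linarith
  have hb : 0 < (((n / 2 : ℝ) : ℂ) + 1).re := by
    rw [Complex.add_re, Complex.ofReal_re, Complex.one_re]; linarith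
  have h1 := Complex.Gamma_mul_Gamma_eq_betaIntegral ha hb
  have e : ((n / 2 : ℝ) : ℂ) + ((n / 2 : ℝ) + 1) = n + 1 := by push_cast; ring
  rw [e, Complex.Gamma_nat_eq_factorial] at h1
  have h4 := Complex.Gamma_ne_zero_of_re_pos hb
  have h5 : Complex.Gamma ((n / 2 : ℝ) - Complex.I * ν) ≠ 0 :=
    Complex.Gamma_ne_zero_of_re_pos (by rw [Complex.sub_re, Complex.ofReal_re]; simp; linarith)
  have h7 : layerSingular ν (eulerProd n g) (0, η) = n.factorial * g (0, η) := by
    simp [layerSingular, eulerProd_zero]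
  rw [capSingular]
  simp only [zero_mul]
  rw [intervalIntegral.integral_mul_const, integral_betaWeight, sub_zero, h7,
    betaConst_eq (by simp) (by simp [hν]) hn]
  field_simp
  linear_combination (-(g (0, η)) * Complex.Gamma (-(Complex.I * ν))) * h1

theorem dv_eulerStep (hg : IsCapFunction g) (j : ℕ) (v : ℝ) (η : E) :
    dv (eulerStep j g) (v, η) = (j + 1) * dv g (v, η) + v * dv (dv g) (v, η) := by
  refine ((hg.eulerStep j).hasDerivAt v η).unique ?_
  have h1 := ((hg.hasDerivAt v η).const_mul (j : ℂ)).add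
    ((hasDerivAt_id v).ofReal_comp.mul (hg.dv.hasDerivAt v η))
  refine h1.congr_deriv ?_
  simp
  ring

/-- Integrating by parts against y^(iν), the operator y ∂_y + j acts on the functional g ↦ ∫ y^(iν)
∂_y g dy as the scalar j - iν. -/
theorem integral_cpow_mul_dv_eulerStep {ν : ℝ} (hg : IsCapFunction g) (j : ℕ)
    (η : E) :
    ∫ y in (0 : ℝ)..2, (y : ℂ) ^ (Complex.I * ν) * dv (eulerStep j g) (y, η) =
      (j - Complex.I * ν) * ∫ y in (0 : ℝ)..2, (y : ℂ) ^ (Complex.I * ν) * dv g (y, η) := by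
  set s := Complex.I * ν with hs
  have hs1 : 0 < (s + 1).re := by simp [hs]
  have hs1' : s + 1 ≠ 0 := fun h => by simp [h] at hs1
  have hI : ∀ f : ℝ → ℂ, Continuous f →
      IntervalIntegrable (fun y : ℝ => (y : ℂ) ^ s * f y) volume 0 2 := fun f hf =>
    intervalIntegrable_of_norm_le (by fun_prop) (fun y => norm_cpow_I_le ν) hf
  have c1 := hg.dv.continuous_slice η
  have c2 := hg.dv.dv.continuous_slice η
  have c3 : Continuous fun y : ℝ => (y : ℂ) * dv (dv g) (y, η) :=
    Complex.continuous_ofReal.mul c2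
  have h := intervalIntegral.integral_eq_sub_of_hasDerivAt_of_le (a := (0 : ℝ)) (b := 2)
    (f := fun y : ℝ => (y : ℂ) ^ (s + 1) * dv g (y, η))
    (f' := fun y : ℝ => (s + 1) * ((y : ℂ) ^ s * dv g (y, η)) +
      (y : ℂ) ^ s * (y * dv (dv g) (y, η))) zero_le_two ?_ ?_
    (((hI _ c1).const_mul _).add (hI _ c3))
  · rw [intervalIntegral.integral_add ((hI _ c1).const_mul _) (hI _ c3),
      intervalIntegral.integral_const_mul] at h
    rw [hg.dv.eq_zero (2, η) (by norm_num), Complex.ofReal_zero, Complex.zero_cpow hs1'] at h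
    simp only [mul_zero, zero_mul, sub_zero] at h
    have h2 : ∫ y in (0 : ℝ)..2, (y : ℂ) ^ s * dv (eulerStep j g) (y, η) =
        ∫ y in (0 : ℝ)..2, ((j + 1) * ((y : ℂ) ^ s * dv g (y, η)) +
          (y : ℂ) ^ s * (y * dv (dv g) (y, η))) := by
      refine intervalIntegral.integral_congr fun y _ => ?_
      simp only [dv_eulerStep hg]
      ring
    rw [h2, intervalIntegral.integral_add ((hI _ c1).const_mul _) (hI _ c3),
      intervalIntegral.integral_const_mul]
    linear_combination h
  · refine ContinuousOn.mul (Continuous.continuousOn ?_) c1.continuousOn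
    exact Complex.continuous_ofReal_cpow_const hs1
  · intro y hy
    have d1 : HasDerivAt (fun y : ℝ => (y : ℂ) ^ (s + 1)) ((s + 1) * (y : ℂ) ^ s) y := by
      have := hasDerivAt_ofReal_cpow_const hy.1.ne' hs1'
      rwa [add_sub_cancel_right] at this
    refine (d1.mul (hg.dv.hasDerivAt y η)).congr_deriv ?_
    have hy0 : (y : ℂ) ≠ 0 := by exact_mod_cast hy.1.ne'
    rw [Complex.cpow_add _ _ hy0, Complex.cpow_one]
    ring

theorem integral_cpow_mul_dv_eulerProd {ν : ℝ} (n : ℕ) (η : E) :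
    ∀ {g : ℝ × E → ℂ}, IsCapFunction g →
    ∫ y in (0 : ℝ)..2, (y : ℂ) ^ (Complex.I * ν) * dv (eulerProd n g) (y, η) =
      (∏ i ∈ Finset.range n, ((i : ℂ) + 1 - Complex.I * ν)) *
        ∫ y in (0 : ℝ)..2, (y : ℂ) ^ (Complex.I * ν) * dv g (y, η) := by
  induction n with
  | zero => intro g _; simp [eulerProd]
  | succ n ih =>
    intro g hg
    rw [eulerProd, ih (hg.eulerStep (n + 1)), integral_cpow_mul_dv_eulerStep hg,
      Finset.prod_range_succ]
    push_cast
    ring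

/-- The scalars j - iν of the Euler factors cancel the product in `betaConst`, and the integrated
weight cancels its Beta integral; only -(iν)⁻¹ survives. In this form the analytic continuation in s
is recognizable. -/
theorem capRegular_zero (hn : 1 ≤ n) (ν : ℝ) (hg : IsCapFunction g) (η : E) :
    capRegular ν n g (0, η) = -(Complex.I * ν)⁻¹ *
      ∫ y in (0 : ℝ)..2, (y : ℂ) ^ (Complex.I * ν) * dv g (y, η) := by
  have hn' : (1 : ℝ) ≤ n := by exact_mod_cast hn
  have ha : 0 < (((n / 2 : ℝ) : ℂ) - Complex.I * ν).re := by
    rw [Complex.sub_re, Complex.ofReal_re]; simp; linarith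
  have hb : 0 < (((n / 2 : ℝ) : ℂ) + 1).re := by
    rw [Complex.add_re, Complex.ofReal_re, Complex.one_re]; linarith
  have h3 := betaIntegral_ne_zero ha hb
  have h2 := prod_ne_zero_of_re (s := Complex.I * ν) (by simp) n
  rw [capRegular]
  simp only [zero_mul]
  have h7 : layerRegular ν (eulerProd n g) (0, η) =
      ∫ y in (0 : ℝ)..2, (y : ℂ) ^ (Complex.I * ν) * dv (eulerProd n g) (y, η) := by
    simp [layerRegular]
  rw [intervalIntegral.integral_mul_const, integral_betaWeight, h7,
    integral_cpow_mul_dv_eulerProd n η hg, betaConst]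
  field_simp

end CapIntegral

end DeSitter

end

/-! ### Extension of test functions; boundary values of powers on a line. -/

noncomputable section

namespace DeSitter

/-- A smooth function on the sphere has a smooth extension. -/
theorem SmoothOnSphere.exists_extension {d : ℕ} {φ : Sph d → ℂ} (hφ : SmoothOnSphere φ) :
    ∃ Φ : Mink d → ℂ, ContDiff ℝ ∞ Φ ∧ ∀ x : Sph d, Φ x = φ x := by
  classical
  have hdim : Fact (Module.finrank ℝ (Mink d) = d + 1) := ⟨by simp⟩
  let U : TopologicalSpace.Opens (Mink d) := ⟨{0}ᶜ, isOpen_compl_singleton⟩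
  have hU : ∀ x : U, (x : Mink d) ≠ 0 := fun x => x.2
  let N : U → Mink d := fun x => ‖(x : Mink d)‖⁻¹ • (x : Mink d)
  have hNs : ∀ x : U, N x ∈ sphere (0 : Mink d) 1 := fun x => by
    simp only [N, mem_sphere_zero_iff_norm, norm_smul, norm_inv, norm_norm]
    exact inv_mul_cancel₀ (norm_ne_zero_iff.2 (hU x))
  have hN : ContMDiff 𝓘(ℝ, Mink d) 𝓘(ℝ, Mink d) ∞ N := by
    intro x
    have h1 : ContDiffAt ℝ ∞ (fun y : Mink d => ‖y‖⁻¹ • y) x :=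
      ((contDiffAt_norm ℝ (hU x)).inv (norm_ne_zero_iff.2 (hU x))).smul contDiffAt_id
    exact contMDiffAt_subtype_iff.2 h1.contMDiffAt
  have hN2 := hφ.comp (hN.codRestrict_sphere (n := d) hNs)
  let g : Mink d → ℂ := fun y => if h : y ∈ U then φ ⟨N ⟨y, h⟩, hNs ⟨y, h⟩⟩ else 0
  have hg : ∀ y : Mink d, y ≠ 0 → ContDiffAt ℝ ∞ g y := by
    intro y hy
    have h1 : ContMDiffAt 𝓘(ℝ, Mink d) 𝓘(ℝ, ℂ) ∞ (fun x : U => g x) ⟨y, hy⟩ := by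
      refine (hN2 ⟨y, hy⟩).congr_of_eventuallyEq (Eventually.of_forall fun x => ?_)
      simp only [g, dif_pos x.2]
      rfl
    exact contMDiffAt_iff_contDiffAt.1 (contMDiffAt_subtype_iff.1 h1)
  -- The radially constant extension is singular only at the origin, where it is cut off without
  -- touching the unit sphere.
  let b : ContDiffBump (0 : Mink d) := ⟨1 / 4, 1 / 2, by norm_num, by norm_num⟩
  refine ⟨fun y => ((1 - b y : ℝ) : ℂ) * g y, contDiff_iff_contDiffAt.2 fun y => ?_, fun x => ?_⟩
  · by_cases hy : y = 0
    · have h1 : (fun y => ((1 - b y : ℝ) : ℂ) * g y) =ᶠ[𝓝 y] fun _ => 0 := by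
        rw [hy]
        filter_upwards [closedBall_mem_nhds (0 : Mink d) (by norm_num : (0 : ℝ) < 1 / 4)] with z hz
        rw [b.one_of_mem_closedBall hz]
        simp
      exact contDiffAt_const.congr_of_eventuallyEq h1
    · exact (Complex.ofRealCLM.contDiff.contDiffAt.comp y
        (contDiffAt_const.sub b.contDiffAt)).mul (hg y hy)
  · have hx : ‖(x : Mink d)‖ = 1 := by simp
    have hx0 : (x : Mink d) ∈ U := fun h => by
      rw [Set.mem_singleton_iff.1 h] at hx; simp at hx
    have h1 : b (x : Mink d) = 0 := b.zero_of_le_dist (by simp [b]; norm_num)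
    simp only [h1, g, dif_pos hx0, sub_zero, Complex.ofReal_one, one_mul]
    congr 1
    ext1
    simp [N]

section LineIntegral

variable {E : Type} [NormedAddCommGroup E] [NormedSpace ℝ E]

theorem integral_line_cpow_mul_eq {G : ℝ × E → ℂ} (hG : IsCapFunction G) (η : E) {Y : ℂ}
    (hY : Y.im ≠ 0) {p : ℂ} (hp : p + 1 ≠ 0) :
    ∫ v in (-1 : ℝ)..1, (Y + v) ^ p * G (v, η) =
      -(p + 1)⁻¹ * ∫ v in (-1 : ℝ)..1, (Y + v) ^ (p + 1) * dv G (v, η) := by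
  have c1 : Continuous fun v : ℝ => (Y + v) ^ p * G (v, η) :=
    (continuous_add_cpow hY p).mul (hG.continuous_slice η)
  have c2 : Continuous fun v : ℝ => (Y + v) ^ (p + 1) * dv G (v, η) :=
    (continuous_add_cpow hY (p + 1)).mul (hG.dv.continuous_slice η)
  have h := intervalIntegral.integral_eq_sub_of_hasDerivAt (a := (-1 : ℝ)) (b := 1)
    (f := fun v : ℝ => (Y + v) ^ (p + 1) * G (v, η))
    (f' := fun v : ℝ => (p + 1) * ((Y + v) ^ p * G (v, η)) + (Y + v) ^ (p + 1) * dv G (v, η))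
    (fun v _ => by
      refine ((hasDerivAt_add_cpow hY v (p + 1)).mul (hG.hasDerivAt v η)).congr_deriv ?_
      rw [add_sub_cancel_right]; ring)
    (((continuous_const.mul c1).add c2).intervalIntegrable _ _)
  rw [intervalIntegral.integral_add ((c1.intervalIntegrable _ _).const_mul _)
    (c2.intervalIntegrable _ _), intervalIntegral.integral_const_mul,
    hG.eq_zero (1, η) (by norm_num), hG.eq_zero (-1, η) (by norm_num)] at h
  simp only [mul_zero, sub_zero] at h
  field_simp
  linear_combination h

theorem IsCapFunction.iterate_dv {G : ℝ × E → ℂ} (hG : IsCapFunction G) (k : ℕ) :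
    IsCapFunction (DeSitter.dv^[k] G) := by
  induction k with
  | zero => exact hG
  | succ k ih => rw [Function.iterate_succ_apply']; exact ih.dv

/-- Repeated integration by parts against `(Y + v) ^ p`. -/
theorem exists_integral_line_cpow_eq {p : ℂ} (hp : p.im ≠ 0) (K : ℕ) :
    ∃ C : ℂ, ∀ {G : ℝ × E → ℂ}, IsCapFunction G → ∀ (η : E) {Y : ℂ}, Y.im ≠ 0 →
      ∫ v in (-1 : ℝ)..1, (Y + v) ^ p * G (v, η) =
        C * ∫ v in (-1 : ℝ)..1, (Y + v) ^ (p + K) * (dv^[K] G) (v, η) := by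
  induction K with
  | zero => exact ⟨1, fun _ _ _ _ => by simp⟩
  | succ K ih =>
    obtain ⟨C, hC⟩ := ih
    refine ⟨C * -(p + K + 1)⁻¹, fun {G} hG η Y hY => ?_⟩
    rw [hC hG η hY, integral_line_cpow_mul_eq (hG.iterate_dv K) η hY, Function.iterate_succ_apply']
    · push_cast
      rw [← add_assoc]; ring
    -- The denominators p + K + 1 cannot vanish because p is not real; for p = iν - α this is the
    -- condition ν ≠ 0.
    · intro h
      exact hp (by simpa using congrArg Complex.im h)

theorem norm_cpow_le_of_norm_le {z p : ℂ} (hp : 0 ≤ p.re) (hz : ‖z‖ ≤ 2) :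
    ‖z ^ p‖ ≤ 2 ^ p.re * Real.exp (Real.pi * |p.im|) := by
  refine norm_cpow_le_of_re.trans ?_
  gcongr

/-- Once enough integrations by parts have made the real part of the exponent nonnegative, the
integrand is bounded down to T = 0, uniformly over compact parameter sets. -/
theorem exists_norm_integral_line_le {p : ℂ} (hp : p.im ≠ 0) {G : ℝ × E → ℂ}
    (hG : IsCapFunction G) {S : Set E} (hS : IsCompact S) :
    ∃ C, ∀ η ∈ S, ∀ T : ℝ, T ≠ 0 → |T| ≤ 1 →
      ‖∫ v in (-1 : ℝ)..1, (Complex.I * T + v) ^ p * G (v, η)‖ ≤ C := by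
  obtain ⟨K, hK⟩ := exists_nat_ge (-p.re)
  obtain ⟨C, hC⟩ := exists_integral_line_cpow_eq (E := E) hp K
  obtain ⟨B, hB⟩ := ((isCompact_Icc (a := (-1 : ℝ)) (b := 1)).prod hS).exists_bound_of_continuousOn
    (hG.iterate_dv K).contDiff.continuous.continuousOn
  have hre : 0 ≤ (p + K).re := by simp; linarith
  set A := 2 ^ (p + K).re * Real.exp (Real.pi * |(p + K).im|) with hA
  refine ⟨‖C‖ * (A * B * |1 - (-1)|), fun η hη T hT hT1 => ?_⟩
  rw [hC hG η (by simpa using hT), norm_mul]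
  gcongr
  refine intervalIntegral.norm_integral_le_of_norm_le_const fun v hv => ?_
  rw [Set.uIoc_of_le (by norm_num)] at hv
  rw [norm_mul]
  refine mul_le_mul (norm_cpow_le_of_norm_le hre ?_) (hB (v, η) ⟨⟨hv.1.le, hv.2⟩, hη⟩)
    (norm_nonneg _) (by positivity)
  refine (norm_add_le _ _).trans ?_
  have : |v| ≤ 1 := abs_le.2 ⟨hv.1.le, hv.2⟩
  simp
  linarith

/-- The same regularization makes the limit a case of dominated convergence. The limit ℓ is chosen
before the filter, so a single value serves every approach from the side ε. -/
theorem exists_tendsto_integral_line {p : ℂ} (hp : p.im ≠ 0) {G : ℝ × E → ℂ}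
    (hG : IsCapFunction G) (η : E) (ε : ℤˣ) :
    ∃ ℓ, ∀ {β : Type} {l : Filter β} [l.IsCountablyGenerated] {f : β → ℝ},
      Tendsto f l (𝓝 0) → (∀ᶠ b in l, 0 < sgn ε * f b) →
      Tendsto (fun b => ∫ v in (-1 : ℝ)..1, (Complex.I * f b + v) ^ p * G (v, η)) l (𝓝 ℓ) := by
  obtain ⟨K, hK⟩ := exists_nat_ge (-p.re)
  obtain ⟨C, hC⟩ := exists_integral_line_cpow_eq (E := E) hp K
  have hre : 0 ≤ (p + K).re := by simp; linarith
  have hGK := (hG.iterate_dv K).continuous_slice η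
  refine ⟨C * ∫ v in (-1 : ℝ)..1, Complex.exp (bdryLog ε v * (p + K)) * (dv^[K] G) (v, η),
    fun {β l} _ {f} hf hpos => ?_⟩
  have h0 : ∀ᶠ b in l, f b ≠ 0 := hpos.mono fun b hb h => by simp [h] at hb
  have h1 : ∀ᶠ b in l, |f b| ≤ 1 := by
    filter_upwards [hf.eventually (closedBall_mem_nhds (0 : ℝ) one_pos)] with b hb
    simpa using hb
  refine Tendsto.congr' (h0.mono fun b hb => (hC hG η (by simpa using hb)).symm)
    (Tendsto.const_mul _ ?_)
  refine intervalIntegral.tendsto_integral_filter_of_dominated_convergence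
    (fun v => (2 ^ (p + K).re * Real.exp (Real.pi * |(p + K).im|)) * ‖(dv^[K] G) (v, η)‖)
    ?_ ?_ ?_ ?_
  · refine Eventually.of_forall fun b => Measurable.aestronglyMeasurable ?_
    exact (by fun_prop : Measurable fun v : ℝ => (Complex.I * f b + v) ^ (p + K)).mul
      hGK.measurable
  · filter_upwards [h1] with b hb
    refine ae_of_all _ fun v hv => ?_
    rw [Set.uIoc_of_le (by norm_num)] at hv
    rw [norm_mul]
    gcongr
    refine norm_cpow_le_of_norm_le hre ((norm_add_le _ _).trans ?_)
    have : |v| ≤ 1 := abs_le.2 ⟨hv.1.le, hv.2⟩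
    simp
    linarith
  · exact (continuous_const.mul hGK.norm).intervalIntegrable _ _
  · have h2 : ∀ᵐ v : ℝ, v ≠ 0 := by rw [ae_iff]; simp
    filter_upwards [h2] with v hv _
    refine (tendsto_cpow_bdry hv ε ?_ ?_ _).mul_const _
    · have : Tendsto (fun b => Complex.I * (f b : ℂ) + v) l (𝓝 (Complex.I * ((0 : ℝ) : ℂ) + v)) :=
        (((Complex.continuous_ofReal.tendsto 0).comp hf).const_mul _).add_const _
      simpa using this
    · simpa using hpos

end LineIntegral

end DeSitter

end

/-! ### Plane-wave integrals near and away from an equator. -/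

noncomputable section

namespace DeSitter

/-- A smooth cutoff on the line, equal to `1` for `|v| ≤ 1/4` and to `0` for `|v| ≥ 1/2`. -/
def capBumpData : ContDiffBump (0 : ℝ) := ⟨1 / 4, 1 / 2, by norm_num, by norm_num⟩

/-- The function of `capBumpData`. -/
def capBump (v : ℝ) : ℝ := capBumpData v

theorem contDiff_capBump : ContDiff ℝ ∞ capBump := capBumpData.contDiff

theorem capBump_eq_zero {v : ℝ} (hv : 1 / 2 ≤ |v|) : capBump v = 0 :=
  capBumpData.zero_of_le_dist (by simpa [capBumpData] using hv)

theorem capBump_eq_one {v : ℝ} (hv : |v| ≤ 1 / 4) : capBump v = 1 :=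
  capBumpData.one_of_mem_closedBall (by simpa [capBumpData] using hv)

theorem capBump_nonneg (v : ℝ) : 0 ≤ capBump v := capBumpData.nonneg

theorem capBump_le_one (v : ℝ) : capBump v ≤ 1 := capBumpData.le_one

variable {d : ℕ}

/-- Linear operators of Minkowski space. -/
abbrev MinkOp (d : ℕ) : Type := Mink d →L[ℝ] Mink d

/-- Cut off weighted integrals of `Φ ∘ L` over the slices of the sphere. -/
def sliceIntegral (Φ : Mink d → ℂ) (z : ℝ × MinkOp d) : ℂ :=
  ((capBump z.1 * (1 - z.1 ^ 2) ^ ((d : ℝ) / 2 - 1) : ℝ) : ℂ) *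
    ∫ u : AngSph d, Φ (z.2 (consPt z.1 (√(1 - z.1 ^ 2) • (u : EuclideanSpace ℝ (Fin d)))))
      ∂(volume : Measure (EuclideanSpace ℝ (Fin d))).toSphere

theorem one_sub_sq_pos {c : ℝ} (hc : |c| < 1) : 0 < 1 - c ^ 2 := by
  have := (sq_lt_one_iff_abs_lt_one c).2 hc
  linarith

/-- √(1 - v²) is smooth only for |v| < 1, but `capBump` has vanished well before. The operator is
kept as a smooth parameter so that estimates are uniform over all rotations, which lie in a compact
ball. -/
theorem isCapFunction_sliceIntegral {Φ : Mink d → ℂ} (hΦ : ContDiff ℝ ∞ Φ) :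
    IsCapFunction (sliceIntegral Φ) := by
  have h0 : ∀ z : ℝ × MinkOp d, 1 / 2 < |z.1| → sliceIntegral Φ z = 0 := fun z hz => by
    rw [sliceIntegral, capBump_eq_zero hz.le]; simp
  refine ⟨contDiff_iff_contDiffAt.2 fun z => ?_, h0⟩
  set O : Set (ℝ × MinkOp d) := {z | |z.1| < 1} with hO
  have hOo : IsOpen O := isOpen_lt (continuous_abs.comp continuous_fst) continuous_const
  by_cases hz : |z.1| < 1
  · have h1 : ContDiffOn ℝ ∞ (fun z : ℝ × MinkOp d => ∫ u : AngSph d, (1 : ℂ) *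
        Φ (z.2 (consPt z.1 (√(1 - z.1 ^ 2) • (u : EuclideanSpace ℝ (Fin d)))))
        ∂(volume : Measure (EuclideanSpace ℝ (Fin d))).toSphere) O := by
      refine contDiffOn_parametric_of_isCompact hOo (v := fun u : AngSph d =>
        (u : EuclideanSpace ℝ (Fin d))) measurable_subtype_coe
        (isCompact_sphere (0 : EuclideanSpace ℝ (Fin d)) 1) (fun u => u.2)
        (integrable_const _) (H := fun q : (ℝ × MinkOp d) × EuclideanSpace ℝ (Fin d) =>
          Φ (q.1.2 (consPt q.1.1 (√(1 - q.1.1 ^ 2) • q.2)))) ?_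
      refine hΦ.comp_contDiffOn ?_
      have h2 : ContDiffOn ℝ ∞ (fun q : (ℝ × MinkOp d) × EuclideanSpace ℝ (Fin d) =>
          √(1 - q.1.1 ^ 2)) (O ×ˢ Set.univ) :=
        ContDiffOn.sqrt (by fun_prop) fun q hq => (one_sub_sq_pos hq.1).ne'
      have h3 : ContDiffOn ℝ ∞ (fun q : (ℝ × MinkOp d) × EuclideanSpace ℝ (Fin d) =>
          consPt q.1.1 (√(1 - q.1.1 ^ 2) • q.2)) (O ×ˢ Set.univ) := by
        refine (consCLM d).contDiff.comp_contDiffOn (f := fun q : (ℝ × MinkOp d) ×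
          EuclideanSpace ℝ (Fin d) => (q.1.1, √(1 - q.1.1 ^ 2) • q.2)) ?_
        exact ContDiffOn.prodMk (by fun_prop) (h2.smul contDiffOn_snd)
      exact ContDiffOn.clm_apply (by fun_prop) h3
    have h4 : ContDiffAt ℝ ∞ (fun z : ℝ × MinkOp d =>
        capBump z.1 * (1 - z.1 ^ 2) ^ ((d : ℝ) / 2 - 1)) z :=
      (contDiff_capBump.comp contDiff_fst).contDiffAt.mul
        (ContDiffAt.rpow_const_of_ne (by fun_prop) (one_sub_sq_pos hz).ne')
    refine (Complex.ofRealCLM.contDiff.contDiffAt.comp z h4).mul ?_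
    simpa using h1.contDiffAt (hOo.mem_nhds hz)
  · have h5 : (sliceIntegral Φ) =ᶠ[𝓝 z] fun _ => 0 := by
      have : ∀ᶠ y : ℝ × MinkOp d in 𝓝 z, 1 / 2 < |y.1| :=
        (isOpen_lt continuous_const (continuous_abs.comp continuous_fst)).mem_nhds
          (show (1 / 2 : ℝ) < |z.1| by push Not at hz; linarith)
      exact this.mono h0
    exact contDiffAt_const.congr_of_eventuallyEq h5

theorem continuous_ofReal_add_I_cpow {X : Type*} [TopologicalSpace X] {h : X → ℝ}
    (hh : Continuous h) {T : ℝ} (hT : T ≠ 0) (p : ℂ) :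
    Continuous fun x => (Complex.I * T + h x) ^ p :=
  Continuous.cpow (by fun_prop) continuous_const fun x =>
    Complex.mem_slitPlane_iff.2 (Or.inr (by simpa using hT))

theorem integrable_sphere_of_continuous {F : Mink d → ℂ} (hF : Continuous F) :
    Integrable (fun x : Sph d => F x) (volume : Measure (Mink d)).toSphere := by
  have : Continuous fun x : Sph d => F x := hF.comp continuous_subtype_val
  obtain ⟨C, hC⟩ := (isCompact_sphere (0 : Mink d) 1).exists_bound_of_continuousOn hF.continuousOn
  exact Integrable.of_bound this.aestronglyMeasurable C (Eventually.of_forall fun x => hC x x.2)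

theorem integral_capBump_mul_eq (hd : 1 ≤ d) {Φ : Mink d → ℂ} (hΦ : ContDiff ℝ ∞ Φ)
    (L : MinkOp d) (p : ℂ) {T : ℝ} (hT : T ≠ 0) :
    ∫ x : Sph d, (Complex.I * T + ((x : Mink d) 0 : ℝ)) ^ p * (capBump ((x : Mink d) 0) *
        Φ (L x)) ∂(volume : Measure (Mink d)).toSphere =
      ∫ v in (-1 : ℝ)..1, (Complex.I * T + v) ^ p * sliceIntegral Φ (v, L) := by
  set F : Mink d → ℂ := fun x => (Complex.I * T + (x 0 : ℝ)) ^ p * (capBump (x 0) * Φ (L x))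
    with hFdef
  have hF : Continuous F := by
    refine (continuous_ofReal_add_I_cpow (by fun_prop) hT p).mul
      ((Complex.continuous_ofReal.comp (contDiff_capBump.continuous.comp (by fun_prop))).mul
        (hΦ.continuous.comp L.continuous))
  have hi := (integrable_sphere_iff_slice hd hF.measurable).1 (integrable_sphere_of_continuous hF)
  rw [integral_sphere_eq_slice hd hF.measurable, integral_prod _ hi, integral_sliceMeasure,
    intervalIntegral.integral_of_le (by norm_num), integral_Ioc_eq_integral_Ioo]
  refine setIntegral_congr_fun measurableSet_Ioo fun c _ => ?_
  simp only [hFdef, consPt_zero, integral_const_mul, sliceIntegral]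
  push_cast
  ring

/-- The integral of `(⟨N, x⟩ + i T) ^ p Φ(x)` over the unit sphere. -/
def planeIntegral (Φ : Mink d → ℂ) (p : ℂ) (N : Mink d) (T : ℝ) : ℂ :=
  ∫ x : Sph d, (Complex.I * T + (inner ℝ N (x : Mink d) : ℝ)) ^ p * Φ x
    ∂(volume : Measure (Mink d)).toSphere

/-- The part of `planeIntegral` away from `⟨N, x⟩ = 0`. -/
def planeFar (Φ : Mink d → ℂ) (p : ℂ) (R : Mink d ≃ₗᵢ[ℝ] Mink d) (T : ℝ) : ℂ :=
  ∫ x : Sph d, (Complex.I * T + ((x : Mink d) 0 : ℝ)) ^ p * (((1 - capBump ((x : Mink d) 0) : ℝ) : ℂ) *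
        Φ (R x)) ∂(volume : Measure (Mink d)).toSphere

/-- Rotating the first axis to N turns ⟨N, x⟩ into x_0. The cutoff then isolates the equator, the
only place where the kernel degenerates as T → 0. -/
theorem planeIntegral_eq (hd : 1 ≤ d) {Φ : Mink d → ℂ} (hΦ : ContDiff ℝ ∞ Φ) (p : ℂ) {N : Mink d}
    {R : Mink d ≃ₗᵢ[ℝ] Mink d} (hR : R (EuclideanSpace.single 0 1) = N) {T : ℝ} (hT : T ≠ 0) :
    planeIntegral Φ p N T = (∫ v in (-1 : ℝ)..1, (Complex.I * T + v) ^ p *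
      sliceIntegral Φ (v, (R : Mink d →L[ℝ] Mink d))) + planeFar Φ p R T := by
  have hF : Continuous fun x : Mink d => (Complex.I * T + (inner ℝ N x : ℝ)) ^ p * Φ x :=
    (continuous_ofReal_add_I_cpow (by fun_prop) hT p).mul hΦ.continuous
  have hin : ∀ x, inner ℝ N (R x) = x 0 := fun x => by
    rw [← hR, R.inner_map_map]; simp [EuclideanSpace.inner_single_left]
  have hb : Continuous fun x : Mink d => capBump (x 0) :=
    contDiff_capBump.continuous.comp (by fun_prop)
  have hc := continuous_ofReal_add_I_cpow (X := Mink d) (h := fun x => x 0) (by fun_prop) hT p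
  have hΦR := hΦ.continuous.comp R.continuous
  rw [planeIntegral, ← integral_sphere_isometry R hF.measurable, planeFar,
    ← integral_capBump_mul_eq hd hΦ _ p hT, ← integral_add]
  · refine integral_congr_ae (Eventually.of_forall fun x => ?_)
    simp only [hin]
    push_cast
    simp only [LinearIsometryEquiv.coe_toContinuousLinearEquiv]
    ring
  · exact integrable_sphere_of_continuous (F := fun x => (Complex.I * T + (x 0 : ℝ)) ^ p *
      (capBump (x 0) * Φ (R x))) (hc.mul ((Complex.continuous_ofReal.comp hb).mul hΦR))
  · exact integrable_sphere_of_continuous (F := fun x => (Complex.I * T + (x 0 : ℝ)) ^ p *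
      (((1 - capBump (x 0) : ℝ) : ℂ) * Φ (R x)))
      (hc.mul ((Complex.continuous_ofReal.comp (continuous_const.sub hb)).mul hΦR))

/-- Off the plateau of the cutoff |c| exceeds 1/4, so the base of the power stays between 1/4 and 4
in modulus. -/
theorem norm_far_kernel_le (p : ℂ) {c T : ℝ} (hc : |c| ≤ 1) (hT : |T| ≤ 1) :
    ‖(Complex.I * T + c) ^ p * ((1 - capBump c : ℝ) : ℂ)‖ ≤
      4 ^ |p.re| * Real.exp (Real.pi * |p.im|) := by
  by_cases h : |c| ≤ 1 / 4
  · rw [capBump_eq_one h]; simp; positivity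
  push Not at h
  set z : ℂ := Complex.I * T + c with hz
  have h1 : 1 / 4 ≤ ‖z‖ := by
    have := Complex.abs_re_le_norm z
    simp [hz] at this
    linarith
  have h2 : ‖z‖ ≤ 4 := by
    refine (norm_add_le _ _).trans ?_
    simp
    linarith
  have h0 : 0 < ‖z‖ := by linarith
  have h3 : ‖z‖ ^ p.re ≤ 4 ^ |p.re| := by
    rcases le_total 0 p.re with hp | hp
    · rw [abs_of_nonneg hp]; gcongr
    · rw [abs_of_nonpos hp]
      calc ‖z‖ ^ p.re ≤ (1 / 4 : ℝ) ^ p.re := Real.rpow_le_rpow_of_nonpos (by norm_num) h1 hp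
        _ = 4 ^ (-p.re) := by rw [Real.rpow_neg (by norm_num), one_div, Real.inv_rpow (by norm_num)]
  rw [norm_mul]
  have h4 : ‖((1 - capBump c : ℝ) : ℂ)‖ ≤ 1 := by
    rw [Complex.norm_real, Real.norm_eq_abs, abs_le]
    constructor <;> linarith [capBump_nonneg c, capBump_le_one c]
  calc ‖z ^ p‖ * ‖((1 - capBump c : ℝ) : ℂ)‖
      ≤ (4 ^ |p.re| * Real.exp (Real.pi * |p.im|)) * 1 := by
        gcongr
        refine norm_cpow_le_of_re.trans ?_
        gcongr
    _ = _ := mul_one _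

theorem abs_apply_zero_le (x : Sph d) : |(x : Mink d) 0| ≤ 1 := by
  have := PiLp.norm_apply_le (x : Mink d) 0
  simpa using this

theorem exists_norm_planeFar_le {Φ : Mink d → ℂ} (hΦ : ContDiff ℝ ∞ Φ) (p : ℂ) :
    ∃ C, ∀ (R : Mink d ≃ₗᵢ[ℝ] Mink d) (T : ℝ), |T| ≤ 1 → ‖planeFar Φ p R T‖ ≤ C := by
  obtain ⟨B, hB⟩ := (isCompact_sphere (0 : Mink d) 1).exists_bound_of_continuousOn
    hΦ.continuous.continuousOn
  refine ⟨(4 ^ |p.re| * Real.exp (Real.pi * |p.im|)) * B *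
    (volume : Measure (Mink d)).toSphere.real Set.univ, fun R T hT => ?_⟩
  refine norm_integral_le_of_norm_le_const (Eventually.of_forall fun x => ?_)
  rw [← mul_assoc, norm_mul]
  exact mul_le_mul (norm_far_kernel_le p (abs_apply_zero_le x) hT) (hB _ (by simp))
    (norm_nonneg _) (by positivity)

theorem exists_tendsto_planeFar {Φ : Mink d → ℂ} (hΦ : ContDiff ℝ ∞ Φ) (p : ℂ)
    (R : Mink d ≃ₗᵢ[ℝ] Mink d) (ε : ℤˣ) :
    ∃ ℓ, ∀ {β : Type} {l : Filter β} [l.IsCountablyGenerated] {f : β → ℝ},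
      Tendsto f l (𝓝 0) → (∀ᶠ b in l, 0 < sgn ε * f b) →
      Tendsto (fun b => planeFar Φ p R (f b)) l (𝓝 ℓ) := by
  obtain ⟨B, hB⟩ := (isCompact_sphere (0 : Mink d) 1).exists_bound_of_continuousOn
    hΦ.continuous.continuousOn
  refine ⟨∫ x : Sph d, Complex.exp (bdryLog ε ((x : Mink d) 0) * p) *
    (((1 - capBump ((x : Mink d) 0) : ℝ) : ℂ) * Φ (R x)) ∂(volume : Measure (Mink d)).toSphere,
    fun {β l} _ {f} hf hpos => ?_⟩
  have h0 : ∀ᶠ b in l, f b ≠ 0 := hpos.mono fun b hb h => by simp [h] at hb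
  have h1 : ∀ᶠ b in l, |f b| ≤ 1 := by
    filter_upwards [hf.eventually (closedBall_mem_nhds (0 : ℝ) one_pos)] with b hb
    simpa using hb
  refine tendsto_integral_filter_of_dominated_convergence
    (fun _ => (4 ^ |p.re| * Real.exp (Real.pi * |p.im|)) * B) ?_ ?_ (integrable_const _) ?_
  · filter_upwards [h0] with b hb
    have hb : Continuous fun x : Mink d => (Complex.I * f b + (x 0 : ℝ)) ^ p *
        (((1 - capBump (x 0) : ℝ) : ℂ) * Φ (R x)) := by
      refine (continuous_ofReal_add_I_cpow (by fun_prop) hb p).mul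
        ((Complex.continuous_ofReal.comp (continuous_const.sub
          (contDiff_capBump.continuous.comp (by fun_prop)))).mul
        (hΦ.continuous.comp R.continuous))
    exact (hb.comp continuous_subtype_val).aestronglyMeasurable
  · filter_upwards [h1] with b hb
    refine Eventually.of_forall fun x => ?_
    rw [← mul_assoc, norm_mul]
    exact mul_le_mul (norm_far_kernel_le p (abs_apply_zero_le x) hb) (hB _ (by simp))
      (norm_nonneg _) (by positivity)
  · refine Eventually.of_forall fun x => ?_
    by_cases hx : (x : Mink d) 0 = 0
    · have : capBump ((x : Mink d) 0) = 1 := capBump_eq_one (by rw [hx]; norm_num)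
      simpa [this] using tendsto_const_nhds
    · refine (tendsto_cpow_bdry hx ε ?_ ?_ _).mul_const _
      · have : Tendsto (fun b => Complex.I * (f b : ℂ) + ((x : Mink d) 0 : ℝ)) l
            (𝓝 (Complex.I * ((0 : ℝ) : ℂ) + ((x : Mink d) 0 : ℝ))) :=
          (((Complex.continuous_ofReal.tendsto 0).comp hf).const_mul _).add_const _
        simpa using this
      · simpa using hpos

theorem exists_isometry_single {N : Mink d} (hN : ‖N‖ = 1) :
    ∃ R : Mink d ≃ₗᵢ[ℝ] Mink d, R (EuclideanSpace.single 0 1) = N :=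
  exists_isometry_apply_eq (by simp [hN])

/-- Uniform bound for `planeIntegral`. -/
theorem exists_norm_planeIntegral_le (hd : 1 ≤ d) {Φ : Mink d → ℂ} (hΦ : ContDiff ℝ ∞ Φ) {p : ℂ}
    (hp : p.im ≠ 0) :
    ∃ C, ∀ N : Mink d, ‖N‖ = 1 → ∀ T : ℝ, T ≠ 0 → |T| ≤ 1 → ‖planeIntegral Φ p N T‖ ≤ C := by
  obtain ⟨C1, h1⟩ := exists_norm_integral_line_le hp (isCapFunction_sliceIntegral hΦ)
    (isCompact_closedBall (0 : MinkOp d) 1)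
  obtain ⟨C2, h2⟩ := exists_norm_planeFar_le hΦ p
  refine ⟨C1 + C2, fun N hN T hT hT1 => ?_⟩
  obtain ⟨R, hR⟩ := exists_isometry_single hN
  rw [planeIntegral_eq hd hΦ p hR hT]
  refine (norm_add_le _ _).trans (add_le_add (h1 _ ?_ T hT hT1) (h2 R T hT1))
  rw [mem_closedBall_zero_iff]
  refine ContinuousLinearMap.opNorm_le_bound _ zero_le_one fun x => ?_
  simp

theorem exists_tendsto_planeIntegral (hd : 1 ≤ d) {Φ : Mink d → ℂ} (hΦ : ContDiff ℝ ∞ Φ) {p : ℂ}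
    (hp : p.im ≠ 0) (ε : ℤˣ) {N : Mink d} (hN : ‖N‖ = 1) :
    ∃ ℓ, ∀ {β : Type} {l : Filter β} [l.IsCountablyGenerated] {f : β → ℝ},
      Tendsto f l (𝓝 0) → (∀ᶠ b in l, 0 < sgn ε * f b) →
      Tendsto (fun b => planeIntegral Φ p N (f b)) l (𝓝 ℓ) := by
  obtain ⟨R, hR⟩ := exists_isometry_single hN
  obtain ⟨ℓ1, h1⟩ := exists_tendsto_integral_line hp (isCapFunction_sliceIntegral hΦ)
    (R : Mink d →L[ℝ] Mink d) ε
  obtain ⟨ℓ2, h2⟩ := exists_tendsto_planeFar hΦ p R ε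
  refine ⟨ℓ1 + ℓ2, fun {β l} _ {f} hf hpos => ?_⟩
  have h0 : ∀ᶠ b in l, f b ≠ 0 := hpos.mono fun b hb h => by simp [h] at hb
  exact Tendsto.congr' (h0.mono fun b hb => (planeIntegral_eq hd hΦ p hR hb).symm)
    ((h1 hf hpos).add (h2 hf hpos))

end DeSitter

end

/-! ### Tube and light cone; existence of the sphere plane waves. -/

noncomputable section

namespace DeSitter

variable {d : ℕ}

/-- The reflected vector `(ξ_0, -ξ_1, …, -ξ_d)`. -/
def spaceReflect (ξ : Mink d) : Mink d :=
  consPt (ξ 0) (WithLp.toLp 2 fun i => -ξ i.succ)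

theorem inner_spaceReflect (ξ x : Mink d) : inner ℝ (spaceReflect ξ) x = mdot x ξ := by
  simp only [spaceReflect, mdot, PiLp.inner_apply, Fin.sum_univ_succ, consPt_zero, consPt_succ]
  simp [sub_eq_add_neg, mul_comm]

theorem norm_spaceReflect (ξ : Mink d) : ‖spaceReflect ξ‖ = ‖ξ‖ := by
  rw [EuclideanSpace.norm_eq, EuclideanSpace.norm_eq, Fin.sum_univ_succ, Fin.sum_univ_succ]
  simp [spaceReflect]

theorem mdot_complex (x y ξ : Mink d) :
    mdot (fun i => ((x i : ℝ) : ℂ) + Complex.I * ((y i : ℝ) : ℂ)) (fun i => ((ξ i : ℝ) : ℂ)) =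
      Complex.I * (mdot y ξ : ℝ) + (mdot x ξ : ℝ) := by
  simp only [mdot]
  push_cast
  simp only [add_mul, Finset.sum_add_distrib, mul_assoc, mul_sub, Finset.mul_sum]
  ring

theorem norm_sq_of_mem_futureCone {ξ : Mink d} (hξ : ξ ∈ futureCone d) :
    ∑ i : Fin d, ξ i.succ * ξ i.succ = ξ 0 * ξ 0 := by
  have := hξ.1
  rw [mdot] at this
  linarith

theorem norm_pos_of_mem_futureCone {ξ : Mink d} (hξ : ξ ∈ futureCone d) : 0 < ‖ξ‖ := by
  refine norm_pos_iff.2 fun h => ?_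
  have := hξ.2
  rw [h] at this
  simp at this

/-- Cauchy–Schwarz on the spatial parts: |y' · ξ'| ≤ ‖y'‖ ξ_0 < |y_0| ξ_0, since y is timelike and ξ
lightlike. Hence y_0 ξ_0 decides the sign. -/
theorem mdot_pos_of_mem_tubeCone {ε : ℤˣ} {y ξ : Mink d} (hy : y ∈ tubeCone d ε)
    (hξ : ξ ∈ futureCone d) : 0 < sgn ε * mdot y ξ := by
  have h1 := Finset.sum_mul_sq_le_sq_mul_sq Finset.univ (fun i : Fin d => y i.succ)
    (fun i : Fin d => ξ i.succ)
  have h2 := norm_sq_of_mem_futureCone hξ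
  have h3 := hy.1
  have h4 : 0 < sgn ε * y 0 := hy.2
  have h5 := hξ.2
  simp only [← pow_two] at h2
  rw [mdot] at h3 ⊢
  simp only [← pow_two] at h3
  set S := ∑ i : Fin d, y i.succ * ξ i.succ
  set Y := ∑ i : Fin d, y i.succ ^ 2
  rw [h2] at h1
  have hs : sgn ε ^ 2 = 1 := by rcases sgn_eq ε with h | h <;> simp [h]
  have h6 : (sgn ε * S) ^ 2 < (sgn ε * y 0 * ξ 0) ^ 2 := by
    calc (sgn ε * S) ^ 2 = S ^ 2 := by rw [mul_pow, hs, one_mul]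
      _ ≤ Y * ξ 0 ^ 2 := h1
      _ < y 0 ^ 2 * ξ 0 ^ 2 := by
          have : 0 < ξ 0 ^ 2 := by positivity
          exact mul_lt_mul_of_pos_right (by linarith) this
      _ = (sgn ε * y 0 * ξ 0) ^ 2 := by rw [mul_pow, mul_pow, hs, one_mul]
  have h7 := abs_lt_of_sq_lt_sq h6 (by positivity)
  have := (abs_lt.1 h7).2
  rw [mul_sub, ← mul_assoc]
  linarith

theorem ofReal_mul_cpow {r : ℝ} (hr : 0 < r) (z p : ℂ) :
    ((r : ℂ) * z) ^ p = (r : ℂ) ^ p * z ^ p := by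
  by_cases hz : z = 0
  · by_cases hp : p = 0
    · simp [hp]
    · simp [hz, Complex.zero_cpow hp]
  · rw [Complex.cpow_def_of_ne_zero (mul_ne_zero (by exact_mod_cast hr.ne') hz),
      Complex.cpow_def_of_ne_zero (by exact_mod_cast hr.ne'), Complex.cpow_def_of_ne_zero hz,
      Complex.log_ofReal_mul hr hz, ← Complex.ofReal_log hr.le, add_mul, Complex.exp_add]

/-- The imaginary part y enters only through the scalar y · ξ, and x · ξ is a Euclidean product with
the reflected vector. The limit in the tube thus becomes one in a single real variable. -/
theorem tubePairing_eq {p : ℂ} {ξ : Mink d} (hξ : 0 < ‖ξ‖) {φ : Sph d → ℂ} {Φ : Mink d → ℂ}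
    (hΦ : ∀ x : Sph d, Φ x = φ x) (y : Mink d) :
    tubePairing p ξ φ y =
      (‖ξ‖ : ℂ) ^ p * planeIntegral Φ p (‖ξ‖⁻¹ • spaceReflect ξ) (mdot y ξ / ‖ξ‖) := by
  rw [tubePairing, planeIntegral, ← integral_const_mul]
  refine integral_congr_ae (Eventually.of_forall fun x => ?_)
  have h0 : (‖ξ‖ : ℂ) ≠ 0 := by exact_mod_cast hξ.ne'
  have e : Complex.I * (mdot y ξ : ℝ) + (mdot (x : Mink d) ξ : ℝ) = ((‖ξ‖ : ℝ) : ℂ) *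
      (Complex.I * ((mdot y ξ / ‖ξ‖ : ℝ) : ℂ) +
        (inner ℝ (‖ξ‖⁻¹ • spaceReflect ξ) (x : Mink d) : ℝ)) := by
    rw [inner_smul_left, inner_spaceReflect]
    push_cast
    simp only [map_inv₀, Complex.ofReal_inv, conj_trivial]
    field_simp
  simp only
  rw [mdot_complex, e, ofReal_mul_cpow hξ, hΦ x]
  ring

/-- The vector `(ε t, 0, …, 0)`. -/
def axisPt (d : ℕ) (ε : ℤˣ) (t : ℝ) : Mink d := EuclideanSpace.single 0 (sgn ε * t)

theorem mdot_axisPt (ε : ℤˣ) (t : ℝ) (ξ : Mink d) :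
    mdot (axisPt d ε t) ξ = sgn ε * t * ξ 0 := by
  simp [mdot, axisPt]

theorem axisPt_mem_tubeCone (ε : ℤˣ) {t : ℝ} (ht : 0 < t) : axisPt d ε t ∈ tubeCone d ε := by
  have hs : sgn ε * sgn ε = 1 := by rcases sgn_eq ε with h | h <;> simp [h]
  have h0 : (axisPt d ε t) 0 = sgn ε * t := by simp [axisPt]
  refine ⟨?_, ?_⟩
  · rw [mdot_axisPt, h0, mul_mul_mul_comm, hs]; positivity
  · rw [h0]
    change 0 < sgn ε * _
    rw [← mul_assoc, hs]; simpa using ht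

theorem tendsto_axisPt (ε : ℤˣ) :
    Tendsto (axisPt d ε) (𝓝[>] 0) (𝓝[tubeCone d ε] (0 : Mink d)) := by
  refine tendsto_nhdsWithin_iff.2 ⟨?_, ?_⟩
  · have h : Continuous (axisPt d ε) := by
      have : axisPt d ε = fun t => (sgn ε * t) • EuclideanSpace.single 0 (1 : ℝ) := by
        funext t
        ext i
        by_cases hi : i = 0 <;> simp [axisPt, hi]
      rw [this]; fun_prop
    have h2 : axisPt d ε 0 = 0 := by simp [axisPt]
    exact (h2 ▸ h.tendsto 0).mono_left nhdsWithin_le_nhds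
  · filter_upwards [self_mem_nhdsWithin] with t ht using axisPt_mem_tubeCone ε ht

instance tubeCone_neBot (ε : ℤˣ) : NeBot (𝓝[tubeCone d ε] (0 : Mink d)) :=
  (tendsto_axisPt ε).neBot

/-- The sphere plane waves are boundary values in the sense of distributions. -/
theorem tendsto_tubePairing (hd : 1 ≤ d) {p : ℂ} (hp : p.im ≠ 0) (ε : ℤˣ) {ξ : Mink d}
    (hξ : ξ ∈ futureCone d) {φ : Sph d → ℂ} (hφ : SmoothOnSphere φ) :
    Tendsto (tubePairing p ξ φ) (𝓝[tubeCone d ε] 0) (𝓝 (spherePlaneWave ε p ξ φ)) := by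
  obtain ⟨Φ, hΦ, hΦφ⟩ := hφ.exists_extension
  have h0 := norm_pos_of_mem_futureCone hξ
  have hN : ‖‖ξ‖⁻¹ • spaceReflect ξ‖ = 1 := by
    rw [norm_smul, norm_spaceReflect, norm_inv, norm_norm, inv_mul_cancel₀ h0.ne']
  obtain ⟨ℓ, hℓ⟩ := exists_tendsto_planeIntegral hd hΦ hp ε hN
  have h1 : Tendsto (fun y : Mink d => mdot y ξ / ‖ξ‖) (𝓝[tubeCone d ε] (0 : Mink d)) (𝓝 0) := by
    simp only [← inner_spaceReflect]
    have h2 : Continuous fun y : Mink d => inner ℝ (spaceReflect ξ) y / ‖ξ‖ := by fun_prop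
    simpa using (h2.tendsto 0).mono_left (nhdsWithin_le_nhds (s := tubeCone d ε))
  have h2 : ∀ᶠ y : Mink d in 𝓝[tubeCone d ε] (0 : Mink d), 0 < sgn ε * (mdot y ξ / ‖ξ‖) := by
    filter_upwards [self_mem_nhdsWithin] with y hy
    rw [← mul_div_assoc]
    exact div_pos (mdot_pos_of_mem_tubeCone hy hξ) h0
  have h3 : Tendsto (tubePairing p ξ φ) (𝓝[tubeCone d ε] 0) (𝓝 ((‖ξ‖ : ℂ) ^ p * ℓ)) :=
    ((hℓ h1 h2).const_mul _).congr fun y => (tubePairing_eq h0 hΦφ y).symm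
  exact tendsto_nhds_limUnder ⟨_, h3⟩

theorem scriPoint_eq (ζ : AngSph d) :
    scriPoint ζ = (Real.sqrt 2)⁻¹ • consPt 1 (ζ : EuclideanSpace ℝ (Fin d)) := by
  have : ‖(ζ : EuclideanSpace ℝ (Fin d))‖ = 1 := by simp
  rw [scriPoint, conePoint, this]
  rfl

theorem scriPoint_zero (ζ : AngSph d) : scriPoint ζ 0 = (√2)⁻¹ := by
  rw [scriPoint_eq]; simp

theorem conePoint_mem_futureCone {η : EuclideanSpace ℝ (Fin d)} (hη : η ≠ 0) :
    conePoint η ∈ futureCone d := by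
  refine ⟨?_, ?_⟩
  · have := EuclideanSpace.norm_sq_eq η
    simp only [mdot, conePoint, Fin.cons_zero, Fin.cons_succ]
    rw [← pow_two, this]
    simp [pow_two]
  · simpa [conePoint] using hη

theorem smul_mem_futureCone {ξ : Mink d} (hξ : ξ ∈ futureCone d) {t : ℝ} (ht : 0 < t) :
    t • ξ ∈ futureCone d := by
  refine ⟨?_, ?_⟩
  · have h : mdot (t • ξ : Mink d) (t • ξ : Mink d) = t ^ 2 * mdot ξ ξ := by
      simp only [mdot, PiLp.smul_apply, smul_eq_mul, mul_sub, Finset.mul_sum]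
      congr 1
      · ring
      · exact Finset.sum_congr rfl fun i _ => by ring
    rw [h, hξ.1, mul_zero]
  · simpa using mul_pos ht hξ.2

theorem scriPoint_mem_futureCone (ζ : AngSph d) : scriPoint ζ ∈ futureCone d := by
  have : (ζ : EuclideanSpace ℝ (Fin d)) ≠ 0 := fun h => by
    have := ζ.2; simp [h] at this
  exact smul_mem_futureCone (conePoint_mem_futureCone this) (by positivity)

theorem norm_scriPoint (ζ : AngSph d) : ‖scriPoint ζ‖ = 1 := by
  have : ‖(ζ : EuclideanSpace ℝ (Fin d))‖ = 1 := by simp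
  rw [scriPoint_eq, norm_smul, norm_consPt, this, norm_inv, Real.norm_of_nonneg (by positivity)]
  norm_num

/-- The pairings at the points `(ε t, 0)` are bounded uniformly in the direction. -/
theorem exists_norm_tubePairing_le (hd : 1 ≤ d) {p : ℂ} (hp : p.im ≠ 0) (ε : ℤˣ)
    {φ : Sph d → ℂ} (hφ : SmoothOnSphere φ) :
    ∃ C, ∀ (ζ : AngSph d) (t : ℝ), 0 < t → t ≤ 1 →
      ‖tubePairing p (scriPoint ζ) φ (axisPt d ε t)‖ ≤ C := by
  obtain ⟨Φ, hΦ, hΦφ⟩ := hφ.exists_extension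
  obtain ⟨C, hC⟩ := exists_norm_planeIntegral_le hd hΦ hp
  refine ⟨C, fun ζ t ht ht1 => ?_⟩
  rw [tubePairing_eq (by rw [norm_scriPoint]; norm_num) hΦφ, norm_scriPoint, mdot_axisPt,
    scriPoint_zero]
  simp only [Complex.ofReal_one, Complex.one_cpow, one_mul, inv_one, one_smul, div_one]
  have hs : |sgn ε| = 1 := by rcases sgn_eq ε with h | h <;> simp [h]
  have h2 : (√2 : ℝ)⁻¹ ≤ 1 := inv_le_one_of_one_le₀ (Real.one_le_sqrt.2 one_le_two)
  refine hC _ (by rw [norm_spaceReflect, norm_scriPoint]) _ ?_ ?_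
  · have := sgn_ne_zero ε
    positivity
  · rw [abs_mul, abs_mul, hs, one_mul, abs_of_pos ht, abs_of_pos (by positivity)]
    exact mul_le_one₀ ht1 (by positivity) h2

end DeSitter

end

/-! ### Zonal powers: the cap at the pole and the smooth remainder. -/

noncomputable section

namespace DeSitter

open scoped SchwartzMap

section ZonalPower

variable {m : ℕ}

/-- The profile of the zonal integral near the pole. -/
def capProfile (f : 𝓢(EuclideanSpace ℝ (Fin (m + 2)), ℂ))
    (x : ℝ × EuclideanSpace ℝ (Fin (m + 2))) : ℂ :=
  ((capBump x.1 * (2 - x.1) ^ (((m + 1 : ℕ) : ℝ) / 2 - 1) : ℝ) : ℂ) * meanExt f x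

variable (f : 𝓢(EuclideanSpace ℝ (Fin (m + 2)), ℂ))

theorem isCapFunction_capProfile : IsCapFunction (capProfile f) := by
  have h0 : ∀ x : ℝ × EuclideanSpace ℝ (Fin (m + 2)), 1 / 2 < |x.1| → capProfile f x = 0 :=
    fun x hx => by rw [capProfile, capBump_eq_zero hx.le]; simp
  refine ⟨contDiff_iff_contDiffAt.2 fun z => ?_, h0⟩
  by_cases hz : z.1 < 2
  · refine (Complex.ofRealCLM.contDiff.contDiffAt.comp z
      ((contDiff_capBump.comp contDiff_fst).contDiffAt.mul ?_)).mul (contDiff_meanExt f).contDiffAt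
    exact ContDiffAt.rpow_const_of_ne (by fun_prop) (by linarith)
  · have h5 : capProfile f =ᶠ[𝓝 z] fun _ => 0 := by
      have : ∀ᶠ y : ℝ × EuclideanSpace ℝ (Fin (m + 2)) in 𝓝 z, 1 / 2 < |y.1| :=
        (isOpen_lt continuous_const (continuous_abs.comp continuous_fst)).mem_nhds
          (show (1 / 2 : ℝ) < |z.1| by
            push Not at hz; exact lt_of_lt_of_le (by linarith) (le_abs_self _))
      exact this.mono h0
    exact contDiffAt_const.congr_of_eventuallyEq h5

theorem capProfile_zero {η : EuclideanSpace ℝ (Fin (m + 2))} (hη : ‖η‖ = 1) :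
    capProfile f (0, η) = ((2 : ℝ) ^ (((m + 1 : ℕ) : ℝ) / 2 - 1) *
      (volume : Measure (EuclideanSpace ℝ (Fin (m + 1)))).toSphere.real Set.univ : ℝ) * f η := by
  rw [capProfile, meanExt_zero f hη]
  simp only [capBump_eq_one (v := 0) (by norm_num), sub_zero, one_mul]
  push_cast
  ring

/-- The cap part of the zonal integral of a function `F(⟨η, ζ⟩)`, in the variable
`v = 1 - ⟨η, ζ⟩`. -/
theorem integral_sphere_capBump {η : EuclideanSpace ℝ (Fin (m + 2))} (hη : ‖η‖ = 1) {k : ℝ → ℂ}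
    (hk : Measurable k)
    (hki : IntegrableOn (fun v : ℝ => (v : ℂ) ^ (((m + 1 : ℕ) / 2 : ℝ) - 1 : ℂ) * k v)
      (Set.Ioo 0 (1 / 2))) :
    Integrable (fun ζ : AngSph (m + 2) =>
        k (1 - inner ℝ η (ζ : EuclideanSpace ℝ (Fin (m + 2)))) *
          (capBump (1 - inner ℝ η (ζ : EuclideanSpace ℝ (Fin (m + 2)))) : ℂ) * f ζ)
        (volume : Measure (EuclideanSpace ℝ (Fin (m + 2)))).toSphere ∧
      ∫ ζ : AngSph (m + 2), k (1 - inner ℝ η (ζ : EuclideanSpace ℝ (Fin (m + 2)))) *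
          (capBump (1 - inner ℝ η (ζ : EuclideanSpace ℝ (Fin (m + 2)))) : ℂ) * f ζ
        ∂(volume : Measure (EuclideanSpace ℝ (Fin (m + 2)))).toSphere =
      ∫ v in (0 : ℝ)..1, k v * (v : ℂ) ^ (((m + 1 : ℕ) / 2 : ℝ) - 1 : ℂ) * capProfile f (v, η) := by
  have hcm : Measurable capBump := contDiff_capBump.continuous.measurable
  have hcp : ∀ v : ℝ, 0 < v → (v : ℂ) ^ (((m + 1 : ℕ) / 2 : ℝ) - 1 : ℂ) =
      ((v ^ (((m + 1 : ℕ) : ℝ) / 2 - 1) : ℝ) : ℂ) := fun v hv => by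
    rw [Complex.ofReal_cpow hv.le]; push_cast; rfl
  have h := integral_sphere_zonal f hη (F := fun c => k (1 - c) * (capBump (1 - c) : ℂ))
    ((hk.comp (by fun_prop)).mul (Complex.measurable_ofReal.comp (hcm.comp (by fun_prop))))
    (fun c hc => by
      rw [capBump_eq_zero (by rw [abs_of_nonneg] <;> linarith)]; simp) (by
      have h1 : IntegrableOn (fun v : ℝ => (v : ℂ) ^ (((m + 1 : ℕ) / 2 : ℝ) - 1 : ℂ) * k v *
          (capBump v : ℂ)) (Set.Ioo 0 (1 / 2)) := by
        refine Integrable.mul_bdd (c := 1) hki ?_ (Eventually.of_forall fun v => ?_)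
        · exact (Complex.measurable_ofReal.comp hcm).aestronglyMeasurable
        · rw [Complex.norm_real, Real.norm_of_nonneg (capBump_nonneg v)]; exact capBump_le_one v
      refine h1.congr_fun (fun v hv => ?_) measurableSet_Ioo
      simp only [sub_sub_cancel, hcp v hv.1]
      ring)
  refine ⟨h.1, h.2.trans ?_⟩
  rw [intervalIntegral.integral_of_le zero_le_one, integral_Ioc_eq_integral_Ioo]
  have hsub : Set.Ioo (0 : ℝ) (1 / 2) ⊆ Set.Ioo 0 1 := Set.Ioo_subset_Ioo_right (by norm_num)
  rw [setIntegral_eq_of_subset_of_forall_sdiff_eq_zero measurableSet_Ioo hsub]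
  · refine setIntegral_congr_fun measurableSet_Ioo fun v hv => ?_
    simp only [sub_sub_cancel, hcp v hv.1, capProfile]
    push_cast
    ring
  · intro v hv
    have : 1 / 2 ≤ v := by
      by_contra h; exact hv.2 ⟨hv.1.1, by linarith⟩
    rw [capProfile, capBump_eq_zero (by rw [abs_of_nonneg] <;> linarith)]
    simp

/-- The zonal integral of `(X + 1 - ⟨η, ζ⟩) ^ p`. -/
def zonalPower (p : ℂ) (η : EuclideanSpace ℝ (Fin (m + 2))) (X : ℂ) : ℂ :=
  ∫ ζ : AngSph (m + 2),
    (X + (1 - inner ℝ η (ζ : EuclideanSpace ℝ (Fin (m + 2))) : ℝ)) ^ p * f ζ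
    ∂(volume : Measure (EuclideanSpace ℝ (Fin (m + 2)))).toSphere

/-- The part of `zonalPower` away from the pole. -/
def zonalFar (p : ℂ) (η : EuclideanSpace ℝ (Fin (m + 2))) (X : ℂ) : ℂ :=
  ∫ ζ : AngSph (m + 2),
    (X + (1 - inner ℝ η (ζ : EuclideanSpace ℝ (Fin (m + 2))) : ℝ)) ^ p *
      ((1 - capBump (1 - inner ℝ η (ζ : EuclideanSpace ℝ (Fin (m + 2)))) : ℝ) : ℂ) * f ζ
    ∂(volume : Measure (EuclideanSpace ℝ (Fin (m + 2)))).toSphere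

theorem intervalIntegrable_cpow_half (m : ℕ) :
    IntegrableOn (fun v : ℝ => (v : ℂ) ^ (((m + 1 : ℕ) / 2 : ℝ) - 1 : ℂ)) (Set.Ioc 0 (1 / 2)) := by
  refine (intervalIntegrable_iff_integrableOn_Ioc_of_le (by norm_num)).1
    (intervalIntegral.intervalIntegrable_cpow' ?_)
  have : (0 : ℝ) ≤ m := by positivity
  rw [Complex.sub_re, Complex.ofReal_re, Complex.one_re]
  push_cast
  linarith

/-- Where the cutoff factor is nonzero one has v > 1/4, so |Re X| ≤ 1/8 keeps Re(X + v) above 1/8,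
even when X is real. -/
theorem norm_zonal_kernel_le (p : ℂ) {X : ℂ} (hX : |X.re| ≤ 1 / 8) (hX2 : |X.im| ≤ 4) {v : ℝ}
    (hv0 : 0 ≤ v) (hv : v ≤ 2) :
    ‖(X + v) ^ p * ((1 - capBump v : ℝ) : ℂ)‖ ≤ 8 ^ |p.re| * Real.exp (Real.pi * |p.im|) := by
  by_cases h : v ≤ 1 / 4
  · rw [capBump_eq_one (by rwa [abs_of_nonneg hv0])]; simp; positivity
  push Not at h
  have hX' := abs_le.1 hX
  set z : ℂ := X + v with hz
  have h1 : 1 / 8 ≤ ‖z‖ := by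
    have := (le_abs_self _).trans (Complex.abs_re_le_norm z)
    simp [hz] at this
    linarith
  have h2 : ‖z‖ ≤ 8 := by
    refine (Complex.norm_le_abs_re_add_abs_im z).trans ?_
    have : |z.re| ≤ 3 := by
      simp [hz, abs_le]; constructor <;> linarith
    simp [hz] at this ⊢
    linarith
  have h0 : 0 < ‖z‖ := by linarith
  have h3 : ‖z‖ ^ p.re ≤ 8 ^ |p.re| := by
    rcases le_total 0 p.re with hp | hp
    · rw [abs_of_nonneg hp]; gcongr
    · rw [abs_of_nonpos hp]
      calc ‖z‖ ^ p.re ≤ (1 / 8 : ℝ) ^ p.re := Real.rpow_le_rpow_of_nonpos (by norm_num) h1 hp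
        _ = 8 ^ (-p.re) := by rw [Real.rpow_neg (by norm_num), one_div, Real.inv_rpow (by norm_num)]
  rw [norm_mul]
  have h4 : ‖((1 - capBump v : ℝ) : ℂ)‖ ≤ 1 := by
    rw [Complex.norm_real, Real.norm_eq_abs, abs_le]
    constructor <;> linarith [capBump_nonneg v, capBump_le_one v]
  calc ‖z ^ p‖ * ‖((1 - capBump v : ℝ) : ℂ)‖
      ≤ (8 ^ |p.re| * Real.exp (Real.pi * |p.im|)) * 1 := by
        gcongr
        refine norm_cpow_le_of_re.trans ?_
        gcongr
    _ = _ := mul_one _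

variable {η : EuclideanSpace ℝ (Fin (m + 2))}

theorem one_sub_inner_mem (hη : ‖η‖ = 1) (ζ : AngSph (m + 2)) :
    0 ≤ 1 - inner ℝ η (ζ : EuclideanSpace ℝ (Fin (m + 2))) ∧
      1 - inner ℝ η (ζ : EuclideanSpace ℝ (Fin (m + 2))) ≤ 2 := by
  have h1 := abs_real_inner_le_norm η (ζ : EuclideanSpace ℝ (Fin (m + 2)))
  have h2 : ‖(ζ : EuclideanSpace ℝ (Fin (m + 2)))‖ = 1 := by simp
  rw [hη, h2, mul_one] at h1
  have := abs_le.1 h1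
  constructor <;> linarith

theorem schwartz_exists_bound : ∃ C, ∀ x, ‖f x‖ ≤ C := by
  obtain ⟨C, hC⟩ := f.decay 0 0
  exact ⟨C, fun x => by simpa using hC.2 x⟩

theorem measurable_zonal {k : ℝ → ℂ} (hk : Measurable k) :
    Measurable fun ζ : AngSph (m + 2) => k (1 - inner ℝ η (ζ : EuclideanSpace ℝ (Fin (m + 2)))) :=
  hk.comp (by fun_prop)

theorem integrable_zonalFar (p : ℂ) (hη : ‖η‖ = 1) {X : ℂ} (hX : |X.re| ≤ 1 / 8)
    (hX2 : |X.im| ≤ 4) :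
    Integrable (fun ζ : AngSph (m + 2) =>
      (X + (1 - inner ℝ η (ζ : EuclideanSpace ℝ (Fin (m + 2))) : ℝ)) ^ p *
      ((1 - capBump (1 - inner ℝ η (ζ : EuclideanSpace ℝ (Fin (m + 2)))) : ℝ) : ℂ) * f ζ)
      (volume : Measure (EuclideanSpace ℝ (Fin (m + 2)))).toSphere := by
  obtain ⟨C, hC⟩ := schwartz_exists_bound f
  have hcm : Measurable capBump := contDiff_capBump.continuous.measurable
  have hm : Measurable fun ζ : AngSph (m + 2) =>
      (X + (1 - inner ℝ η (ζ : EuclideanSpace ℝ (Fin (m + 2))) : ℝ)) ^ p *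
      ((1 - capBump (1 - inner ℝ η (ζ : EuclideanSpace ℝ (Fin (m + 2)))) : ℝ) : ℂ) :=
    measurable_zonal (k := fun v => (X + v) ^ p * ((1 - capBump v : ℝ) : ℂ)) (by fun_prop)
  refine Integrable.of_bound (hm.mul
    (f.continuous.measurable.comp measurable_subtype_coe)).aestronglyMeasurable
    (8 ^ |p.re| * Real.exp (Real.pi * |p.im|) * C) (Eventually.of_forall fun ζ => ?_)
  rw [norm_mul]
  obtain ⟨h1, h2⟩ := one_sub_inner_mem hη ζ
  exact mul_le_mul (norm_zonal_kernel_le p hX hX2 h1 h2) (hC _) (norm_nonneg _) (by positivity)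

theorem exists_norm_zonalFar_le (p : ℂ) :
    ∃ C, ∀ η : EuclideanSpace ℝ (Fin (m + 2)), ‖η‖ = 1 → ∀ X : ℂ, |X.re| ≤ 1 / 8 → |X.im| ≤ 4 →
      ‖zonalFar f p η X‖ ≤ C := by
  obtain ⟨C, hC⟩ := schwartz_exists_bound f
  refine ⟨(8 ^ |p.re| * Real.exp (Real.pi * |p.im|) * C) *
    (volume : Measure (EuclideanSpace ℝ (Fin (m + 2)))).toSphere.real Set.univ,
    fun η hη X hX hX2 => ?_⟩
  refine norm_integral_le_of_norm_le_const (Eventually.of_forall fun ζ => ?_)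
  rw [norm_mul]
  obtain ⟨h1, h2⟩ := one_sub_inner_mem hη ζ
  exact mul_le_mul (norm_zonal_kernel_le p hX hX2 h1 h2) (hC _) (norm_nonneg _) (by positivity)

theorem zonalPower_eq (ν : ℝ) (hη : ‖η‖ = 1) {X : ℂ} (hX : X.im ≠ 0) (hX1 : |X.re| ≤ 1 / 8)
    (hX2 : |X.im| ≤ 4) :
    zonalPower f (Complex.I * ν - ((m + 1 : ℕ) / 2 : ℝ)) η X =
      capIntegral ν (m + 1) (capProfile f) η X +
        zonalFar f (Complex.I * ν - ((m + 1 : ℕ) / 2 : ℝ)) η X := by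
  set p : ℂ := Complex.I * ν - ((m + 1 : ℕ) / 2 : ℝ) with hp
  obtain ⟨h1, h2⟩ := integral_sphere_capBump f hη (k := fun v => (X + v) ^ p) (by fun_prop) (by
    have hi : IntegrableOn (fun v : ℝ => (v : ℂ) ^ (((m + 1 : ℕ) / 2 : ℝ) - 1 : ℂ))
        (Set.Icc 0 (1 / 2)) := by
      rw [integrableOn_Icc_iff_integrableOn_Ioc]; exact intervalIntegrable_cpow_half m
    exact (hi.mul_continuousOn (continuous_add_cpow hX p).continuousOn isCompact_Icc).mono_set
      Set.Ioo_subset_Icc_self)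
  have h3 := integrable_zonalFar f p hη hX1 hX2
  rw [capIntegral, ← hp, ← h2, zonalFar, ← integral_add h1 h3, zonalPower]
  refine integral_congr_ae (Eventually.of_forall fun ζ => ?_)
  simp only
  push_cast
  ring

/-- A smooth function on the line that equals `u ^ p` for `u ≥ 1/8`. -/
def smoothPower (p : ℂ) (u : ℝ) : ℂ := (Real.smoothTransition (16 * u - 1) : ℂ) * (u : ℂ) ^ p

theorem smoothPower_eq (p : ℂ) {u : ℝ} (hu : 1 / 8 ≤ u) : smoothPower p u = (u : ℂ) ^ p := by
  rw [smoothPower, Real.smoothTransition.one_of_one_le (by linarith), Complex.ofReal_one, one_mul]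

theorem contDiffAt_ofReal_cpow {u : ℝ} (hu : 0 < u) (p : ℂ) :
    ContDiffAt ℝ ∞ (fun u : ℝ => (u : ℂ) ^ p) u := by
  have h : (fun u : ℝ => (u : ℂ) ^ p) =ᶠ[𝓝 u] fun u : ℝ => Complex.exp ((Real.log u : ℂ) * p) := by
    filter_upwards [eventually_gt_nhds hu] with v hv
    rw [Complex.cpow_def_of_ne_zero (by exact_mod_cast hv.ne'), Complex.ofReal_log hv.le]
  refine ContDiffAt.congr_of_eventuallyEq ?_ h
  refine ContDiffAt.cexp (ContDiffAt.mul ?_ contDiffAt_const)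
  exact Complex.ofRealCLM.contDiff.contDiffAt.comp u (Real.contDiffAt_log.2 hu.ne')

theorem contDiff_smoothPower (p : ℂ) : ContDiff ℝ ∞ (smoothPower p) := by
  refine contDiff_iff_contDiffAt.2 fun u => ?_
  by_cases hu : 0 < u
  · refine ContDiffAt.mul ?_ (contDiffAt_ofReal_cpow hu p)
    exact (Complex.ofRealCLM.contDiff.comp
      (Real.smoothTransition.contDiff.comp (by fun_prop))).contDiffAt
  · have h5 : smoothPower p =ᶠ[𝓝 u] fun _ => 0 := by
      filter_upwards [eventually_lt_nhds (show u < 1 / 16 by linarith)] with v hv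
      rw [smoothPower, Real.smoothTransition.zero_of_nonpos (by linarith)]
      simp
    exact contDiffAt_const.congr_of_eventuallyEq h5

/-- A smooth function of `(M, η)` that agrees with `zonalFar` for `|M| ≤ 1/8`. -/
def zonalFarSmooth (p : ℂ) (x : ℝ × EuclideanSpace ℝ (Fin (m + 2))) : ℂ :=
  ∫ ζ : AngSph (m + 2),
    smoothPower p (x.1 + (1 - inner ℝ x.2 (ζ : EuclideanSpace ℝ (Fin (m + 2))))) *
      ((1 - capBump (1 - inner ℝ x.2 (ζ : EuclideanSpace ℝ (Fin (m + 2)))) : ℝ) : ℂ) * f ζ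
    ∂(volume : Measure (EuclideanSpace ℝ (Fin (m + 2)))).toSphere

theorem contDiff_zonalFarSmooth (p : ℂ) : ContDiff ℝ ∞ (zonalFarSmooth f p) := by
  have h := contDiffOn_parametric_of_isCompact
    (μ := (volume : Measure (EuclideanSpace ℝ (Fin (m + 2)))).toSphere)
    (isOpen_univ (X := ℝ × EuclideanSpace ℝ (Fin (m + 2))))
    (v := fun u : AngSph (m + 2) => (u : EuclideanSpace ℝ (Fin (m + 2)))) measurable_subtype_coe
    (isCompact_sphere (0 : EuclideanSpace ℝ (Fin (m + 2))) 1) (fun u => u.2)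
    (integrable_const (1 : ℂ))
    (H := fun q : (ℝ × EuclideanSpace ℝ (Fin (m + 2))) × EuclideanSpace ℝ (Fin (m + 2)) =>
      smoothPower p (q.1.1 + (1 - inner ℝ q.1.2 q.2)) *
      ((1 - capBump (1 - inner ℝ q.1.2 q.2) : ℝ) : ℂ) * f q.2) (by
    have hin : ContDiff ℝ ∞ fun q : (ℝ × EuclideanSpace ℝ (Fin (m + 2))) ×
        EuclideanSpace ℝ (Fin (m + 2)) => (1 : ℝ) - inner ℝ q.1.2 q.2 :=
      contDiff_const.sub (ContDiff.inner ℝ (by fun_prop) (by fun_prop))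
    refine ContDiff.contDiffOn ?_
    refine (((contDiff_smoothPower p).comp (ContDiff.add (by fun_prop) hin)).mul ?_).mul
      ((f.smooth ⊤).comp contDiff_snd)
    exact Complex.ofRealCLM.contDiff.comp (contDiff_const.sub (contDiff_capBump.comp hin)))
  rw [contDiffOn_univ] at h
  simp only [one_mul] at h
  exact h

/-- The far factor forces v > 1/4, hence M + v ≥ 1/8, where `smoothPower` is the true power. -/
theorem zonalFarSmooth_eq (p : ℂ) (hη : ‖η‖ = 1) {M : ℝ} (hM : |M| ≤ 1 / 8) :
    zonalFarSmooth f p (M, η) = zonalFar f p η M := by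
  refine integral_congr_ae (Eventually.of_forall fun ζ => ?_)
  obtain ⟨h1, _⟩ := one_sub_inner_mem hη ζ
  simp only
  set v := 1 - inner ℝ η (ζ : EuclideanSpace ℝ (Fin (m + 2))) with hv
  by_cases h : v ≤ 1 / 4
  · rw [capBump_eq_one (by rwa [abs_of_nonneg h1])]; simp
  · push Not at h
    rw [smoothPower_eq p (by linarith [(abs_le.1 hM).1])]
    push_cast
    rfl

theorem tendsto_zonalFar (p : ℂ) (hη : ‖η‖ = 1) {M : ℝ} (hM : |M| < 1 / 8) {β : Type}
    {l : Filter β} [l.IsCountablyGenerated] {g : β → ℂ} (hg : Tendsto g l (𝓝 M)) :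
    Tendsto (fun b => zonalFar f p η (g b)) l (𝓝 (zonalFarSmooth f p (M, η))) := by
  rw [zonalFarSmooth_eq f p hη hM.le]
  obtain ⟨C, hC⟩ := schwartz_exists_bound f
  have hre : ∀ᶠ b in l, |(g b).re| ≤ 1 / 8 := by
    have : Tendsto (fun b => |(g b).re|) l (𝓝 |M|) :=
      ((continuous_abs.comp Complex.continuous_re).tendsto (M : ℂ)).comp hg
    exact (this.eventually (eventually_lt_nhds hM)).mono fun b hb => hb.le
  have him : ∀ᶠ b in l, |(g b).im| ≤ 4 := by
    have : Tendsto (fun b => |(g b).im|) l (𝓝 |(M : ℂ).im|) :=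
      ((continuous_abs.comp Complex.continuous_im).tendsto (M : ℂ)).comp hg
    rw [Complex.ofReal_im, abs_zero] at this
    exact (this.eventually (eventually_lt_nhds (by norm_num : (0 : ℝ) < 4))).mono fun b hb => hb.le
  refine tendsto_integral_filter_of_dominated_convergence
    (fun _ => 8 ^ |p.re| * Real.exp (Real.pi * |p.im|) * C) ?_ ?_ (integrable_const _) ?_
  · filter_upwards [hre, him] with b h1 h2
    exact (integrable_zonalFar f p hη h1 h2).1
  · filter_upwards [hre, him] with b hb1 hb2
    refine Eventually.of_forall fun ζ => ?_
    rw [norm_mul]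
    obtain ⟨h1, h2⟩ := one_sub_inner_mem hη ζ
    exact mul_le_mul (norm_zonal_kernel_le p hb1 hb2 h1 h2) (hC _) (norm_nonneg _) (by positivity)
  · refine Eventually.of_forall fun ζ => ?_
    obtain ⟨h1, _⟩ := one_sub_inner_mem hη ζ
    set v := 1 - inner ℝ η (ζ : EuclideanSpace ℝ (Fin (m + 2))) with hv
    by_cases h : v ≤ 1 / 4
    · have : capBump v = 1 := capBump_eq_one (by rwa [abs_of_nonneg h1])
      simpa [this] using tendsto_const_nhds
    · push Not at h
      refine (Tendsto.mul_const _ ?_).mul_const _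
      refine (hg.add_const _).cpow tendsto_const_nhds ?_
      refine Complex.mem_slitPlane_iff.2 (Or.inl ?_)
      simp
      linarith [(abs_lt.1 hM).1]

end ZonalPower

end DeSitter

end

/-! ### Coordinates and cutoffs near the future light cone. -/

noncomputable section

namespace DeSitter

open scoped SchwartzMap

theorem alpha_add_two (m : ℕ) : alpha (m + 2) = ((m + 1 : ℕ) / 2 : ℝ) := by
  rw [alpha]; push_cast; ring

theorem smoothOnSphere_of_contDiffAt {d : ℕ} {F : Mink d → ℂ}
    (hF : ∀ x : Mink d, x ≠ 0 → ContDiffAt ℝ ∞ F x) : SmoothOnSphere fun x : Sph d => F x := by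
  have hdim : Fact (Module.finrank ℝ (Mink d) = d + 1) := ⟨by simp⟩
  intro x
  have hx : (x : Mink d) ≠ 0 := fun h => by have := x.2; simp [h] at this
  exact ((hF x hx).contMDiffAt).comp x contMDiff_coe_sphere.contMDiffAt

/-- The restriction to `I_+` of a smooth homogeneous function extends to a test function. -/
theorem exists_schwartz_scriPoint {d : ℕ} {k : ℂ} {ψ : Mink d → ℂ}
    (hψ : IsSmoothHomogeneous d k ψ) :
    ∃ f : 𝓢(EuclideanSpace ℝ (Fin d), ℂ), ∀ ζ : AngSph d, f ζ = ψ (scriPoint ζ) := by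
  let b : ContDiffBump (0 : EuclideanSpace ℝ (Fin d)) := ⟨1 / 4, 1 / 2, by norm_num, by norm_num⟩
  let b2 : ContDiffBump (0 : EuclideanSpace ℝ (Fin d)) := ⟨1, 2, by norm_num, by norm_num⟩
  let g : EuclideanSpace ℝ (Fin d) → ℂ := fun y =>
    ((b2 y * (1 - b y) : ℝ) : ℂ) * ψ (conePoint ((√2)⁻¹ • y))
  have hs : (√2 : ℝ)⁻¹ ≠ 0 := by positivity
  have hg : ContDiff ℝ ∞ g := by
    refine contDiff_iff_contDiffAt.2 fun y => ?_
    by_cases hy : y = 0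
    · have h1 : g =ᶠ[𝓝 y] fun _ => 0 := by
        rw [hy]
        filter_upwards [closedBall_mem_nhds (0 : EuclideanSpace ℝ (Fin d))
          (by norm_num : (0 : ℝ) < 1 / 4)] with z hz
        simp only [g]
        rw [b.one_of_mem_closedBall hz]
        simp
      exact contDiffAt_const.congr_of_eventuallyEq h1
    · refine (Complex.ofRealCLM.contDiff.contDiffAt.comp y
        (b2.contDiffAt.mul (contDiffAt_const.sub b.contDiffAt))).mul ?_
      have h2 : ContDiffAt ℝ ∞ (fun η : EuclideanSpace ℝ (Fin d) => ψ (conePoint η))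
          ((√2)⁻¹ • y) :=
        hψ.1.contDiffAt (isOpen_compl_singleton.mem_nhds (smul_ne_zero hs hy))
      exact h2.comp y (by fun_prop)
  have hc : HasCompactSupport g := by
    refine HasCompactSupport.intro (isCompact_closedBall (0 : EuclideanSpace ℝ (Fin d)) 2)
      fun y hy => ?_
    simp only [g]
    rw [b2.zero_of_le_dist (le_of_lt (by simpa [b2] using hy))]
    simp
  refine ⟨hc.toSchwartzMap hg, fun ζ => ?_⟩
  have hζ : ‖(ζ : EuclideanSpace ℝ (Fin d))‖ = 1 := by simp
  have e1 : b2 (ζ : EuclideanSpace ℝ (Fin d)) = 1 := b2.one_of_mem_closedBall (by simp [b2])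
  have e2 : b (ζ : EuclideanSpace ℝ (Fin d)) = 0 :=
    b.zero_of_le_dist (by simp [b]; norm_num)
  have e3 : conePoint ((√2)⁻¹ • (ζ : EuclideanSpace ℝ (Fin d))) = scriPoint ζ := by
    rw [scriPoint_eq, ← consPt_smul, conePoint, norm_smul, hζ, norm_inv,
      Real.norm_of_nonneg (by positivity)]
    rfl
  change g ζ = _
  simp only [g]
  rw [e1, e2, e3]
  simp

section Tail

variable {d : ℕ}

/-- The spatial part of a vector. -/
def tail (x : Mink d) : EuclideanSpace ℝ (Fin d) := WithLp.toLp 2 fun i => x i.succ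

theorem consPt_tail (x : Mink d) : consPt (x 0) (tail x) = x := by
  ext i; refine Fin.cases ?_ (fun i => ?_) i <;> simp [tail]

theorem contDiff_tail : ContDiff ℝ ∞ (tail (d := d)) := by
  rw [contDiff_euclidean]
  intro i
  simp only [tail]
  fun_prop

theorem continuous_tail : Continuous (tail (d := d)) := contDiff_tail.continuous

theorem norm_sq_eq_tail (x : Mink d) : ‖x‖ ^ 2 = x 0 ^ 2 + ‖tail x‖ ^ 2 := by
  conv_lhs => rw [← consPt_tail x, norm_consPt_sq]

theorem mdot_scriPoint (x : Mink d) (ζ : AngSph d) :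
    mdot x (scriPoint ζ) =
      (√2)⁻¹ * (x 0 - inner ℝ (tail x) (ζ : EuclideanSpace ℝ (Fin d))) := by
  rw [scriPoint_eq]
  simp only [mdot, PiLp.smul_apply, consPt_zero, consPt_succ, smul_eq_mul, PiLp.inner_apply,
    mul_sub, Finset.mul_sum, tail]
  congr 1
  · ring
  · refine Finset.sum_congr rfl fun i _ => ?_
    simp
    ring

theorem mdot_self (x : Mink d) : mdot x x = (x 0 - ‖tail x‖) * (x 0 + ‖tail x‖) := by
  have h := EuclideanSpace.norm_sq_eq (tail x)
  have h2 : ∑ i : Fin d, x i.succ * x i.succ = ‖tail x‖ ^ 2 := by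
    rw [h]
    simp [tail, pow_two]
  rw [mdot, h2]
  ring

/-- The direction of the spatial part. -/
def angDir (x : Mink d) : EuclideanSpace ℝ (Fin d) := ‖tail x‖⁻¹ • tail x

/-- The relative distance `x_0 / ‖x'‖ - 1` to the light cone. -/
def coneRatio (x : Mink d) : ℝ := x 0 / ‖tail x‖ - 1

theorem norm_angDir {x : Mink d} (hx : 0 < ‖tail x‖) : ‖angDir x‖ = 1 := by
  rw [angDir, norm_smul, norm_inv, norm_norm, inv_mul_cancel₀ hx.ne']

theorem coneRatio_eq {x : Mink d} (hx : 0 < ‖tail x‖) :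
    coneRatio x = (x 0 - ‖tail x‖) / ‖tail x‖ := by
  rw [coneRatio, sub_div, div_self hx.ne']

theorem contDiffAt_norm_tail {x : Mink d} (hx : 0 < ‖tail x‖) :
    ContDiffAt ℝ ∞ (fun x : Mink d => ‖tail x‖) x :=
  (contDiffAt_norm ℝ (norm_pos_iff.1 hx)).comp x contDiff_tail.contDiffAt

theorem contDiffAt_angDir {x : Mink d} (hx : 0 < ‖tail x‖) : ContDiffAt ℝ ∞ (angDir (d := d)) x :=
  ((contDiffAt_norm_tail hx).inv hx.ne').smul contDiff_tail.contDiffAt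

theorem contDiffAt_coneRatio {x : Mink d} (hx : 0 < ‖tail x‖) :
    ContDiffAt ℝ ∞ (coneRatio (d := d)) x :=
  (ContDiffAt.div (by fun_prop) (contDiffAt_norm_tail hx) hx.ne').sub contDiffAt_const

/-- A cutoff to a conical neighbourhood of the future light cone. -/
def coneCut (x : Mink d) : ℝ := capBump (16 * coneRatio x)

theorem coneCut_eq_zero {x : Mink d} (h : ‖tail x‖ / 32 ≤ |x 0 - ‖tail x‖|) : coneCut x = 0 := by
  refine capBump_eq_zero ?_
  rcases (norm_nonneg (tail x)).eq_or_lt with h0 | h0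
  -- On the time axis division by zero makes `coneRatio` equal to -1, far outside the support of the
  -- cutoff.
  · rw [coneRatio, ← h0]; norm_num
  · rw [coneRatio_eq h0, abs_mul, abs_div, abs_of_pos h0, abs_of_pos (by norm_num : (0 : ℝ) < 16)]
    rw [div_le_iff₀ (by norm_num)] at h
    rw [div_le_iff₀ (by norm_num), mul_right_comm, ← mul_div_assoc, le_div_iff₀ h0]
    linarith

theorem abs_coneRatio_le {x : Mink d} {δ : ℝ} (h0 : 0 < ‖tail x‖)
    (h : |x 0 - ‖tail x‖| ≤ δ * ‖tail x‖) : |coneRatio x| ≤ δ := by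
  rw [coneRatio_eq h0, abs_div, abs_of_pos h0]
  rwa [div_le_iff₀ h0]

theorem coneCut_eq_one {x : Mink d} (h0 : 0 < ‖tail x‖)
    (h : |x 0 - ‖tail x‖| ≤ ‖tail x‖ / 64) : coneCut x = 1 := by
  refine capBump_eq_one ?_
  have := abs_coneRatio_le (δ := 1 / 64) h0 (by linarith)
  rw [abs_mul, abs_of_pos (by norm_num : (0 : ℝ) < 16)]
  linarith

/-- The cutoff already vanishes for |x_0 - r| ≥ r/32, so smoothness of F is needed only in the wider
cone |x_0 - r| < r/16. A nonzero vector with r = 0 has x_0 ≠ 0 and lies in the region of vanishing.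
-/
theorem contDiffAt_coneCut_mul {F : Mink d → ℂ}
    (hF : ∀ x : Mink d, 0 < ‖tail x‖ → |x 0 - ‖tail x‖| < ‖tail x‖ / 16 → ContDiffAt ℝ ∞ F x)
    {x : Mink d} (hx : x ≠ 0) : ContDiffAt ℝ ∞ (fun x => (coneCut x : ℂ) * F x) x := by
  by_cases h : |x 0 - ‖tail x‖| < ‖tail x‖ / 16
  · have h0 : 0 < ‖tail x‖ := by
      have := abs_nonneg (x 0 - ‖tail x‖)
      linarith
    refine ContDiffAt.mul ?_ (hF x h0 h)
    refine Complex.ofRealCLM.contDiff.contDiffAt.comp x ?_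
    exact contDiff_capBump.contDiffAt.comp x (contDiffAt_const.mul (contDiffAt_coneRatio h0))
  · push Not at h
    have h1 : ‖tail x‖ / 32 < |x 0 - ‖tail x‖| := by
      rcases (norm_nonneg (tail x)).eq_or_lt with h0 | h0
      · rw [← h0]
        have : x 0 ≠ 0 := fun hx0 => hx (by
          have := norm_sq_eq_tail x
          rw [hx0, ← h0] at this
          simpa using this)
        simpa using this
      · linarith
    have hc : Continuous fun x : Mink d => |x 0 - ‖tail x‖| - ‖tail x‖ / 32 := by
      have := continuous_tail (d := d)
      fun_prop
    have h2 : ∀ᶠ y : Mink d in 𝓝 x, ‖tail y‖ / 32 < |y 0 - ‖tail y‖| := by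
      filter_upwards [hc.continuousAt.eventually_const_lt (sub_pos.2 h1)] with y hy
      linarith
    refine (contDiffAt_const (c := (0 : ℂ))).congr_of_eventuallyEq (h2.mono fun y hy => ?_)
    simp only
    rw [coneCut_eq_zero hy.le]
    simp

end Tail

end DeSitter

end

/-! ### Boundary values of the smeared wave at points near I_+. -/

noncomputable section

namespace DeSitter

open scoped SchwartzMap

section BoundaryIntegral

variable {m : ℕ}

/-- The exponent `iν - α`. -/
def waveExp (m : ℕ) (ν : ℝ) : ℂ := Complex.I * ν - ((m + 1 : ℕ) / 2 : ℝ)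

theorem waveExp_eq (m : ℕ) (ν : ℝ) : waveExp m ν = Complex.I * ν - (alpha (m + 2) : ℂ) := by
  rw [alpha_add_two, waveExp]

theorem waveExp_re (m : ℕ) (ν : ℝ) : (waveExp m ν).re = -((m + 1 : ℕ) / 2 : ℝ) := by
  rw [waveExp, Complex.sub_re, Complex.ofReal_re]; simp

theorem waveExp_im (m : ℕ) (ν : ℝ) : (waveExp m ν).im = ν := by
  rw [waveExp, Complex.sub_im, Complex.ofReal_im]; simp

/-- The integral over `I_+` of `((x + i y) · ξ) ^ p ψ(ξ)`. -/
def waveIntegral {d : ℕ} (ψ : Mink d → ℂ) (p : ℂ) (x y : Mink d) : ℂ :=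
  ∫ ζ : AngSph d, (mdot (fun i => ((x i : ℝ) : ℂ) + Complex.I * ((y i : ℝ) : ℂ))
    (fun i => ((scriPoint ζ i : ℝ) : ℂ))) ^ p * ψ (scriPoint ζ) ∂(omegaMeasure d)

theorem integral_omegaMeasure {d : ℕ} (F : AngSph d → ℂ) :
    ∫ ζ, F ζ ∂(omegaMeasure d) = ((2 : ℝ) ^ (-alpha d) : ℝ) *
      ∫ ζ, F ζ ∂(volume : Measure (EuclideanSpace ℝ (Fin d))).toSphere := by
  rw [omegaMeasure, integral_smul_measure, ENNReal.toReal_ofReal (by positivity),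
    Complex.real_smul]

/-- The normalization of `waveIntegral`. -/
def waveConst (m : ℕ) (p : ℂ) : ℂ :=
  ((2 : ℝ) ^ (-alpha (m + 2)) : ℝ) * (((√2)⁻¹ : ℝ) : ℂ) ^ p

variable {ψ : Mink (m + 2) → ℂ} {f : 𝓢(EuclideanSpace ℝ (Fin (m + 2)), ℂ)}

theorem inner_angDir {d : ℕ} {x : Mink d} (hx : 0 < ‖tail x‖) (ζ : AngSph d) :
    inner ℝ (tail x) (ζ : EuclideanSpace ℝ (Fin d)) =
      ‖tail x‖ * inner ℝ (angDir x) (ζ : EuclideanSpace ℝ (Fin d)) := by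
  rw [angDir, inner_smul_left, conj_trivial, ← mul_assoc, mul_inv_cancel₀ hx.ne', one_mul]

/-- For x = (x_0, rη) and y = (εt, 0) one has (x + iy) · ξ = (r/√2)(M + iεt/r + 1 - ⟨η, ζ⟩), and
positive factors leave a principal power without a phase. -/
theorem waveIntegral_eq (hf : ∀ ζ : AngSph (m + 2), f ζ = ψ (scriPoint ζ)) (p : ℂ)
    {x : Mink (m + 2)} (hx : 0 < ‖tail x‖) (ε : ℤˣ) (t : ℝ) :
    waveIntegral ψ p x (axisPt (m + 2) ε t) = waveConst m p * (‖tail x‖ : ℂ) ^ p *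
      zonalPower f p (angDir x)
        ((coneRatio x : ℂ) + Complex.I * ((sgn ε * t / ‖tail x‖ : ℝ) : ℂ)) := by
  suffices key : ∀ ζ : AngSph (m + 2), (mdot (fun i => ((x i : ℝ) : ℂ) +
      Complex.I * ((axisPt (m + 2) ε t i : ℝ) : ℂ)) (fun i => ((scriPoint ζ i : ℝ) : ℂ))) ^ p *
        ψ (scriPoint ζ) = ((((√2)⁻¹ : ℝ) : ℂ) ^ p * (‖tail x‖ : ℂ) ^ p) *
      (((coneRatio x : ℂ) + Complex.I * ((sgn ε * t / ‖tail x‖ : ℝ) : ℂ) +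
        (1 - inner ℝ (angDir x) (ζ : EuclideanSpace ℝ (Fin (m + 2))) : ℝ)) ^ p * f ζ) by
    rw [waveIntegral, integral_omegaMeasure, integral_congr_ae (Eventually.of_forall key),
      integral_const_mul, waveConst, zonalPower]
    ring
  intro ζ
  have h0 : (‖tail x‖ : ℂ) ≠ 0 := by exact_mod_cast hx.ne'
  have hs : (0 : ℝ) < (√2)⁻¹ := by positivity
  have e : Complex.I * ((mdot (axisPt (m + 2) ε t) (scriPoint ζ) : ℝ) : ℂ) +
      ((mdot x (scriPoint ζ) : ℝ) : ℂ) = (((√2)⁻¹ : ℝ) : ℂ) * ((‖tail x‖ : ℂ) *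
        ((coneRatio x : ℂ) + Complex.I * ((sgn ε * t / ‖tail x‖ : ℝ) : ℂ) +
          ((1 - inner ℝ (angDir x) (ζ : EuclideanSpace ℝ (Fin (m + 2))) : ℝ) : ℂ))) := by
    rw [mdot_axisPt, scriPoint_zero, mdot_scriPoint, inner_angDir hx, coneRatio]
    push_cast
    field_simp
    ring
  rw [mdot_complex, e, ofReal_mul_cpow hs, ofReal_mul_cpow hx, hf]
  ring

/-- The smooth part of the boundary value of `waveIntegral`. -/
def waveRegular (f : 𝓢(EuclideanSpace ℝ (Fin (m + 2)), ℂ)) (ν : ℝ) (x : Mink (m + 2)) : ℂ :=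
  waveConst m (waveExp m ν) * (‖tail x‖ : ℂ) ^ (waveExp m ν) *
    (capRegular ν (m + 1) (capProfile f) (coneRatio x, angDir x) +
      zonalFarSmooth f (waveExp m ν) (coneRatio x, angDir x))

/-- The coefficient of `(μ ± i0) ^ (iν)` in the boundary value of `waveIntegral`. -/
def waveSingular (f : 𝓢(EuclideanSpace ℝ (Fin (m + 2)), ℂ)) (ν : ℝ) (x : Mink (m + 2)) : ℂ :=
  waveConst m (waveExp m ν) * (‖tail x‖ : ℂ) ^ (waveExp m ν) *
    (((‖tail x‖ * (x 0 + ‖tail x‖) : ℝ) : ℂ) ^ (-(Complex.I * ν)) *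
      capSingular ν (m + 1) (capProfile f) (coneRatio x, angDir x))

theorem contDiffAt_waveRegular (ν : ℝ) {x : Mink (m + 2)} (h0 : 0 < ‖tail x‖) :
    ContDiffAt ℝ ∞ (waveRegular f ν) x := by
  have hp := (contDiffAt_coneRatio h0).prodMk (contDiffAt_angDir h0)
  refine (contDiffAt_const.mul ((contDiffAt_ofReal_cpow h0 _).comp x (contDiffAt_norm_tail h0))).mul
    (ContDiffAt.add ?_ ?_)
  · exact (contDiff_capRegular (by omega) (isCapFunction_capProfile f) ν).contDiffAt.comp x hp
  · exact (contDiff_zonalFarSmooth f _).contDiffAt.comp x hp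

theorem contDiffAt_waveSingular (ν : ℝ) {x : Mink (m + 2)} (h0 : 0 < ‖tail x‖)
    (h1 : 0 < x 0 + ‖tail x‖) : ContDiffAt ℝ ∞ (waveSingular f ν) x := by
  have hp := (contDiffAt_coneRatio h0).prodMk (contDiffAt_angDir h0)
  refine (contDiffAt_const.mul ((contDiffAt_ofReal_cpow h0 _).comp x (contDiffAt_norm_tail h0))).mul
    (ContDiffAt.mul ?_ ?_)
  · refine ContDiffAt.comp (g := fun u : ℝ => (u : ℂ) ^ (-(Complex.I * (ν : ℂ))))
      (f := fun x : Mink (m + 2) => ‖tail x‖ * (x 0 + ‖tail x‖)) x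
      (contDiffAt_ofReal_cpow (mul_pos h0 h1) _) ?_
    exact (contDiffAt_norm_tail h0).mul (ContDiffAt.add (by fun_prop) (contDiffAt_norm_tail h0))
  · exact (contDiff_capSingular (by omega) (isCapFunction_capProfile f) ν).contDiffAt.comp x hp

/-- The neighbourhood of `I_+` on which the asymptotics is proved. -/
def scriNhd (d : ℕ) : Set (Sph d) :=
  {x | |(x : Mink d) 0 - ‖tail (x : Mink d)‖| < ‖tail (x : Mink d)‖ / 64}

theorem isOpen_scriNhd (d : ℕ) : IsOpen (scriNhd d) := by
  have := continuous_tail (d := d)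
  refine isOpen_lt ?_ ?_ <;> fun_prop

theorem norm_tail_of_mem_scriNhd {d : ℕ} {x : Sph d} (hx : x ∈ scriNhd d) :
    1 / 4 ≤ ‖tail (x : Mink d)‖ := by
  have h1 := norm_sq_eq_tail (x : Mink d)
  have h2 : ‖(x : Mink d)‖ = 1 := by simp
  have h3 := abs_lt.1 (show |(x : Mink d) 0 - ‖tail (x : Mink d)‖| < _ from hx)
  rw [h2] at h1
  by_contra h
  push Not at h
  nlinarith [norm_nonneg (tail (x : Mink d))]

theorem abs_coneRatio_of_mem_scriNhd {d : ℕ} {x : Sph d} (hx : x ∈ scriNhd d) :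
    |coneRatio (x : Mink d)| ≤ 1 / 64 := by
  have h0 := norm_tail_of_mem_scriNhd hx
  refine abs_coneRatio_le (by linarith) ?_
  have : |(x : Mink d) 0 - ‖tail (x : Mink d)‖| < ‖tail (x : Mink d)‖ / 64 := hx
  linarith

/-- On the unit sphere μ = (x_0 - r)(x_0 + r). Near I_+ the factor r(x_0 + r) in front of M is
positive, so the singular powers of μ and of M differ by a smooth factor. -/
theorem muFun_eq {d : ℕ} {x : Sph d} (hx : 0 < ‖tail (x : Mink d)‖) :
    muFun x = (‖tail (x : Mink d)‖ * ((x : Mink d) 0 + ‖tail (x : Mink d)‖)) *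
      coneRatio (x : Mink d) := by
  have h2 : ‖(x : Mink d)‖ = 1 := by simp
  rw [muFun, mdot_self, h2, coneRatio_eq hx]
  field_simp

theorem tendsto_coneRatio_add (ε : ℤˣ) (M : ℝ) {r : ℝ} (hr : 0 < r) :
    Tendsto (fun t : ℝ => (M : ℂ) + Complex.I * ((sgn ε * t / r : ℝ) : ℂ)) (𝓝[>] 0) (𝓝 (M : ℂ)) ∧
      ∀ t : ℝ, 0 < t → 0 < sgn ε * ((M : ℂ) + Complex.I * ((sgn ε * t / r : ℝ) : ℂ)).im := by
  refine ⟨?_, fun t ht => ?_⟩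
  · have h : Continuous fun t : ℝ => (M : ℂ) + Complex.I * ((sgn ε * t / r : ℝ) : ℂ) := by fun_prop
    have := (h.tendsto 0).mono_left (nhdsWithin_le_nhds (s := Set.Ioi 0))
    simpa using this
  · have hs : sgn ε * sgn ε = 1 := by rcases sgn_eq ε with h | h <;> simp [h]
    have e : ((M : ℂ) + Complex.I * ((sgn ε * t / r : ℝ) : ℂ)).im = sgn ε * t / r := by
      simp [-Complex.ofReal_div, -Complex.ofReal_mul]
    rw [e, ← mul_div_assoc, ← mul_assoc, hs, one_mul]
    positivity

/-- The cap and far limits add up. The power (r(x_0 + r))^(-iν) built into `waveSingular`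
compensates for the passage from M to μ. -/
theorem tendsto_waveIntegral (hf : ∀ ζ : AngSph (m + 2), f ζ = ψ (scriPoint ζ)) (ε : ℤˣ) {ν : ℝ}
    (hν : ν ≠ 0) {x : Sph (m + 2)} (hx : x ∈ scriNhd (m + 2)) (hμ : muFun x ≠ 0) :
    Tendsto (fun t => waveIntegral ψ (waveExp m ν) x (axisPt (m + 2) ε t)) (𝓝[>] 0)
      (𝓝 (waveRegular f ν x + i0Pow ε ν (muFun x) * waveSingular f ν x)) := by
  have hr4 := norm_tail_of_mem_scriNhd hx
  have hr : 0 < ‖tail (x : Mink (m + 2))‖ := by linarith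
  have hM := abs_coneRatio_of_mem_scriNhd hx
  rw [muFun_eq hr] at hμ ⊢
  set r := ‖tail (x : Mink (m + 2))‖ with hrdef
  set M := coneRatio (x : Mink (m + 2)) with hMdef
  have hM0 : M ≠ 0 := right_ne_zero_of_mul hμ
  have hη := norm_angDir hr
  have hxr : 0 < (x : Mink (m + 2)) 0 + r := by
    have := (abs_lt.1 (show |(x : Mink (m + 2)) 0 - r| < r / 64 from hx)).1
    linarith
  obtain ⟨ht1, ht2⟩ := tendsto_coneRatio_add ε M hr
  have ht2' : ∀ᶠ t : ℝ in 𝓝[>] 0,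
      0 < sgn ε * ((M : ℂ) + Complex.I * ((sgn ε * t / r : ℝ) : ℂ)).im := by
    filter_upwards [self_mem_nhdsWithin] with t ht using ht2 t ht
  have hcap := tendsto_capIntegral (n := m + 1) (by omega) ε hν (isCapFunction_capProfile f)
    (angDir (x : Mink (m + 2))) hM0 ht1 ht2'
  rw [betaConst_mul_boundaryLayer (by omega) ε ν (isCapFunction_capProfile f) _
    (by linarith)] at hcap
  have hfar := tendsto_zonalFar f (waveExp m ν) hη (M := M) (by linarith) ht1
  have hsum := (hcap.add hfar).const_mul (waveConst m (waveExp m ν) * (r : ℂ) ^ (waveExp m ν))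
  have hsmall : ∀ᶠ t : ℝ in 𝓝[>] 0, t ≤ 1 :=
    mem_of_superset (Ioc_mem_nhdsGT one_pos) fun t ht => ht.2
  have hlim : waveConst m (waveExp m ν) * (r : ℂ) ^ waveExp m ν *
      (capRegular ν (m + 1) (capProfile f) (M, angDir (x : Mink (m + 2))) +
        i0Pow ε ν M * capSingular ν (m + 1) (capProfile f) (M, angDir (x : Mink (m + 2))) +
        zonalFarSmooth f (waveExp m ν) (M, angDir (x : Mink (m + 2)))) =
      waveRegular f ν x + i0Pow ε ν (r * ((x : Mink (m + 2)) 0 + r) * M) * waveSingular f ν x := by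
    have hpos : 0 < r * ((x : Mink (m + 2)) 0 + r) := mul_pos hr hxr
    have hne : ((r * ((x : Mink (m + 2)) 0 + r) : ℝ) : ℂ) ^ (Complex.I * (ν : ℂ)) ≠ 0 := by
      rw [Complex.cpow_def_of_ne_zero (by exact_mod_cast hpos.ne')]
      exact Complex.exp_ne_zero _
    rw [i0Pow_mul hpos, waveRegular, waveSingular, Complex.cpow_neg, ← hrdef, ← hMdef]
    field_simp
    ring
  rw [← hlim]
  refine hsum.congr' ?_
  filter_upwards [self_mem_nhdsWithin, hsmall] with t ht ht1
  rw [waveIntegral_eq hf _ hr, waveExp]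
  congr 1
  have ht0 : (0 : ℝ) < t := ht
  have him := ht2 t ht0
  have e : ((M : ℂ) + Complex.I * ((sgn ε * t / r : ℝ) : ℂ)).im = sgn ε * t / r := by
    simp [-Complex.ofReal_div, -Complex.ofReal_mul]
  have hs : |sgn ε| = 1 := by rcases sgn_eq ε with h | h <;> simp [h]
  refine (zonalPower_eq f ν hη ?_ ?_ ?_).symm
  · intro h; rw [h] at him; simp at him
  · have : ((M : ℂ) + Complex.I * ((sgn ε * t / r : ℝ) : ℂ)).re = M := by
      simp [-Complex.ofReal_div, -Complex.ofReal_mul]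
    rw [this]; linarith
  · rw [e, abs_div, abs_mul, hs, one_mul, abs_of_pos ht0, abs_of_pos hr, div_le_iff₀ hr]
    linarith

/-- The uniform cap and far bounds combine with r ≥ 1/4. This dominates the integrand when the limit
is taken after pairing with a test function. -/
theorem exists_norm_waveIntegral_le (hf : ∀ ζ : AngSph (m + 2), f ζ = ψ (scriPoint ζ)) (ε : ℤˣ)
    {ν : ℝ} (hν : ν ≠ 0) :
    ∃ C, ∀ x ∈ scriNhd (m + 2), ∀ t : ℝ, 0 < t → t ≤ 1 →
      ‖waveIntegral ψ (waveExp m ν) x (axisPt (m + 2) ε t)‖ ≤ C := by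
  obtain ⟨C1, h1⟩ := exists_norm_capIntegral_le (n := m + 1) (by omega) hν
    (isCapFunction_capProfile f) (isCompact_sphere (0 : EuclideanSpace ℝ (Fin (m + 2))) 1)
  obtain ⟨C2, h2⟩ := exists_norm_zonalFar_le f (waveExp m ν)
  refine ⟨‖waveConst m (waveExp m ν)‖ * (1 / 4) ^ (-((m + 1 : ℕ) / 2 : ℝ)) * (C1 + C2),
    fun x hx t ht0 ht1 => ?_⟩
  have hr4 := norm_tail_of_mem_scriNhd hx
  have hr : 0 < ‖tail (x : Mink (m + 2))‖ := by linarith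
  have hM := abs_coneRatio_of_mem_scriNhd hx
  rw [waveIntegral_eq hf _ hr]
  set r := ‖tail (x : Mink (m + 2))‖ with hrdef
  set M := coneRatio (x : Mink (m + 2)) with hMdef
  have hη := norm_angDir hr
  have e : ((M : ℂ) + Complex.I * ((sgn ε * t / r : ℝ) : ℂ)).im = sgn ε * t / r := by
    simp [-Complex.ofReal_div, -Complex.ofReal_mul]
  have e2 : ((M : ℂ) + Complex.I * ((sgn ε * t / r : ℝ) : ℂ)).re = M := by
    simp [-Complex.ofReal_div, -Complex.ofReal_mul]
  have hs : |sgn ε| = 1 := by rcases sgn_eq ε with h | h <;> simp [h]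
  have him := (tendsto_coneRatio_add ε M hr).2 t ht0
  set X := (M : ℂ) + Complex.I * ((sgn ε * t / r : ℝ) : ℂ) with hX
  have hX0 : X.im ≠ 0 := fun h => by rw [h] at him; simp at him
  have hX1 : |X.re| ≤ 1 / 8 := by rw [e2]; linarith
  have hX2 : |X.im| ≤ 4 := by
    rw [e, abs_div, abs_mul, hs, one_mul, abs_of_pos ht0, abs_of_pos hr, div_le_iff₀ hr]
    linarith
  have hz := zonalPower_eq f ν hη hX0 hX1 hX2
  rw [← waveExp] at hz
  rw [hz, norm_mul, norm_mul]
  have hrp : ‖(r : ℂ) ^ waveExp m ν‖ ≤ (1 / 4) ^ (-((m + 1 : ℕ) / 2 : ℝ)) := by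
    rw [Complex.norm_cpow_eq_rpow_re_of_pos hr, waveExp_re]
    refine Real.rpow_le_rpow_of_nonpos (by norm_num) hr4 ?_
    have : (0 : ℝ) ≤ (m + 1 : ℕ) := by positivity
    linarith
  gcongr
  exact (norm_add_le _ _).trans (add_le_add (h1 _ (by simpa using hη) X hX0) (h2 _ hη X hX1 hX2))

end BoundaryIntegral

end DeSitter

end

/-! ### Analytic continuation in s. -/

noncomputable section

namespace DeSitter

open scoped SchwartzMap

/-- A bounded exponent L makes both the integrand and its s-derivative locally uniformly dominated
by ‖K‖; L will be the logarithm of a quantity bounded above and away from 0. -/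
theorem differentiable_integral_exp_mul {Y : Type*} [MeasurableSpace Y] {μ : Measure Y}
    {L : Y → ℝ} (hL : Measurable L) {B : ℝ} (hB : ∀ y, |L y| ≤ B) {K : Y → ℂ}
    (hK : Integrable K μ) :
    Differentiable ℂ fun s : ℂ => ∫ y, Complex.exp (s * L y) * K y ∂μ := by
  intro s₀
  have hexp : ∀ s : ℂ, Measurable fun y => Complex.exp (s * L y) := fun s => by fun_prop
  have hn : ∀ (s : ℂ) (y : Y), ‖Complex.exp (s * L y)‖ ≤ Real.exp (‖s‖ * B) := fun s y => by
    rw [Complex.norm_exp]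
    refine Real.exp_le_exp.2 ((Complex.re_le_norm _).trans ?_)
    rw [norm_mul, Complex.norm_real]
    exact mul_le_mul_of_nonneg_left (hB y) (norm_nonneg _)
  refine (hasDerivAt_integral_of_dominated_loc_of_deriv_le (ball_mem_nhds s₀ one_pos)
    (F' := fun s y => (Complex.exp (s * L y) * L y) * K y)
    (bound := fun y => (Real.exp ((‖s₀‖ + 1) * B) * B) * ‖K y‖)
    (Eventually.of_forall fun s => (hexp s).aestronglyMeasurable.mul hK.1) ?_ ?_ ?_
    (hK.norm.const_mul _) ?_).2.differentiableAt
  · exact hK.bdd_mul (hexp s₀).aestronglyMeasurable (Eventually.of_forall (hn s₀))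
  · exact (((hexp s₀).mul (Complex.measurable_ofReal.comp hL)).aestronglyMeasurable).mul hK.1
  · refine Eventually.of_forall fun y s hs => ?_
    have hB0 : 0 ≤ B := (abs_nonneg _).trans (hB y)
    have hs1 : ‖s‖ ≤ ‖s₀‖ + 1 := by
      have := norm_sub_norm_le s s₀
      have h2 : ‖s - s₀‖ < 1 := by simpa [dist_eq_norm] using hs
      linarith
    rw [norm_mul, norm_mul, Complex.norm_real]
    gcongr
    · exact (hn s y).trans (Real.exp_le_exp.2 (by gcongr))
    · exact hB y
  · refine Eventually.of_forall fun y s _ => HasDerivAt.mul_const ?_ _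
    simpa using ((hasDerivAt_id s).mul_const (L y : ℂ)).cexp

section Continuation

variable {m : ℕ} (f : 𝓢(EuclideanSpace ℝ (Fin (m + 2)), ℂ))
  {η : EuclideanSpace ℝ (Fin (m + 2))}

theorem differentiable_zonalFar (hη : ‖η‖ = 1) (a : ℂ) :
    Differentiable ℂ fun s : ℂ => zonalFar f (s - a) η 0 := by
  set V : AngSph (m + 2) → ℝ := fun ζ => 1 - inner ℝ η (ζ : EuclideanSpace ℝ (Fin (m + 2)))
    with hV
  have hK := integrable_zonalFar f (-a) hη (X := 0) (by simp) (by simp)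
  -- The maximum with 1/4 keeps the logarithm bounded everywhere; where it alters the base, the far
  -- cutoff factor is zero.
  have h := differentiable_integral_exp_mul (L := fun ζ => Real.log (max (1 / 4) (V ζ)))
    (B := Real.log 4) ?_ ?_ hK
  · convert! h using 2 with s
    refine integral_congr_ae (Eventually.of_forall fun ζ => ?_)
    obtain ⟨h1, _⟩ := one_sub_inner_mem hη ζ
    simp only [zero_add]
    by_cases hv : V ζ ≤ 1 / 4
    · rw [capBump_eq_one (by rw [abs_of_nonneg h1]; exact hv)]; simp
    · push Not at hv
      have h0 : ((V ζ : ℝ) : ℂ) ≠ 0 := by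
        have : V ζ ≠ 0 := by linarith
        exact_mod_cast this
      rw [max_eq_right hv.le, sub_eq_add_neg s a, Complex.cpow_add _ _ h0,
        Complex.cpow_def_of_ne_zero h0 s, ← Complex.ofReal_log h1, mul_comm s]
      ring
  · have : Measurable V := by fun_prop
    fun_prop
  · intro ζ
    obtain ⟨h1, h2⟩ := one_sub_inner_mem hη ζ
    have h3 : (1 / 4 : ℝ) ≤ max (1 / 4) (V ζ) := le_max_left _ _
    have h4 : max (1 / 4) (V ζ) ≤ 4 := max_le (by norm_num) (h2.trans (by norm_num))
    rw [abs_le]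
    constructor
    · rw [← Real.log_inv]
      exact Real.log_le_log (by norm_num) (by norm_num)
    · exact Real.log_le_log (by linarith) h4

theorem integral_cpow_mul_eq_mellin {E : Type} [NormedAddCommGroup E] [NormedSpace ℝ E]
    {g : ℝ × E → ℂ} (hg : IsCapFunction g) (s : ℂ) (η : E) :
    ∫ y in (0 : ℝ)..2, (y : ℂ) ^ s * g (y, η) = mellin (fun y => g (y, η)) (s + 1) := by
  rw [mellin, intervalIntegral.integral_of_le zero_le_two]
  simp only [add_sub_cancel_right, smul_eq_mul]
  symm
  refine setIntegral_eq_of_subset_of_forall_sdiff_eq_zero measurableSet_Ioi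
    (fun y hy => hy.1) fun y hy => ?_
  have : 2 < y := by
    by_contra h; exact hy.2 ⟨hy.1, by linarith⟩
  rw [hg.eq_zero _ (lt_of_lt_of_le (by simp only; linarith) (le_abs_self _)), mul_zero]

/-- As a Mellin transform of a function bounded at 0 and vanishing for large y, the integral is
holomorphic as soon as Re(s + 1) > 0. -/
theorem differentiableAt_integral_cpow_mul {E : Type} [NormedAddCommGroup E] [NormedSpace ℝ E]
    {g : ℝ × E → ℂ} (hg : IsCapFunction g) {s : ℂ} (hs : -1 < s.re) (η : E) :
    DifferentiableAt ℂ (fun s : ℂ => ∫ y in (0 : ℝ)..2, (y : ℂ) ^ s * g (y, η)) s := by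
  simp only [integral_cpow_mul_eq_mellin hg]
  have hc := hg.continuous_slice η
  have hd : DifferentiableAt ℂ (fun s : ℂ => s + 1) s := by fun_prop
  refine DifferentiableAt.comp (g := mellin fun y => g (y, η)) s ?_ hd
  refine mellin_differentiableAt_of_isBigO_rpow (a := (s + 1).re + 1) (b := 0)
    (hc.locallyIntegrable.locallyIntegrableOn _) ?_ (by simp) ?_ (by simp; linarith)
  · have h : (fun y => g (y, η)) =ᶠ[atTop] fun _ => 0 := by
      filter_upwards [eventually_gt_atTop (1 / 2 : ℝ)] with y hy
      exact hg.eq_zero _ (lt_of_lt_of_le hy (le_abs_self _))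
    exact h.trans_isBigO (Asymptotics.isBigO_zero _ _)
  · simp only [neg_zero, Real.rpow_zero]
    exact (hc.continuousAt.tendsto.isBigO_one ℝ).mono nhdsWithin_le_nhds

/-- One integration by parts performs the continuation: the right-hand expression makes sense for Re
s > -1 with s ≠ 0, in particular at s = iν. Both upper limits lie beyond the support. -/
theorem integral_cpow_sub_one_mul {E : Type} [NormedAddCommGroup E] [NormedSpace ℝ E]
    {g : ℝ × E → ℂ} (hg : IsCapFunction g) {s : ℂ} (hs : 0 < s.re) (η : E) :
    ∫ y in (0 : ℝ)..1, (y : ℂ) ^ (s - 1) * g (y, η) =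
      -s⁻¹ * ∫ y in (0 : ℝ)..2, (y : ℂ) ^ s * dv g (y, η) := by
  have hs0 : s ≠ 0 := fun h => by simp [h] at hs
  have i1 : IntervalIntegrable (fun y : ℝ => (y : ℂ) ^ (s - 1) * g (y, η)) volume 0 2 :=
    (intervalIntegral.intervalIntegrable_cpow' (by simp; linarith)).mul_continuousOn
      (hg.continuous_slice η).continuousOn
  have c2 : Continuous fun y : ℝ => (y : ℂ) ^ s * dv g (y, η) :=
    (Complex.continuous_ofReal_cpow_const hs).mul (hg.dv.continuous_slice η)
  have h := intervalIntegral.integral_eq_sub_of_hasDerivAt_of_le (a := (0 : ℝ)) (b := 2)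
    (f := fun y : ℝ => (y : ℂ) ^ s * g (y, η))
    (f' := fun y : ℝ => s * ((y : ℂ) ^ (s - 1) * g (y, η)) + (y : ℂ) ^ s * dv g (y, η))
    zero_le_two ((Complex.continuous_ofReal_cpow_const hs).mul
      (hg.continuous_slice η)).continuousOn ?_
    ((i1.const_mul _).add (c2.intervalIntegrable _ _))
  · rw [intervalIntegral.integral_add (i1.const_mul _) (c2.intervalIntegrable _ _),
      intervalIntegral.integral_const_mul, hg.eq_zero (2, η) (by norm_num), Complex.ofReal_zero,
      Complex.zero_cpow hs0] at h
    simp only [mul_zero, zero_mul, sub_zero] at h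
    have h2 : ∫ y in (0 : ℝ)..1, (y : ℂ) ^ (s - 1) * g (y, η) =
        ∫ y in (0 : ℝ)..2, (y : ℂ) ^ (s - 1) * g (y, η) := by
      rw [intervalIntegral.integral_of_le zero_le_one, intervalIntegral.integral_of_le zero_le_two]
      symm
      refine setIntegral_eq_of_subset_of_forall_sdiff_eq_zero measurableSet_Ioc
        (Set.Ioc_subset_Ioc_right one_le_two) fun y hy => ?_
      have : 1 < y := by
        by_contra h; exact hy.2 ⟨hy.1.1, by linarith⟩
      rw [hg.eq_zero _ (lt_of_lt_of_le (by simp only; linarith) (le_abs_self _)), mul_zero]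
    rw [h2]
    field_simp
    linear_combination h
  · intro y hy
    exact ((hasDerivAt_ofReal_cpow_const hy.1.ne' hs0).mul (hg.hasDerivAt y η)).congr_deriv
      (by ring)

/-- The zonal integral of `(1 - ⟨η, ζ⟩) ^ (s - α)` for `Re s > 0`. -/
theorem integral_zonal_of_re_pos (hη : ‖η‖ = 1) {s : ℂ} (hs : 0 < s.re) :
    Integrable (fun ζ : AngSph (m + 2) =>
        ((1 - inner ℝ η (ζ : EuclideanSpace ℝ (Fin (m + 2))) : ℝ) : ℂ) ^
          (s - ((m + 1 : ℕ) / 2 : ℝ)) * f ζ)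
        (volume : Measure (EuclideanSpace ℝ (Fin (m + 2)))).toSphere ∧
      ∫ ζ : AngSph (m + 2), ((1 - inner ℝ η (ζ : EuclideanSpace ℝ (Fin (m + 2))) : ℝ) : ℂ) ^
          (s - ((m + 1 : ℕ) / 2 : ℝ)) * f ζ
        ∂(volume : Measure (EuclideanSpace ℝ (Fin (m + 2)))).toSphere =
      -s⁻¹ * (∫ y in (0 : ℝ)..2, (y : ℂ) ^ s * dv (capProfile f) (y, η)) +
        zonalFar f (s - ((m + 1 : ℕ) / 2 : ℝ)) η 0 := by
  set q : ℂ := s - ((m + 1 : ℕ) / 2 : ℝ) with hq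
  have hmul : ∀ v : ℝ, 0 < v → (v : ℂ) ^ (((m + 1 : ℕ) / 2 : ℝ) - 1 : ℂ) * (v : ℂ) ^ q =
      (v : ℂ) ^ (s - 1) := fun v hv => by
    rw [← Complex.cpow_add _ _ (by exact_mod_cast hv.ne'), hq]
    congr 1; ring
  obtain ⟨h1, h2⟩ := integral_sphere_capBump f hη (k := fun v => (v : ℂ) ^ q) (by fun_prop) (by
    have hi : IntegrableOn (fun v : ℝ => (v : ℂ) ^ (s - 1)) (Set.Ioc 0 (1 / 2)) :=
      (intervalIntegrable_iff_integrableOn_Ioc_of_le (by norm_num)).1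
        (intervalIntegral.intervalIntegrable_cpow' (by simp; linarith))
    exact (hi.mono_set Set.Ioo_subset_Ioc_self).congr_fun (fun v hv => (hmul v hv.1).symm)
      measurableSet_Ioo)
  have h3 := integrable_zonalFar f q hη (X := 0) (by simp) (by simp)
  have e : ∀ ζ : AngSph (m + 2),
      ((1 - inner ℝ η (ζ : EuclideanSpace ℝ (Fin (m + 2))) : ℝ) : ℂ) ^ q *
        (capBump (1 - inner ℝ η (ζ : EuclideanSpace ℝ (Fin (m + 2)))) : ℂ) * f ζ +
      (0 + ((1 - inner ℝ η (ζ : EuclideanSpace ℝ (Fin (m + 2))) : ℝ) : ℂ)) ^ q *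
      ((1 - capBump (1 - inner ℝ η (ζ : EuclideanSpace ℝ (Fin (m + 2)))) : ℝ) : ℂ) * f ζ =
      ((1 - inner ℝ η (ζ : EuclideanSpace ℝ (Fin (m + 2))) : ℝ) : ℂ) ^ q * f ζ := fun ζ => by
    rw [zero_add]
    push_cast
    ring
  refine ⟨(h1.add h3).congr (Eventually.of_forall e), ?_⟩
  rw [← integral_congr_ae (Eventually.of_forall e), integral_add h1 h3, h2, zonalFar,
    ← integral_cpow_sub_one_mul (isCapFunction_capProfile f) hs η]
  congr 1
  rw [intervalIntegral.integral_of_le zero_le_one, intervalIntegral.integral_of_le zero_le_one]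
  refine setIntegral_congr_fun measurableSet_Ioc fun v hv => ?_
  simp only [← hmul v hv.1]
  ring

end Continuation

end DeSitter

end

/-! ### The coefficients on I_+. -/

noncomputable section

namespace DeSitter

open scoped SchwartzMap

/-- The area of the unit sphere. -/
theorem toSphere_real_univ (n : ℕ) (hn : 1 ≤ n) :
    (volume : Measure (EuclideanSpace ℝ (Fin n))).toSphere.real Set.univ =
      2 * Real.pi ^ (n / 2 : ℝ) / Real.Gamma (n / 2 : ℝ) := by
  have : Nonempty (Fin n) := ⟨⟨0, hn⟩⟩
  have hn' : (0 : ℝ) < n := by exact_mod_cast hn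
  have hG : 0 < Real.Gamma (n / 2 + 1 : ℝ) := Real.Gamma_pos_of_pos (by positivity)
  have hG0 : 0 < Real.Gamma (n / 2 : ℝ) := Real.Gamma_pos_of_pos (by positivity)
  have hp : √Real.pi ^ n = Real.pi ^ (n / 2 : ℝ) := by
    rw [Real.sqrt_eq_rpow, ← Real.rpow_natCast, ← Real.rpow_mul Real.pi_pos.le]
    congr 1; ring
  rw [Measure.toSphere_real_apply_univ, measureReal_def, EuclideanSpace.volume_ball]
  simp only [ENNReal.ofReal_one, one_pow, one_mul, Fintype.card_fin, finrank_euclideanSpace]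
  rw [ENNReal.toReal_ofReal (by positivity), hp, Real.Gamma_add_one (by positivity)]
  field_simp

section ScriPlus

variable {m : ℕ}

theorem tail_of_mem_scriPlus {d : ℕ} {x : Sph d} (hx : x ∈ scriPlus d) :
    (x : Mink d) 0 = (√2)⁻¹ ∧ ‖tail (x : Mink d)‖ = (√2)⁻¹ := by
  have h1 : (x : Mink d) ∈ futureCone d := hx
  have h2 := h1.1
  have h3 := h1.2
  rw [mdot_self] at h2
  have h4 : (x : Mink d) 0 = ‖tail (x : Mink d)‖ := by
    have : (x : Mink d) 0 + ‖tail (x : Mink d)‖ ≠ 0 := by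
      have := norm_nonneg (tail (x : Mink d)); linarith
    have := (mul_eq_zero.1 h2).resolve_right this
    linarith
  have h5 := norm_sq_eq_tail (x : Mink d)
  have h6 : ‖(x : Mink d)‖ = 1 := by simp
  rw [h6, ← h4] at h5
  have h7 : (x : Mink d) 0 = (√2)⁻¹ := by
    have h8 : (x : Mink d) 0 ^ 2 = ((√2)⁻¹) ^ 2 := by
      rw [inv_pow, Real.sq_sqrt zero_le_two]; linarith
    exact (pow_left_inj₀ h3.le (by positivity) two_ne_zero).1 h8
  exact ⟨h7, h4 ▸ h7⟩

theorem scriPlus_subset_scriNhd (d : ℕ) : scriPlus d ⊆ scriNhd d := by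
  intro x hx
  obtain ⟨h1, h2⟩ := tail_of_mem_scriPlus hx
  change |(x : Mink d) 0 - ‖tail (x : Mink d)‖| < ‖tail (x : Mink d)‖ / 64
  rw [h1, h2, sub_self, abs_zero]
  positivity

theorem coneRatio_of_mem_scriPlus {d : ℕ} {x : Sph d} (hx : x ∈ scriPlus d) :
    coneRatio (x : Mink d) = 0 := by
  obtain ⟨h1, h2⟩ := tail_of_mem_scriPlus hx
  rw [coneRatio, h1, h2, div_self (by positivity), sub_self]

theorem norm_tail_pos_of_mem_scriPlus {d : ℕ} {x : Sph d} (hx : x ∈ scriPlus d) :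
    0 < ‖tail (x : Mink d)‖ := by
  rw [(tail_of_mem_scriPlus hx).2]; positivity

theorem eq_scriPoint_of_mem_scriPlus {d : ℕ} {x : Sph d} (hx : x ∈ scriPlus d) :
    ∃ ζ : AngSph d, (ζ : EuclideanSpace ℝ (Fin d)) = angDir (x : Mink d) ∧
      scriPoint ζ = (x : Mink d) := by
  obtain ⟨h1, h2⟩ := tail_of_mem_scriPlus hx
  have h0 := norm_tail_pos_of_mem_scriPlus hx
  refine ⟨⟨angDir (x : Mink d), by simpa using norm_angDir h0⟩, rfl, ?_⟩
  have hs : (√2 : ℝ)⁻¹ ≠ 0 := by positivity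
  rw [scriPoint_eq, ← consPt_smul]
  change consPt _ ((√2)⁻¹ • angDir (x : Mink d)) = _
  conv_rhs => rw [← consPt_tail (x : Mink d)]
  rw [angDir, h2, h1, smul_smul, mul_inv_cancel₀ hs, one_smul, mul_one]

variable {ψ : Mink (m + 2) → ℂ} {f : 𝓢(EuclideanSpace ℝ (Fin (m + 2)), ℂ)}

/-- On I_+ both x_0 and r equal 1/√2, so r(x_0 + r) = 1 and the two factors (1/√2)^(iν - α) give
2^(α - iν). The area 2π^α/Γ(α) of the slice sphere supplies π^α and cancels the Γ(α) of
`capSingular_zero`; the remaining powers satisfy 2^(-α) · 2^(α - 1) · 2 = 1. -/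
theorem waveSingular_of_mem_scriPlus (hf : ∀ ζ : AngSph (m + 2), f ζ = ψ (scriPoint ζ)) {ν : ℝ}
    (hν : ν ≠ 0) {x : Sph (m + 2)} (hx : x ∈ scriPlus (m + 2)) :
    waveSingular f ν x = aCoeff (m + 2) ν * ψ x := by
  obtain ⟨h1, h2⟩ := tail_of_mem_scriPlus hx
  obtain ⟨ζ, hζ, hζx⟩ := eq_scriPoint_of_mem_scriPlus hx
  have h0 := norm_tail_pos_of_mem_scriPlus hx
  have hsq : (√2)⁻¹ * ((√2)⁻¹ + (√2)⁻¹) = (1 : ℝ) := by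
    have := Real.mul_self_sqrt (zero_le_two (α := ℝ))
    field_simp
    linarith
  set α : ℝ := ((m + 1 : ℕ) : ℝ) / 2 with hα
  have hα0 : 0 < α := by rw [hα]; positivity
  rw [waveSingular, coneRatio_of_mem_scriPlus hx, capSingular_zero (by omega) hν,
    capProfile_zero f (norm_angDir h0), ← hζ, hf, hζx, h1, h2, hsq, Complex.ofReal_one,
    Complex.one_cpow, one_mul, waveConst, toSphere_real_univ (m + 1) (by omega), ← hα, aCoeff,
    alpha_add_two, ← hα]
  set s : ℂ := Complex.I * (ν : ℂ) with hs
  have hpow : ((((√2)⁻¹ : ℝ) : ℂ) ^ waveExp m ν) * ((((√2)⁻¹ : ℝ) : ℂ) ^ waveExp m ν) =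
      (2 : ℂ) ^ (α : ℂ) * (2 : ℂ) ^ (-s) := by
    rw [← ofReal_mul_cpow (by positivity), ← Complex.ofReal_mul, ← mul_inv,
      Real.mul_self_sqrt zero_le_two, ← Complex.cpow_add _ _ two_ne_zero, Complex.ofReal_inv,
      Complex.ofReal_ofNat, Complex.inv_cpow _ _ (by
        rw [show (2 : ℂ) = ((2 : ℝ) : ℂ) by norm_num, Complex.arg_ofReal_of_nonneg zero_le_two]
        exact Real.pi_pos.ne), ← Complex.cpow_neg, waveExp, ← hα, ← hs]
    congr 1; ring
  have hG1 : Complex.Gamma (α : ℂ) = ((Real.Gamma α : ℝ) : ℂ) := Complex.Gamma_ofReal α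
  have hG1' : ((Real.Gamma α : ℝ) : ℂ) ≠ 0 := by
    exact_mod_cast (Real.Gamma_pos_of_pos hα0).ne'
  have hG2 : Complex.Gamma ((α : ℂ) - s) ≠ 0 :=
    Complex.Gamma_ne_zero_of_re_pos (by rw [Complex.sub_re, Complex.ofReal_re]; simp [hs, hα0])
  have e1 : ((2 : ℝ) ^ (-α) : ℝ) * (2 : ℝ) ^ (α - 1) * 2 = 1 := by
    rw [← Real.rpow_add two_pos, show -α + (α - 1) = -1 by ring, Real.rpow_neg_one]
    norm_num
  have e1' : (((2 : ℝ) ^ (-α) : ℝ) : ℂ) * (((2 : ℝ) ^ (α - 1) : ℝ) : ℂ) * 2 = 1 := by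
    exact_mod_cast congrArg (fun r : ℝ => (r : ℂ)) e1
  clear_value α
  have e2 : ((2 * Real.pi : ℝ) : ℂ) ^ (α : ℂ) = (2 : ℂ) ^ (α : ℂ) * ((Real.pi ^ α : ℝ) : ℂ) := by
    rw [Complex.ofReal_mul, Complex.mul_cpow_ofReal_nonneg zero_le_two Real.pi_pos.le,
      Complex.ofReal_cpow Real.pi_pos.le]
    norm_num
  rw [e2, hG1, neg_add_eq_sub]
  rw [Complex.ofReal_mul, Complex.ofReal_div, Complex.ofReal_mul, Complex.ofReal_ofNat]
  calc _ = ((((√2)⁻¹ : ℝ) : ℂ) ^ waveExp m ν * (((√2)⁻¹ : ℝ) : ℂ) ^ waveExp m ν) *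
        ((((2 : ℝ) ^ (-α) : ℝ) : ℂ) * (((2 : ℝ) ^ (α - 1) : ℝ) : ℂ) * 2) *
        (((Real.pi ^ α : ℝ) : ℂ) * Complex.Gamma (-s) / Complex.Gamma ((α : ℂ) - s) * ψ x) *
        (((Real.Gamma α : ℝ) : ℂ) / ((Real.Gamma α : ℝ) : ℂ)) := by ring
    _ = _ := by
      rw [hpow, e1', div_self hG1']
      ring

theorem boundaryIntegrand_eq (hf : ∀ ζ : AngSph (m + 2), f ζ = ψ (scriPoint ζ))
    {x : Sph (m + 2)} (hx : x ∈ scriPlus (m + 2)) (s : ℂ) (ζ : AngSph (m + 2)) :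
    boundaryIntegrand ψ (x : Mink (m + 2)) s ζ =
      ((((√2)⁻¹ : ℝ) : ℂ) ^ (s - ((m + 1 : ℕ) / 2 : ℝ)) *
        (‖tail (x : Mink (m + 2))‖ : ℂ) ^ (s - ((m + 1 : ℕ) / 2 : ℝ))) *
      (((1 - inner ℝ (angDir (x : Mink (m + 2))) (ζ : EuclideanSpace ℝ (Fin (m + 2))) : ℝ) : ℂ) ^
          (s - ((m + 1 : ℕ) / 2 : ℝ)) * f ζ) := by
  obtain ⟨h1, h2⟩ := tail_of_mem_scriPlus hx
  have h0 := norm_tail_pos_of_mem_scriPlus hx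
  rw [boundaryIntegrand, alpha_add_two, mdot_scriPoint, inner_angDir h0, h1, h2, hf,
    ← mul_one_sub, Complex.ofReal_mul, ofReal_mul_cpow (by positivity), Complex.ofReal_mul,
    ofReal_mul_cpow (by positivity)]
  ring

/-- The formula of `integral_zonal_of_re_pos` is holomorphic near iν because ν ≠ 0, and by
`capRegular_zero` its value there is the regular part at M = 0. -/
theorem isContinuedBoundaryIntegral_waveRegular
    (hf : ∀ ζ : AngSph (m + 2), f ζ = ψ (scriPoint ζ)) {ν : ℝ} (hν : ν ≠ 0)
    {x : Sph (m + 2)} (hx : x ∈ scriPlus (m + 2)) :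
    IsContinuedBoundaryIntegral ψ (x : Mink (m + 2)) (Complex.I * ν) (waveRegular f ν x) := by
  have h0 := norm_tail_pos_of_mem_scriPlus hx
  have hη := norm_angDir h0
  refine ⟨fun s hs => ?_, fun s => ((2 : ℝ) ^ (-alpha (m + 2)) : ℝ) *
    (((((√2)⁻¹ : ℝ) : ℂ) ^ (s - ((m + 1 : ℕ) / 2 : ℝ)) *
        (‖tail (x : Mink (m + 2))‖ : ℂ) ^ (s - ((m + 1 : ℕ) / 2 : ℝ))) *
      (-s⁻¹ * (∫ y in (0 : ℝ)..2, (y : ℂ) ^ s *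
        dv (capProfile f) (y, angDir (x : Mink (m + 2)))) +
        zonalFar f (s - ((m + 1 : ℕ) / 2 : ℝ)) (angDir (x : Mink (m + 2))) 0)), ?_, ?_, ?_⟩
  · rw [omegaMeasure]
    refine Integrable.smul_measure ?_ ENNReal.ofReal_ne_top
    rw [show boundaryIntegrand ψ (x : Mink (m + 2)) s = _ from funext (boundaryIntegrand_eq hf hx s)]
    exact (integral_zonal_of_re_pos f hη hs).1.const_mul _
  · rw [Complex.analyticAt_iff_eventually_differentiableAt]
    have hne : ∀ᶠ s : ℂ in 𝓝 (Complex.I * ν), s ≠ 0 := by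
      refine isOpen_compl_singleton.mem_nhds ?_
      simp [hν]
    have hre : ∀ᶠ s : ℂ in 𝓝 (Complex.I * ν), -1 < s.re := by
      refine (isOpen_lt continuous_const Complex.continuous_re).mem_nhds ?_
      simp
    filter_upwards [hne, hre] with s hs1 hs2
    have d1 : ∀ r : ℝ, 0 < r →
        DifferentiableAt ℂ (fun s : ℂ => (r : ℂ) ^ (s - ((m + 1 : ℕ) / 2 : ℝ))) s := fun r hr => by
      have : (r : ℂ) ≠ 0 := by exact_mod_cast hr.ne'
      exact DifferentiableAt.const_cpow (by fun_prop) (Or.inl this)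
    have d2 := differentiableAt_integral_cpow_mul (isCapFunction_capProfile f).dv hs2
      (angDir (x : Mink (m + 2)))
    have d3 := differentiable_zonalFar f hη (((m + 1 : ℕ) / 2 : ℝ) : ℂ) s
    have d4 : DifferentiableAt ℂ (fun s : ℂ => -s⁻¹) s := (differentiableAt_inv hs1).neg
    exact (((d1 _ (by positivity)).mul (d1 _ h0)).mul ((d4.mul d2).add d3)).const_mul _
  · have e : zonalFarSmooth f (waveExp m ν) (0, angDir (x : Mink (m + 2))) =
        zonalFar f (waveExp m ν) (angDir (x : Mink (m + 2))) 0 := by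
      rw [zonalFarSmooth_eq f _ hη (by norm_num), Complex.ofReal_zero]
    rw [waveRegular, coneRatio_of_mem_scriPlus hx, e,
      capRegular_zero (by omega) ν (isCapFunction_capProfile f), waveConst]
    simp only [waveExp]
    ring
  · filter_upwards [self_mem_nhdsWithin] with s hs
    simp only [boundaryIntegrand_eq hf hx]
    rw [integral_const_mul, integral_omegaMeasure, (integral_zonal_of_re_pos f hη hs).2]
    ring

end ScriPlus

end DeSitter

end

/-! ### Exchange of integrals and passage to the boundary. -/

noncomputable section

namespace DeSitter

open scoped SchwartzMap

instance (d : ℕ) : IsFiniteMeasure (omegaMeasure d) := by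
  unfold omegaMeasure
  exact Measure.smul_finite _ ENNReal.ofReal_ne_top

theorem toSphere_coord_eq_null {d : ℕ} (hd : 1 ≤ d) (a : ℝ) :
    (volume : Measure (Mink d)).toSphere {x : Sph d | (x : Mink d) 0 = a} = 0 := by
  have hs : MeasurableSet {x : Mink d | x 0 = a} := measurableSet_eq_fun (by fun_prop) (by fun_prop)
  have hs' : MeasurableSet {x : Sph d | (x : Mink d) 0 = a} := measurable_subtype_coe hs
  have h := lintegral_sphere_slice hd
    (F := {x : Mink d | x 0 = a}.indicator 1) (measurable_one.indicator hs)
  have e : (fun x : Sph d => {x : Mink d | x 0 = a}.indicator (1 : Mink d → ENNReal) x) =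
      {x : Sph d | (x : Mink d) 0 = a}.indicator 1 := rfl
  rw [e, lintegral_indicator_one hs'] at h
  rw [h]
  have h0 : ∀ᵐ c : ℝ, c ≠ a := by rw [ae_iff]; simp
  refine (lintegral_congr_ae (g := fun _ => 0) ((ae_restrict_of_ae h0).mono fun c hc => ?_)).trans
    lintegral_zero
  have : ∀ w : EuclideanSpace ℝ (Fin d),
      {x : Mink d | x 0 = a}.indicator (1 : Mink d → ENNReal) (consPt c w) = 0 := fun w => by
    rw [Set.indicator_of_notMem]
    exact hc
  simp [this]

/-- Within the neighbourhood, μ = 0 forces x ∈ I_+, hence x_0 = 1/√2, and a single slice is null.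
The pointwise limit may therefore fail there. -/
theorem ae_muFun_ne_zero {d : ℕ} (hd : 1 ≤ d) :
    ∀ᵐ x : Sph d ∂(volume : Measure (Mink d)).toSphere, x ∈ scriNhd d → muFun x ≠ 0 := by
  have h : ∀ᵐ x : Sph d ∂(volume : Measure (Mink d)).toSphere, (x : Mink d) 0 ≠ (√2)⁻¹ := by
    rw [ae_iff]
    simpa using toSphere_coord_eq_null hd _
  filter_upwards [h] with x hx hU hμ
  have h4 := norm_tail_of_mem_scriNhd hU
  have h5 := (abs_lt.1 (show |(x : Mink d) 0 - ‖tail (x : Mink d)‖| < _ from hU)).1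
  have hx1 : ‖(x : Mink d)‖ = 1 := by simp
  rw [muFun, hx1, one_pow, div_one] at hμ
  refine hx (tail_of_mem_scriPlus (x := x) ⟨hμ, ?_⟩).1
  linarith

section Fubini

variable {d : ℕ} {ψ : Mink d → ℂ} {φ : Sph d → ℂ}

theorem continuous_mdot_scriPoint :
    Continuous fun z : AngSph d × Sph d => mdot (z.2 : Mink d) (scriPoint z.1) := by
  simp only [mdot_scriPoint]
  have := continuous_tail (d := d)
  fun_prop

theorem integrable_kernel (hφ : Continuous φ)
    (hψ : Continuous fun ζ : AngSph d => ψ (scriPoint ζ)) (p : ℂ) (ε : ℤˣ) {t : ℝ} (ht : 0 < t) :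
    Integrable (fun z : AngSph d × Sph d =>
      (mdot (fun i => (((z.2 : Mink d) i : ℝ) : ℂ) + Complex.I * ((axisPt d ε t i : ℝ) : ℂ))
        (fun i => ((scriPoint z.1 i : ℝ) : ℂ))) ^ p * φ z.2 * ψ (scriPoint z.1))
      ((omegaMeasure d).prod (volume : Measure (Mink d)).toSphere) := by
  have hT : sgn ε * t * (√2)⁻¹ ≠ 0 := by
    have := sgn_ne_zero ε
    positivity
  have hc : Continuous fun z : AngSph d × Sph d =>
      (mdot (fun i => (((z.2 : Mink d) i : ℝ) : ℂ) + Complex.I * ((axisPt d ε t i : ℝ) : ℂ))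
        (fun i => ((scriPoint z.1 i : ℝ) : ℂ))) ^ p * φ z.2 * ψ (scriPoint z.1) := by
    refine (Continuous.mul ?_ (hφ.comp continuous_snd)).mul (hψ.comp continuous_fst)
    simp only [mdot_complex, mdot_axisPt, scriPoint_zero]
    exact continuous_ofReal_add_I_cpow continuous_mdot_scriPoint hT p
  exact hc.integrable_of_hasCompactSupport (HasCompactSupport.of_compactSpace _)

/-- Exchange of the integrals over `I_+` and over the sphere, inside the tube. -/
theorem integral_tubePairing_mul (hφ : Continuous φ)
    (hψ : Continuous fun ζ : AngSph d => ψ (scriPoint ζ)) (p : ℂ) (ε : ℤˣ) {t : ℝ} (ht : 0 < t) :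
    ∫ ζ : AngSph d, tubePairing p (scriPoint ζ) φ (axisPt d ε t) * ψ (scriPoint ζ)
        ∂(omegaMeasure d) =
      ∫ x : Sph d, waveIntegral ψ p x (axisPt d ε t) * φ x
        ∂(volume : Measure (Mink d)).toSphere := by
  have h := integral_integral_swap (f := fun (ζ : AngSph d) (x : Sph d) =>
    (mdot (fun i => (((x : Mink d) i : ℝ) : ℂ) + Complex.I * ((axisPt d ε t i : ℝ) : ℂ))
      (fun i => ((scriPoint ζ i : ℝ) : ℂ))) ^ p * φ x * ψ (scriPoint ζ)) (integrable_kernel hφ hψ p ε ht)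
  simp only [tubePairing, waveIntegral, ← integral_mul_const]
  refine h.trans (integral_congr_ae (Eventually.of_forall fun x => ?_))
  refine integral_congr_ae (Eventually.of_forall fun ζ => ?_)
  simp only
  ring

theorem aestronglyMeasurable_tubePairing_mul (hφ : Continuous φ)
    (hψ : Continuous fun ζ : AngSph d => ψ (scriPoint ζ)) (p : ℂ) (ε : ℤˣ) {t : ℝ} (ht : 0 < t) :
    AEStronglyMeasurable (fun ζ : AngSph d =>
      tubePairing p (scriPoint ζ) φ (axisPt d ε t) * ψ (scriPoint ζ)) (omegaMeasure d) := by
  simp only [tubePairing, ← integral_mul_const]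
  exact (integrable_kernel hφ hψ p ε ht).integral_prod_left.1

theorem aestronglyMeasurable_waveIntegral_mul (hφ : Continuous φ)
    (hψ : Continuous fun ζ : AngSph d => ψ (scriPoint ζ)) (p : ℂ) (ε : ℤˣ) {t : ℝ} (ht : 0 < t) :
    AEStronglyMeasurable (fun x : Sph d => waveIntegral ψ p x (axisPt d ε t) * φ x)
      (volume : Measure (Mink d)).toSphere := by
  simp only [waveIntegral, ← integral_mul_const]
  refine (integrable_kernel hφ hψ p ε ht).integral_prod_right.1.congr
    (Eventually.of_forall fun x => ?_)
  refine integral_congr_ae (Eventually.of_forall fun ζ => ?_)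
  simp only
  ring

end Fubini

theorem eventually_mem_Ioc : ∀ᶠ t : ℝ in 𝓝[>] 0, 0 < t ∧ t ≤ 1 :=
  mem_of_superset (Ioc_mem_nhdsGT one_pos) fun _ ht => ht

variable {m : ℕ} {ψ : Mink (m + 2) → ℂ} {f : 𝓢(EuclideanSpace ℝ (Fin (m + 2)), ℂ)}

/-- The smooth part of the asymptotics at `I_+`. -/
def outerRegular (f : 𝓢(EuclideanSpace ℝ (Fin (m + 2)), ℂ)) (ν : ℝ) (x : Sph (m + 2)) : ℂ :=
  (coneCut (x : Mink (m + 2)) : ℂ) * waveRegular f ν x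

/-- The coefficient of the singular power in the asymptotics at `I_+`. -/
def outerSingular (f : 𝓢(EuclideanSpace ℝ (Fin (m + 2)), ℂ)) (ν : ℝ) (x : Sph (m + 2)) : ℂ :=
  (coneCut (x : Mink (m + 2)) : ℂ) * waveSingular f ν x

theorem smoothOnSphere_outerRegular (f : 𝓢(EuclideanSpace ℝ (Fin (m + 2)), ℂ)) (ν : ℝ) :
    SmoothOnSphere (outerRegular f ν) :=
  smoothOnSphere_of_contDiffAt fun _ hx =>
    contDiffAt_coneCut_mul (fun _ h0 _ => contDiffAt_waveRegular ν h0) hx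

theorem smoothOnSphere_outerSingular (f : 𝓢(EuclideanSpace ℝ (Fin (m + 2)), ℂ)) (ν : ℝ) :
    SmoothOnSphere (outerSingular f ν) :=
  smoothOnSphere_of_contDiffAt fun _ hx =>
    contDiffAt_coneCut_mul (fun x h0 h1 => contDiffAt_waveSingular ν h0 (by
      have := (abs_lt.1 h1).1
      linarith)) hx

theorem coneCut_of_mem_scriNhd {d : ℕ} {x : Sph d} (hx : x ∈ scriNhd d) :
    coneCut (x : Mink d) = 1 := by
  have h := norm_tail_of_mem_scriNhd hx
  exact coneCut_eq_one (by linarith)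
    (le_of_lt (show |(x : Mink d) 0 - ‖tail (x : Mink d)‖| < _ from hx))

theorem outerRegular_of_mem {ν : ℝ} {x : Sph (m + 2)} (hx : x ∈ scriNhd (m + 2)) :
    outerRegular f ν x = waveRegular f ν x := by
  rw [outerRegular, coneCut_of_mem_scriNhd hx, Complex.ofReal_one, one_mul]

theorem outerSingular_of_mem {ν : ℝ} {x : Sph (m + 2)} (hx : x ∈ scriNhd (m + 2)) :
    outerSingular f ν x = waveSingular f ν x := by
  rw [outerSingular, coneCut_of_mem_scriNhd hx, Complex.ofReal_one, one_mul]

/-- The smeared plane wave near `I_+`. -/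
theorem integral_spherePlaneWave_mul (hf : ∀ ζ : AngSph (m + 2), f ζ = ψ (scriPoint ζ)) (ε : ℤˣ)
    {ν : ℝ} (hν : ν ≠ 0) {φ : Sph (m + 2) → ℂ} (hφ : SmoothOnSphere φ)
    (hsupp : tsupport φ ⊆ scriNhd (m + 2)) :
    Integrable (fun ζ : AngSph (m + 2) =>
        spherePlaneWave ε (waveExp m ν) (scriPoint ζ) φ * ψ (scriPoint ζ)) (omegaMeasure (m + 2)) ∧
      ∫ ζ : AngSph (m + 2), spherePlaneWave ε (waveExp m ν) (scriPoint ζ) φ * ψ (scriPoint ζ)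
          ∂(omegaMeasure (m + 2)) =
        ∫ x : Sph (m + 2), (outerRegular f ν x + i0Pow ε ν (muFun x) * outerSingular f ν x) * φ x
          ∂(volume : Measure (Mink (m + 2))).toSphere := by
  have hp : (waveExp m ν).im ≠ 0 := by rwa [waveExp_im]
  have hφc : Continuous φ := hφ.continuous
  have hψc : Continuous fun ζ : AngSph (m + 2) => ψ (scriPoint ζ) := by
    simp only [← hf]
    exact f.continuous.comp continuous_subtype_val
  obtain ⟨Cf, hCf⟩ := schwartz_exists_bound f
  obtain ⟨C, hC⟩ := exists_norm_tubePairing_le (d := m + 2) (by omega) hp ε hφ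
  obtain ⟨C', hC'⟩ := exists_norm_waveIntegral_le hf ε hν
  have hlim : ∀ ζ : AngSph (m + 2), Tendsto
      (fun t => tubePairing (waveExp m ν) (scriPoint ζ) φ (axisPt (m + 2) ε t) * ψ (scriPoint ζ))
      (𝓝[>] 0) (𝓝 (spherePlaneWave ε (waveExp m ν) (scriPoint ζ) φ * ψ (scriPoint ζ))) :=
    fun ζ => ((tendsto_tubePairing (by omega) hp ε (scriPoint_mem_futureCone ζ) hφ).comp
      (tendsto_axisPt ε)).mul_const _
  have hbd : ∀ t : ℝ, 0 < t → t ≤ 1 → ∀ ζ : AngSph (m + 2),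
      ‖tubePairing (waveExp m ν) (scriPoint ζ) φ (axisPt (m + 2) ε t) * ψ (scriPoint ζ)‖ ≤
        C * Cf := fun t h0 h1 ζ => by
    rw [norm_mul]
    have h2 := hC ζ t h0 h1
    exact mul_le_mul h2 (hf ζ ▸ hCf _) (norm_nonneg _) ((norm_nonneg _).trans h2)
  -- The plane wave is only known as a limit, so its measurability in ξ is inherited from the
  -- sequence t = 1/(k + 1).
  have hmeas : AEStronglyMeasurable (fun ζ : AngSph (m + 2) =>
      spherePlaneWave ε (waveExp m ν) (scriPoint ζ) φ * ψ (scriPoint ζ))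
      (omegaMeasure (m + 2)) := by
    refine aestronglyMeasurable_of_tendsto_ae (u := atTop) (f := fun (k : ℕ) ζ =>
      tubePairing (waveExp m ν) (scriPoint ζ) φ (axisPt (m + 2) ε (1 / ((k : ℝ) + 1))) *
        ψ (scriPoint ζ)) (fun k => aestronglyMeasurable_tubePairing_mul hφc hψc _ ε (by positivity))
      (Eventually.of_forall fun ζ => (hlim ζ).comp ?_)
    exact tendsto_nhdsWithin_iff.2 ⟨tendsto_one_div_add_atTop_nhds_zero_nat,
      Eventually.of_forall fun k => by simp only [Set.mem_Ioi]; positivity⟩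
  refine ⟨Integrable.of_bound hmeas (C * Cf) (Eventually.of_forall fun ζ => ?_), ?_⟩
  · refine le_of_tendsto (hlim ζ).norm ?_
    filter_upwards [eventually_mem_Ioc] with t ht using hbd t ht.1 ht.2 ζ
  -- Let t → 0 on both sides of the Fubini identity. On the ξ side the domination is
  -- `exists_norm_tubePairing_le`; on the x side it is `exists_norm_waveIntegral_le`, which holds on
  -- `scriNhd`, where φ is supported.
  have h1 : Tendsto (fun t => ∫ ζ : AngSph (m + 2),
      tubePairing (waveExp m ν) (scriPoint ζ) φ (axisPt (m + 2) ε t) * ψ (scriPoint ζ)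
        ∂(omegaMeasure (m + 2))) (𝓝[>] 0) (𝓝 (∫ ζ : AngSph (m + 2),
        spherePlaneWave ε (waveExp m ν) (scriPoint ζ) φ * ψ (scriPoint ζ)
          ∂(omegaMeasure (m + 2)))) := by
    refine tendsto_integral_filter_of_dominated_convergence (fun _ => C * Cf) ?_ ?_
      (integrable_const _) (Eventually.of_forall hlim)
    · filter_upwards [eventually_mem_Ioc] with t ht
      exact aestronglyMeasurable_tubePairing_mul hφc hψc _ ε ht.1
    · filter_upwards [eventually_mem_Ioc] with t ht
      exact Eventually.of_forall (hbd t ht.1 ht.2)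
  have h2 : Tendsto (fun t => ∫ x : Sph (m + 2),
      waveIntegral ψ (waveExp m ν) x (axisPt (m + 2) ε t) * φ x
        ∂(volume : Measure (Mink (m + 2))).toSphere) (𝓝[>] 0) (𝓝 (∫ x : Sph (m + 2),
        (outerRegular f ν x + i0Pow ε ν (muFun x) * outerSingular f ν x) * φ x
          ∂(volume : Measure (Mink (m + 2))).toSphere)) := by
    have hzero : ∀ x : Sph (m + 2), x ∉ scriNhd (m + 2) → φ x = 0 := fun x hx =>
      image_eq_zero_of_notMem_tsupport fun h => hx (hsupp h)
    refine tendsto_integral_filter_of_dominated_convergence (fun x => C' * ‖φ x‖) ?_ ?_ ?_ ?_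
    · filter_upwards [eventually_mem_Ioc] with t ht
      exact aestronglyMeasurable_waveIntegral_mul hφc hψc _ ε ht.1
    · filter_upwards [eventually_mem_Ioc] with t ht
      refine Eventually.of_forall fun x => ?_
      by_cases hx : x ∈ scriNhd (m + 2)
      · rw [norm_mul]
        gcongr
        exact hC' x hx t ht.1 ht.2
      · rw [hzero x hx]; simp
    · exact (hφc.norm.integrable_of_hasCompactSupport
        (HasCompactSupport.of_compactSpace _)).const_mul _
    · filter_upwards [ae_muFun_ne_zero (d := m + 2) (by omega)] with x hμ
      by_cases hx : x ∈ scriNhd (m + 2)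
      · rw [outerRegular_of_mem hx, outerSingular_of_mem hx]
        exact (tendsto_waveIntegral hf ε hν hx (hμ hx)).mul_const _
      · rw [hzero x hx]; simp
  refine tendsto_nhds_unique h1 (h2.congr' ?_)
  filter_upwards [eventually_mem_Ioc] with t ht
  exact (integral_tubePairing_mul hφc hψc _ ε ht.1).symm

end DeSitter

end

theorem mainTheorem5 (d : ℕ) (hd : 2 ≤ d) (ν : ℝ) (hν : ν ≠ 0) (ε : ℤˣ) :
    -- the sphere plane waves exist as boundary values in the sense of distributions on `S^d`
    (∀ ξ ∈ DeSitter.futureCone d, ∀ φ : DeSitter.Sph d → ℂ, DeSitter.SmoothOnSphere φ →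
      Tendsto (DeSitter.tubePairing (Complex.I * (ν : ℂ) - (DeSitter.alpha d : ℂ)) ξ φ)
        (𝓝[DeSitter.tubeCone d ε] 0)
        (𝓝 (DeSitter.spherePlaneWave ε
          (Complex.I * (ν : ℂ) - (DeSitter.alpha d : ℂ)) ξ φ))) ∧
    -- the asymptotics near `I_+`, after smearing in `ξ`
    ∃ U : Set (DeSitter.Sph d), IsOpen U ∧ DeSitter.scriPlus d ⊆ U ∧
      ∀ ψ : DeSitter.Mink d → ℂ,
        DeSitter.IsSmoothHomogeneous d (-(Complex.I * (ν : ℂ)) - (DeSitter.alpha d : ℂ)) ψ →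
        ∃ u₀ u₁ : DeSitter.Sph d → ℂ,
          DeSitter.SmoothOnSphere u₀ ∧ DeSitter.SmoothOnSphere u₁ ∧
          (∀ φ : DeSitter.Sph d → ℂ, DeSitter.SmoothOnSphere φ → tsupport φ ⊆ U →
            Integrable (fun ζ : DeSitter.AngSph d =>
              DeSitter.spherePlaneWave ε (Complex.I * (ν : ℂ) - (DeSitter.alpha d : ℂ))
                (DeSitter.scriPoint ζ) φ * ψ (DeSitter.scriPoint ζ))
              (DeSitter.omegaMeasure d) ∧
            ∫ ζ : DeSitter.AngSph d,
              DeSitter.spherePlaneWave ε (Complex.I * (ν : ℂ) - (DeSitter.alpha d : ℂ))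
                (DeSitter.scriPoint ζ) φ * ψ (DeSitter.scriPoint ζ)
              ∂(DeSitter.omegaMeasure d) =
            ∫ x : DeSitter.Sph d,
              (u₀ x + DeSitter.i0Pow ε ν (DeSitter.muFun x) * u₁ x) * φ x
              ∂(volume : Measure (DeSitter.Mink d)).toSphere) ∧
          -- the leading coefficients on `I_+`, where `ξ_+(x) = x`
          (∀ x ∈ DeSitter.scriPlus d,
            DeSitter.IsContinuedBoundaryIntegral ψ (x : DeSitter.Mink d)
              (Complex.I * (ν : ℂ)) (u₀ x)) ∧
          (∀ x ∈ DeSitter.scriPlus d,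
            u₁ x = DeSitter.aCoeff d ν * ψ (x : DeSitter.Mink d)) := by
  -- With d = m + 2 the directions ζ lie in ℝ^(m+2) and the slices of their sphere in ℝ^(m+1), which
  -- has positive dimension; this is where d ≥ 2 is needed.
  obtain ⟨m, rfl⟩ : ∃ m, d = m + 2 := ⟨d - 2, by omega⟩
  rw [← DeSitter.waveExp_eq]
  have hp : (DeSitter.waveExp m ν).im ≠ 0 := by rwa [DeSitter.waveExp_im]
  refine ⟨fun ξ hξ φ hφ => DeSitter.tendsto_tubePairing (by omega) hp ε hξ hφ,
    DeSitter.scriNhd (m + 2), DeSitter.isOpen_scriNhd _, DeSitter.scriPlus_subset_scriNhd _,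
    fun ψ hψ => ?_⟩
  obtain ⟨f, hf⟩ := DeSitter.exists_schwartz_scriPoint hψ
  refine ⟨DeSitter.outerRegular f ν, DeSitter.outerSingular f ν,
    DeSitter.smoothOnSphere_outerRegular f ν, DeSitter.smoothOnSphere_outerSingular f ν,
    fun φ hφ hs => DeSitter.integral_spherePlaneWave_mul hf ε hν hφ hs, fun x hx => ?_,
    fun x hx => ?_⟩
  · rw [DeSitter.outerRegular_of_mem (DeSitter.scriPlus_subset_scriNhd _ hx)]
    exact DeSitter.isContinuedBoundaryIntegral_waveRegular hf hν hx
  · rw [DeSitter.outerSingular_of_mem (DeSitter.scriPlus_subset_scriNhd _ hx)]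
    exact DeSitter.waveSingular_of_mem_scriPlus hf hν hx
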